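/- **Setting.** Let $d\in\{2,3\}$. A polyhedral cluster $\Gamma=(\Gamma_1,\dots,\Gamma_{I_S})$, $I_S\ge1$, consists of oriented polyhedral hypersurfaces in $\mathbb R^d$. Each $\Gamma_i=X_i(\Omega_i^h)$ is the image of a fixed, coherently oriented triangulation $\Omega_i^h$ (flat or a hypersurface; each $(d-2)$-face lies in at most two simplices) under a continuous map $X_i$ that is affine on each $(d-1)$-simplex. The boundary of $\Omega^h_i$ is partitioned into pieces. Each piece is exactly one of the three sides, on surfaces $s^k_1<s^k_2<s^k_3$, of exactly one triple junction line $\mathcal T_k$ ($1\le k\le I_T$), or it is the side, on a surface $s_k$, of exactly one boundary line $\mathcal B_k$ ($1\le k\le I_B$). The vertices and faces of the three sides of $\mathcal T_k$ are matched with each other. Signs $o^k_j\in\{1,-1\}$ are given such that $(o^k_j\nu_{s^k_j},\mu_{s^k_j})$, $j=1,2,3$, have the same orientation in the plane orthogonal to $\mathcal T_k$, where $\nu$ is the normal and $\mu$ the outward conormal. The line $\mathcal B_k$ is attached to a plane $\mathcal D_k=\{x: n_k\cdot x=c_k\}$, $|n_k|=1$. On continuous piecewise affine functions (determined by their nodal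 values) define $$W^h=\Big\{\chi:\textstyle\sum_{j=1}^3 o^k_j\chi_{s^k_j}=0\text{ on }\mathcal T_k\ \forall k\Big\},\qquad V^h=\{\vec\chi:\vec\chi_{s^k_1}=\vec\chi_{s^k_2}=\vec\chi_{s^k_3}\text{ on }\mathcal T_k\ \forall k\},$$ $$V^h_\partial=\{\vec\chi\in V^h: n_k\cdot\vec\chi_{s_k}=0\text{ at the vertices of }\mathcal B_k\ \forall k\}.$$ For a simplex $\sigma$ with ordered vertices $q_0,\dots,q_{d-1}$ let $A\{\sigma\}=(q_1-q_0)\wedge\dots\wedge(q_{d-1}-q_0)$, $|\sigma|=|A\{\sigma\}|/(d-1)!$ and $\nu=A\{\sigma\}/|A\{\sigma\}|$. Let $\langle\cdot,\cdot\rangle_\Gamma$ be the $L^2$ inner product on $\Gamma$, let $\langle u,v\rangle_\Gamma^h=\sum_i\frac1d\sum_{\sigma\subset\Gamma_i}|\sigma|\sum_{k=0}^{d-1}(u\cdot v)|_\sigma(q_k)$, and let $\nabla_s$ be the surface gradient. **Anisotropy.** Let $r\in[1,\infty)$, $L\ge1$, let $G_1,\dots,G_L\in\mathbb R^{d\times d}$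 be symmetric positive definite, and put $\gamma_\ell(p)=\sqrt{p\cdot G_\ell p}$, $\gamma(p)=\big(\sum_{\ell}\gamma_\ell(p)^r\big)^{1/r}$, $\widetilde G_\ell=(\det G_\ell)^{1/(d-1)}G_\ell^{-1}$, $(u,v)_{\widetilde G_\ell}=u\cdot\widetilde G_\ell v$, and $A_\gamma(\Gamma)=\sum_i\int_{\Gamma_i}\gamma(\nu_i)\,d\mathscr H^{d-1}$. With $t^\ell_1,\dots,t^\ell_{d-1}$ a $\widetilde G_\ell$-orthonormal basis of the tangent plane of $\Gamma_i^m$, put $(\nabla_s^{\widetilde G_\ell}\eta,\nabla_s^{\widetilde G_\ell}\chi)_{\widetilde G_\ell}=\sum_{j=1}^{d-1}(\partial_{t^\ell_j}\eta,\partial_{t^\ell_j}\chi)_{\widetilde G_\ell}$ and $$\langle\nabla_s^{\widetilde G}\eta,\nabla_s^{\widetilde G}\chi\rangle_{\gamma,\Gamma^m}=\sum_i\sum_{\ell=1}^L\int_{\Gamma^m_i}\Big[\frac{\gamma_\ell(\nu_i^{m+1})}{\gamma(\nu_i^{m+1})}\Big]^{r-1}(\nabla_s^{\widetilde G_\ell}\eta_i,\nabla_s^{\widetilde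 G_\ell}\chi_i)_{\widetilde G_\ell}\,\gamma_\ell(\nu^m_i)\,d\mathscr H^{d-1}.$$ **Scheme.** Let $t_m<t_{m+1}$, $\Delta t_m=t_{m+1}-t_m$. Let $\Gamma^m$ be a polyhedral cluster whose simplices are nondegenerate, whose sides at each $\mathcal T_k$ coincide, and with $\mathcal B_k\subset\mathcal D_k$ for all $k$. A solution is a pair $(X^{m+1},\kappa_\gamma^{m+1})\in V^h\times W^h$ with $X^{m+1}-\mathrm{id}|_{\Gamma^m}\in V^h_\partial$ and $$\tfrac1{\Delta t_m}\langle X^{m+1}-\mathrm{id},\chi\,\nu^{m+1/2}\rangle^h_{\Gamma^m}-\langle\nabla_s\kappa_\gamma^{m+1},\nabla_s\chi\rangle_{\Gamma^m}=0\quad\forall\chi\in W^h,$$ $$\langle\kappa_\gamma^{m+1}\nu^{m+1/2},\eta\rangle^h_{\Gamma^m}+\langle\nabla_s^{\widetilde G}X^{m+1},\nabla_s^{\widetilde G}\eta\rangle_{\gamma,\Gamma^m}=0\quad\forall\eta\in V^h_\partial,$$ where $\nu^{m+1/2}|_{\sigma}=\frac1{\Delta t_m|A\{\sigma\}|}\int_{t_m}^{t_{m+1}}A\{\sigma(t)\}\,dt$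 for each simplex $\sigma$ of $\Gamma^m$, and the vertices of $\sigma(t)$ interpolate linearly in time between those of $\sigma$ and those of $X^{m+1}(\sigma)$. Put $\Gamma^{m+1}=X^{m+1}(\Gamma^m)$ and let $\nu^{m+1}$ be its normal. **Enclosed regions.** A region $\mathcal R$ is specified by a set $\mathcal I_\Gamma$ of surfaces, signs $o^{\mathcal R}_i\in\{1,-1\}$, a set $\mathcal I_{\mathcal D}$ of planes that contains every $k$ with $s_k\in\mathcal I_\Gamma$, and a fixed convex open set $B\subseteq\mathbb R^d$ ($B=\mathbb R^d$ allowed) whose boundary is a possible additional fixed hypersurface that makes the volume finite. Put $K=B\cap\{x:n_k\cdot x>c_k\ \forall k\in\mathcal I_{\mathcal D}\}$. A nonempty bounded open set $\mathcal R[\Gamma]\subseteq K$ is a region so specified and enclosed by $\Gamma$ if: * the cluster $\Gamma$ is embedded, i.e. different points of the reference domains have the same image only if they are identified at triple junction lines; * the surfaces $\Gamma_i$, $i\in\mathcal I_\Gamma$, lie in $B\cap\{x:n_k\cdot x\ge c_k\ \forall k\in\mathcal I_{\mathcal D}\}$, and no $(d-2)$-face of their triple junction lines lies in a plane $\mathcal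 D_k$, $k\in\mathcal I_{\mathcal D}$; * $\partial\mathcal R[\Gamma]\cap K=\bigcup_{i\in\mathcal I_\Gamma}\Gamma_i\cap K$; * $o^{\mathcal R}_i\nu_i$ is the outer normal to $\mathcal R[\Gamma]$ on the open simplices of $\Gamma_i$, $i\in\mathcal I_\Gamma$. **Theorem.** Every solution $(X^{m+1},\kappa_\gamma^{m+1})$ of the scheme satisfies $$A_\gamma(\Gamma^{m+1})+\Delta t_m\langle\nabla_s\kappa_\gamma^{m+1},\nabla_s\kappa_\gamma^{m+1}\rangle_{\Gamma^m}\le A_\gamma(\Gamma^m).$$ Moreover, for each choice of the data $(\mathcal I_\Gamma,o^{\mathcal R},\mathcal I_{\mathcal D},B)$, if $\mathcal R[\Gamma^m]$ and $\mathcal R[\Gamma^{m+1}]$ are regions with these data enclosed by $\Gamma^m$ and by $\Gamma^{m+1}$, then $\operatorname{vol}(\mathcal R[\Gamma^{m+1}])=\operatorname{vol}(\mathcal R[\Gamma^m])$, where $\operatorname{vol}$ is Lebesgue measure. -/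

import Mathlib

open scoped Matrix Nat Topology

noncomputable section

namespace SurfaceCluster

/-- The ambient space `ℝ^d` with its Euclidean structure, where `d = n + 1`. Hypersurfaces are
`n`-dimensional. -/
abbrev E (n : ℕ) : Type := EuclideanSpace ℝ (Fin (n + 1))

/-! ### Simplices in `ℝ^d` -/

/-- The wedge product `u₁ ∧ ⋯ ∧ u_{d-1} ∈ ℝ^d`: the vector `w` with
`w · x = det (x, u₁, …, u_{d-1})`. It is the cross product for `d = 3` and a rotation by a right
angle for `d = 2`. -/
def wedge {n : ℕ} (u : Fin n → E n) : E n :=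
  WithLp.toLp 2 fun c =>
    Matrix.det (Matrix.of (Fin.cons (Pi.single c 1) (fun k => (u k).ofLp) :
      Fin (n + 1) → Fin (n + 1) → ℝ))

/-- The edge vectors `q_k - q_0`, `k = 1, …, d - 1`. -/
def edge {n : ℕ} (q : Fin (n + 1) → E n) (k : Fin n) : E n := q k.succ - q 0

/-- The orientation vector `A{σ}` of the simplex with ordered vertices `q`. -/
def orientVec {n : ℕ} (q : Fin (n + 1) → E n) : E n := wedge (edge q)

/-- The `(d-1)`-dimensional measure `|σ| = |A{σ}| / (d-1)!` of a simplex. -/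
def area {n : ℕ} (q : Fin (n + 1) → E n) : ℝ := ‖orientVec q‖ / (n ! : ℝ)

/-- The unit normal `A{σ} / |A{σ}|` of a simplex. -/
def unitNormal {n : ℕ} (q : Fin (n + 1) → E n) : E n := ‖orientVec q‖⁻¹ • orientVec q

/-- The time-weighted normal
`(Δt |A{σ}|)⁻¹ ∫_{t₀}^{t₁} A{σ(t)} dt`, where `σ(t)` interpolates linearly between the simplex `q`
at time `t₀` and the simplex `q'` at time `t₁`. -/
def weightedNormal {n : ℕ} (t₀ t₁ : ℝ) (q q' : Fin (n + 1) → E n) : E n :=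
  ((t₁ - t₀) * ‖orientVec q‖)⁻¹ •
    ∫ t in t₀..t₁, orientVec fun k =>
      ((t₁ - t) / (t₁ - t₀)) • q k + ((t - t₀) / (t₁ - t₀)) • q' k

/-- The relatively open simplex with vertices `q`. -/
def openSimplex {n : ℕ} (q : Fin (n + 1) → E n) : Set (E n) :=
  {x | ∃ w : Fin (n + 1) → ℝ, (∀ k, 0 < w k) ∧ ∑ k, w k = 1 ∧ x = ∑ k, w k • q k}

/-- The surface gradient `∇_s g = g^{ab} ∂_b g ∂_a x` on the simplex with vertices `q` of the
affine function with vertex values `f`, where `g^{ab}` is the inverse of the first fundamental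
form. -/
def surfGrad {n : ℕ} (q : Fin (n + 1) → E n) (f : Fin (n + 1) → ℝ) : E n :=
  ∑ a, (∑ b, (Matrix.gram ℝ (edge q))⁻¹ a b * (f b.succ - f 0)) • edge q a

/-- The directional derivative `∂_t η` (component by component `∇_s η_c · t`) of the affine vector
field with vertex values `η`. -/
def dirDeriv {n : ℕ} (q : Fin (n + 1) → E n) (η : Fin (n + 1) → E n) (t : E n) : E n :=
  WithLp.toLp 2 fun c => inner ℝ (surfGrad q fun k => η k c) t

/-- On a nondegenerate simplex the surface gradient has the right derivatives along the edges. -/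
theorem inner_surfGrad_edge {n : ℕ} (q : Fin (n + 1) → E n) (hq : AffineIndependent ℝ q)
    (f : Fin (n + 1) → ℝ) (c : Fin n) :
    inner ℝ (surfGrad q f) (edge q c) = f c.succ - f 0 := by
  have hli : LinearIndependent ℝ (edge q) := by
    have h := (affineIndependent_iff_linearIndependent_vsub ℝ q 0).1 hq
    exact h.comp (fun k : Fin n => (⟨k.succ, Fin.succ_ne_zero k⟩ : {x // x ≠ (0 : Fin (n + 1))}))
      (fun a b hab => by simpa using hab)
  have hdet : IsUnit (Matrix.gram ℝ (edge q)).det :=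
    ((Matrix.posDef_gram_of_linearIndependent hli).isUnit).map Matrix.detMonoidHom
  have key : (Matrix.gram ℝ (edge q)) *ᵥ
      ((Matrix.gram ℝ (edge q))⁻¹ *ᵥ fun b => f b.succ - f 0) = fun b => f b.succ - f 0 := by
    rw [Matrix.mulVec_mulVec, Matrix.mul_nonsing_inv _ hdet, Matrix.one_mulVec]
  have h := congrFun key c
  rw [← h]
  simp only [surfGrad, sum_inner, real_inner_smul_left, Matrix.mulVec, dotProduct,
    Matrix.gram_apply]
  refine Finset.sum_congr rfl fun a _ => ?_
  rw [mul_comm, real_inner_comm]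

/-! ### Anisotropies -/

/-- The data of an anisotropy `γ(p) = (∑_ℓ (p · G_ℓ p)^{r/2})^{1/r}` on `ℝ^d`. -/
structure Anisotropy (n : ℕ) where
  L : ℕ
  L_pos : 0 < L
  r : ℝ
  one_le_r : 1 ≤ r
  G : Fin L → Matrix (Fin (n + 1)) (Fin (n + 1)) ℝ
  posDef : ∀ l, (G l).PosDef

/-- `(u, v)_M = u · M v`. -/
def mInner {n : ℕ} (M : Matrix (Fin (n + 1)) (Fin (n + 1)) ℝ) (u v : E n) : ℝ :=
  u.ofLp ⬝ᵥ (M *ᵥ v.ofLp)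

namespace Anisotropy

variable {n : ℕ} (g : Anisotropy n)

/-- `γ_ℓ(p) = √(p · G_ℓ p)`. -/
def gammaPart (l : Fin g.L) (p : E n) : ℝ := √(mInner (g.G l) p p)

/-- `γ(p) = (∑_ℓ γ_ℓ(p)^r)^{1/r}`. -/
def gamma (p : E n) : ℝ := (∑ l, g.gammaPart l p ^ g.r) ^ (1 / g.r)

/-- `G̃_ℓ = (det G_ℓ)^{1/(d-1)} G_ℓ⁻¹`. -/
def Gtilde (l : Fin g.L) : Matrix (Fin (n + 1)) (Fin (n + 1)) ℝ :=
  ((g.G l).det ^ (1 / (n : ℝ))) • (g.G l)⁻¹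

end Anisotropy

/-- `t₁, …, t_{d-1}` is a basis of the tangent plane of the simplex `q` that is orthonormal for the
inner product `(·, ·)_M`. -/
structure IsTangentFrame {n : ℕ} (M : Matrix (Fin (n + 1)) (Fin (n + 1)) ℝ)
    (q : Fin (n + 1) → E n) (t : Fin n → E n) : Prop where
  tangent : ∀ j, inner ℝ (t j) (unitNormal q) = 0
  orthonormal : ∀ j k, mInner M (t j) (t k) = if j = k then 1 else 0

/-! ### Triangulated reference domains of a surface cluster -/

/-- A triangulation of the reference domains `Ω_i` of a cluster of hypersurfaces, with the
combinatorics of its triple junction lines and its boundary lines. The triangulations are abstract,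
so that the reference domains may be flat domains of `ℝ^{d-1}` as well as hypersurfaces. -/
structure ClusterMesh (n : ℕ) where
  /-- number of surfaces -/
  numSurf : ℕ
  numSurf_pos : 0 < numSurf
  /-- number of vertices of each surface -/
  numVtx : Fin numSurf → ℕ
  /-- number of `(d-1)`-simplices of each surface -/
  numSimp : Fin numSurf → ℕ
  /-- the ordered vertices of each simplex -/
  vert : ∀ i, Fin (numSimp i) → Fin (n + 1) → Fin (numVtx i)
  vert_injective : ∀ i a, Function.Injective (vert i a)
  /-- different simplices have different vertex sets -/
  simp_injective : ∀ i, Function.Injective fun a => Set.range (vert i a)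
  /-- each vertex belongs to a simplex -/
  vert_cover : ∀ i v, ∃ a, v ∈ Set.range (vert i a)
  /-- at most two simplices of a surface meet in a common facet -/
  facet_le_two : ∀ i (F : Finset (Fin (numVtx i))), F.card = n →
    Set.ncard {a | (F : Set (Fin (numVtx i))) ⊆ Set.range (vert i a)} ≤ 2
  /-- The simplices of a surface are ordered with the same orientation: if a neighbour `b` of `a`
  is obtained by replacing the `k`-th vertex of `a` by another vertex, then this replacement
  reverses the orientation. -/
  coherent : ∀ i (a b : Fin (numSimp i)) (k : Fin (n + 1)) (w : Fin (numVtx i))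
    (p : Equiv.Perm (Fin (n + 1))), a ≠ b →
    Function.update (vert i a) k w = vert i b ∘ p → Equiv.Perm.sign p = -1
  /-- number of pieces into which the boundary of each reference domain is partitioned -/
  numPart : Fin numSurf → ℕ
  /-- the facets of each boundary piece -/
  bdry : ∀ i, Fin (numPart i) → Finset (Finset (Fin (numVtx i)))
  /-- the boundary facets are those that belong to exactly one simplex -/
  mem_bdry_iff : ∀ i (F : Finset (Fin (numVtx i))), (∃ p, F ∈ bdry i p) ↔
    F.card = n ∧ ∃! a, (F : Set (Fin (numVtx i))) ⊆ Set.range (vert i a)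
  bdry_disjoint : ∀ i p p', p ≠ p' → Disjoint (bdry i p) (bdry i p')
  /-- number of triple junction lines -/
  numTJ : ℕ
  /-- number of boundary lines -/
  numBL : ℕ
  /-- Each boundary piece is exactly one of the three sides `(s^k_j, p^k_j)` of exactly one triple
  junction line, or the side `(s_k, p_k)` of exactly one boundary line. -/
  slot : (Fin numTJ × Fin 3) ⊕ Fin numBL ≃ Σ i, Fin (numPart i)
  /-- `s^k_1 < s^k_2 < s^k_3` -/
  slot_lt : ∀ k, (slot (Sum.inl (k, 0))).1 < (slot (Sum.inl (k, 1))).1 ∧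
    (slot (Sum.inl (k, 1))).1 < (slot (Sum.inl (k, 2))).1
  /-- number of vertices on each triple junction line -/
  tjSize : Fin numTJ → ℕ
  /-- the vertices of the three sides of a triple junction line, matched with each other -/
  rho : ∀ (k : Fin numTJ) (j : Fin 3), Fin (tjSize k) → Fin (numVtx (slot (Sum.inl (k, j))).1)
  rho_injective : ∀ k j, Function.Injective (rho k j)
  rho_range : ∀ k j, Set.range (rho k j) =
    {v | ∃ F ∈ bdry (slot (Sum.inl (k, j))).1 (slot (Sum.inl (k, j))).2, v ∈ F}
  /-- the matching of vertices is a matching of facets -/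
  rho_facet : ∀ (k : Fin numTJ) (j j' : Fin 3) (F : Finset (Fin (tjSize k))),
    F.image (rho k j) ∈ bdry (slot (Sum.inl (k, j))).1 (slot (Sum.inl (k, j))).2 →
    F.image (rho k j') ∈ bdry (slot (Sum.inl (k, j'))).1 (slot (Sum.inl (k, j'))).2
  /-- the signs `o^k_j` -/
  orient : Fin numTJ → Fin 3 → ℤˣ
  /-- The pairs `(o^k_j ν, μ)`, `j = 1, 2, 3`, have the same orientation in the plane orthogonal to
  the triple junction line. For a common facet with ordered vertices `f`, the pair `(ν, μ)` of the
  adjacent simplex with the remaining vertex `v` has the orientation given by the sign of the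
  permutation that takes the order of the vertices of the simplex to the order `(v, f)`: for this
  order, `A = (f₀ - v) ∧ ⋯`, the conormal `μ` is a positive multiple of `f₀ - v` up to vectors
  tangential to the facet, and `det (A, f₀ - v, …, f_{d-2} - v) = |A|² > 0`. -/
  orient_compat : ∀ (k : Fin numTJ) (f : Fin n → Fin (tjSize k)) (j j' : Fin 3)
    (a : Fin (numSimp (slot (Sum.inl (k, j))).1)) (a' : Fin (numSimp (slot (Sum.inl (k, j'))).1))
    (v : Fin (numVtx (slot (Sum.inl (k, j))).1)) (v' : Fin (numVtx (slot (Sum.inl (k, j'))).1))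
    (p p' : Equiv.Perm (Fin (n + 1))),
    (Finset.univ.image fun c => rho k j (f c)) ∈
      bdry (slot (Sum.inl (k, j))).1 (slot (Sum.inl (k, j))).2 →
    vert (slot (Sum.inl (k, j))).1 a ∘ p = Fin.cons v (fun c => rho k j (f c)) →
    vert (slot (Sum.inl (k, j'))).1 a' ∘ p' = Fin.cons v' (fun c => rho k j' (f c)) →
    orient k j * Equiv.Perm.sign p = orient k j' * Equiv.Perm.sign p'

namespace ClusterMesh

variable {n : ℕ} (T : ClusterMesh n)

/-- The surface `s^k_j` at the `j`-th side of the `k`-th triple junction line. -/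
abbrev tjSurf (k : Fin T.numTJ) (j : Fin 3) : Fin T.numSurf := (T.slot (Sum.inl (k, j))).1

/-- The facets of the `j`-th side of the `k`-th triple junction line. -/
abbrev tjFacets (k : Fin T.numTJ) (j : Fin 3) : Finset (Finset (Fin (T.numVtx (T.tjSurf k j)))) :=
  T.bdry (T.slot (Sum.inl (k, j))).1 (T.slot (Sum.inl (k, j))).2

/-- The surface `s_k` that ends in the `k`-th boundary line. -/
abbrev blSurf (k : Fin T.numBL) : Fin T.numSurf := (T.slot (Sum.inr k)).1

/-- The facets of the `k`-th boundary line. -/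
abbrev blFacets (k : Fin T.numBL) : Finset (Finset (Fin (T.numVtx (T.blSurf k)))) :=
  T.bdry (T.slot (Sum.inr k)).1 (T.slot (Sum.inr k)).2

/-- Continuous piecewise affine scalar functions on the cluster, given by their nodal values (one
value for each surface at the vertices of a triple junction line). -/
abbrev ScalarField : Type := ∀ i, Fin (T.numVtx i) → ℝ

/-- Continuous piecewise affine vector fields on the cluster, given by their nodal values. In
particular, these are the parameterizations of polyhedral clusters. -/
abbrev VectorField : Type := ∀ i, Fin (T.numVtx i) → E n

variable {T}

/-- The vertex values of a field on a simplex. For a parameterization these are the vertices of the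
simplex. -/
def onSimplex {α : Type*} (u : ∀ i, Fin (T.numVtx i) → α) (i : Fin T.numSurf)
    (a : Fin (T.numSimp i)) (k : Fin (n + 1)) : α := u i (T.vert i a k)

/-- The space `W^h`. -/
def InW (χ : T.ScalarField) : Prop :=
  ∀ k l, ∑ j : Fin 3, (((T.orient k j : ℤˣ) : ℤ) : ℝ) * χ (T.tjSurf k j) (T.rho k j l) = 0

/-- The space `V^h`. -/
def InV (η : T.VectorField) : Prop :=
  ∀ k l (j j' : Fin 3), η (T.tjSurf k j) (T.rho k j l) = η (T.tjSurf k j') (T.rho k j' l)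

variable (T) in
/-- The external planes `D_k = {x | n_k · x = c_k}` with unit normals `n_k`, to which the boundary
lines of the cluster are attached. -/
structure Walls where
  normal : Fin T.numBL → E n
  norm_normal : ∀ k, ‖normal k‖ = 1
  offset : Fin T.numBL → ℝ

/-- The space `V^h_∂`. -/
def InVBdry (D : T.Walls) (η : T.VectorField) : Prop :=
  InV η ∧ ∀ k, ∀ F ∈ T.blFacets k, ∀ v ∈ F, inner ℝ (D.normal k) (η (T.blSurf k) v) = 0

/-- `X` parameterizes a polyhedral cluster `Γ`: the surfaces fit together at the triple junction
lines, the boundary lines lie in the external planes, and no simplex is degenerate. -/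
structure IsCluster (D : T.Walls) (X : T.VectorField) : Prop where
  junction : InV X
  attached : ∀ k, ∀ F ∈ T.blFacets k, ∀ v ∈ F,
    inner ℝ (D.normal k) (X (T.blSurf k) v) = D.offset k
  nondegenerate : ∀ i a, AffineIndependent ℝ (onSimplex X i a)

/-! ### The scheme -/

/-- The anisotropic energy `A_γ(Γ) = ∑_i ∫_{Γ_i} γ(ν_i)`. -/
def energy (g : Anisotropy n) (X : T.VectorField) : ℝ :=
  ∑ i, ∑ a, area (onSimplex X i a) * g.gamma (unitNormal (onSimplex X i a))

/-- The mass-lumped inner product `⟨u, v⟩^h_Γ` of piecewise continuous vector fields, which are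
given by their limits at the vertices of the simplices. -/
def lumped (X : T.VectorField) (u v : ∀ i, Fin (T.numSimp i) → Fin (n + 1) → E n) : ℝ :=
  ∑ i, (1 / ((n + 1 : ℕ) : ℝ)) * ∑ a, area (onSimplex X i a) * ∑ k, inner ℝ (u i a k) (v i a k)

/-- `⟨∇_s κ, ∇_s χ⟩_Γ`; the gradients are constant on each simplex. -/
def gradInner (X : T.VectorField) (κ χ : T.ScalarField) : ℝ :=
  ∑ i, ∑ a, area (onSimplex X i a) *
    inner ℝ (surfGrad (onSimplex X i a) (onSimplex κ i a))
      (surfGrad (onSimplex X i a) (onSimplex χ i a))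

/-- The discrete anisotropic inner product `⟨∇_s^{G̃} η, ∇_s^{G̃} χ⟩_{γ,Γ^m}`, with `X` and `X'` the
parameterizations of `Γ^m` and `Γ^{m+1}` and `t` the frames that define the anisotropic gradients.
On each simplex `(∇_s^{G̃} η, ∇_s^{G̃} χ)_{G̃} = ∑_j (∂_{t_j} η, ∂_{t_j} χ)_{G̃}`. -/
def anisoInner (g : Anisotropy n) (X X' : T.VectorField)
    (t : Fin g.L → ∀ i, Fin (T.numSimp i) → Fin n → E n) (η χ : T.VectorField) : ℝ :=
  ∑ i, ∑ l, ∑ a, area (onSimplex X i a) *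
    ((g.gammaPart l (unitNormal (onSimplex X' i a)) /
        g.gamma (unitNormal (onSimplex X' i a))) ^ (g.r - 1) *
      (∑ j, mInner (g.Gtilde l)
        (dirDeriv (onSimplex X i a) (onSimplex η i a) (t l i a j))
        (dirDeriv (onSimplex X i a) (onSimplex χ i a) (t l i a j))) *
      g.gammaPart l (unitNormal (onSimplex X i a)))

/-- `(X', κ)` is a solution of the anisotropic scheme for the time step from `t₀` to `t₁`, where
`X` is the parameterization of the cluster `Γ^m` at time `t₀`. -/
structure IsSolution (g : Anisotropy n) (D : T.Walls) (t₀ t₁ : ℝ) (X : T.VectorField)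
    (t : Fin g.L → ∀ i, Fin (T.numSimp i) → Fin n → E n)
    (X' : T.VectorField) (κ : T.ScalarField) : Prop where
  mem_V : InV X'
  mem_W : InW κ
  displacement : InVBdry D (X' - X)
  eq_one : ∀ χ : T.ScalarField, InW χ →
    (1 / (t₁ - t₀)) * lumped X (onSimplex (X' - X))
      (fun i a k => onSimplex χ i a k •
        weightedNormal t₀ t₁ (onSimplex X i a) (onSimplex X' i a))
    - gradInner X κ χ = 0
  eq_two : ∀ η : T.VectorField, InVBdry D η →
    lumped X (fun i a k => onSimplex κ i a k •
        weightedNormal t₀ t₁ (onSimplex X i a) (onSimplex X' i a)) (onSimplex η)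
    + anisoInner g X X' t X' η = 0

/-! ### Enclosed regions -/

/-- The polyhedral surface `Γ_i`. -/
def surf (X : T.VectorField) (i : Fin T.numSurf) : Set (E n) :=
  ⋃ a, convexHull ℝ (Set.range (onSimplex X i a))

variable (T) in
/-- The points of the triangulated reference domains, in barycentric coordinates. -/
def IsPoint (p : Σ i, Fin (T.numVtx i) → ℝ) : Prop :=
  (∀ v, 0 ≤ p.2 v) ∧ ∑ v, p.2 v = 1 ∧
    ∃ a, ∀ v, p.2 v ≠ 0 → v ∈ Set.range (T.vert p.1 a)

variable (T) in
/-- `p` and `q` are the points of two sides of a triple junction line with the same barycentric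
coordinates `w` in the same facet. -/
def Glue (p q : Σ i, Fin (T.numVtx i) → ℝ) : Prop :=
  ∃ (k : Fin T.numTJ) (j j' : Fin 3) (w : Fin (T.tjSize k) → ℝ) (F : Finset (Fin (T.tjSize k))),
    F.image (T.rho k j) ∈ T.tjFacets k j ∧ (∀ l, 0 ≤ w l) ∧ ∑ l, w l = 1 ∧
    (∀ l, w l ≠ 0 → l ∈ F) ∧
    p = ⟨T.tjSurf k j, fun v => ∑ l, if T.rho k j l = v then w l else 0⟩ ∧
    q = ⟨T.tjSurf k j', fun v => ∑ l, if T.rho k j' l = v then w l else 0⟩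

/-- The cluster is embedded: the only points of the reference domains with the same image are those
that are identified at the triple junction lines. -/
def IsEmbedded (X : T.VectorField) : Prop :=
  ∀ p q, T.IsPoint p → T.IsPoint q → ∑ v, p.2 v • X p.1 v = ∑ v, q.2 v • X q.1 v →
    Relation.EqvGen T.Glue p q

variable (T) in
/-- The data that single out one of the regions enclosed by the cluster: the index set of the
surfaces `Γ_i` that bound it, the signs that turn their normals into outer normals, the index set
of the external planes that bound it, and a fixed convex open set `trunc` whose boundary is the
additional fixed hypersurface that makes the volume finite (`trunc` is the whole space if there is
no such hypersurface). An external plane to which one of the bounding surfaces is attached bounds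
the region. -/
structure RegionData where
  surfaces : Finset (Fin T.numSurf)
  sign : Fin T.numSurf → ℤˣ
  planes : Finset (Fin T.numBL)
  trunc : Set (E n)
  isOpen_trunc : IsOpen trunc
  convex_trunc : Convex ℝ trunc
  plane_of_surface : ∀ k, T.blSurf k ∈ surfaces → k ∈ planes

/-- The fixed open set cut out by the external planes of the region (whose normals point towards
the cluster) and by the additional hypersurface. -/
def RegionData.container (D : T.Walls) (ρ : T.RegionData) : Set (E n) :=
  ρ.trunc ∩ {x | ∀ k ∈ ρ.planes, D.offset k < inner ℝ (D.normal k) x}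

/-- `R` is the region with data `ρ` enclosed by the cluster `Γ` parameterized by `X`. -/
structure IsEnclosedRegion (D : T.Walls) (ρ : T.RegionData) (X : T.VectorField)
    (R : Set (E n)) : Prop where
  isOpen : IsOpen R
  nonempty : R.Nonempty
  isBounded : Bornology.IsBounded R
  subset : R ⊆ ρ.container D
  /-- The surfaces of the cluster meet only at the triple junction lines. -/
  embedded : IsEmbedded X
  /-- The bounding surfaces do not cross the external planes or the additional hypersurface. -/
  surf_subset : ∀ i ∈ ρ.surfaces, surf X i ⊆
    ρ.trunc ∩ {x | ∀ k ∈ ρ.planes, D.offset k ≤ inner ℝ (D.normal k) x}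
  /-- No piece of a triple junction line lies in an external plane. -/
  junction_off : ∀ k j, T.tjSurf k j ∈ ρ.surfaces → ∀ F ∈ T.tjFacets k j, ∀ k' ∈ ρ.planes,
    ∃ v ∈ F, D.offset k' < inner ℝ (D.normal k') (X (T.tjSurf k j) v)
  /-- Apart from the fixed boundaries, the boundary of `R` consists of the bounding surfaces. -/
  frontier_eq : frontier R ∩ ρ.container D = (⋃ i ∈ ρ.surfaces, surf X i) ∩ ρ.container D
  /-- The vectors `sign i • ν_i` are the outer normals to `R`. -/
  outer_normal : ∀ i ∈ ρ.surfaces, ∀ a, ∀ x ∈ openSimplex (onSimplex X i a),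
    ∀ᶠ s : ℝ in 𝓝[>] 0,
      x - (s * (((ρ.sign i : ℤˣ) : ℤ) : ℝ)) • unitNormal (onSimplex X i a) ∈ R ∧
      x + (s * (((ρ.sign i : ℤˣ) : ℤ) : ℝ)) • unitNormal (onSimplex X i a) ∉ R

end ClusterMesh

end SurfaceCluster

end

/-!
The energy estimate and the conservation of volume both come from well chosen test functions.

*Stability.* Testing the first equation with `κ` and the second with the displacement `X' - X`
leaves an estimate for a single simplex: the anisotropic Dirichlet form of `X'` and `X' - X` bounds
the increase of `γ(A)`, where `A` is the wedge product of the edges. Hölder's inequality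
(`Anisotropy.gamma_sub_le`) linearizes `γ` in the `γ_ℓ`, with just the weights that the scheme
contains. Each `γ_ℓ(A)²` is the Gram determinant of the edges for the inner product of `G̃_ℓ`
(`gammaPart_orientVec_sq`), so that in a frame that is orthonormal on the old simplex,
`γ_ℓ(A')/γ_ℓ(A)` becomes the root of a Gram determinant of size `d - 1 ≤ 2`. The inequality of the
arithmetic and geometric means (`sqrt_det_sub_one_le`) bounds its excess over `1` by half the
excess of the trace over `d - 1`, and hence by the Dirichlet form, since `(|a|² - |b|²)/2` is at
most `a · (a - b)`. This is where `d ≤ 3` is needed.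

*Volume.* The weights of a region (the signs of its bounding surfaces, `0` for the other surfaces)
are constant on each surface and satisfy the junction condition of `W^h`: along a small triangle
around a triple junction line the indicator function of the region returns to its value, and its
jumps across the surfaces are the weights (`IsEnclosedRegion.indic_sub`,
`IsEnclosedRegion.sum_orient_weight`). So they are admissible in the first equation, where the
gradient term vanishes. As the time-averaged normal integrates the velocity of the linear motion
exactly, this says that the weighted volume swept by the surfaces vanishes
(`IsSolution.sum_weight_inner`).

It remains to compare the swept volume with the regions themselves, without assuming that the
intermediate surfaces enclose anything. For this the linear motion is replaced by one that moves the
vertices one after the other, in an order by position, which respects the identifications at the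
junctions. Each move of a vertex of a simplex sweeps out a single `d`-simplex, and a generic segment
crosses the faces of a `d`-simplex as often, with signs, as the indicator function changes
(`sum_crossing_faces`). Added up over the cluster, the lateral faces cancel in the interior and at
the junctions (`sum_facets_eq_zero`), or lie in an external plane. What remains are the crossings of
the old and the new surfaces, hence the changes of the indicator functions of the two regions. Thus
the difference of these is the signed indicator function of the swept simplices, up to a constant
integer, almost everywhere in the container (`exists_ae_indic_sub_indic`). The successive and the
linear motion sweep the same weighted volume: on a simplex they differ by polynomials that belong to
the facets (`sum_hdet_sweepTuple_one`, `sum_hdet_sweepTuple_two`) and cancel in the same way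
(`sum_weight_hdet_eq_zero`). So the two volumes differ by an integer multiple of the volume of the
container. Both are positive and at most the volume of the container, so this multiple is `0`.
-/

namespace SurfaceCluster

/-! ### The wedge product -/

theorem inner_eq_dotProduct {n : ℕ} (x y : E n) : inner ℝ x y = x.ofLp ⬝ᵥ y.ofLp := by
  rw [EuclideanSpace.inner_eq_star_dotProduct, dotProduct_comm]
  simp

/-- The defining property `w · x = det (x, u₁, …, u_{d-1})` of the wedge product. -/
theorem inner_wedge {n : ℕ} (u : Fin n → E n) (x : E n) :
    inner ℝ (wedge u) x =
      Matrix.det (Matrix.of (Fin.cons x.ofLp (fun k => (u k).ofLp) :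
        Fin (n + 1) → Fin (n + 1) → ℝ)) := by
  rw [inner_eq_dotProduct, Matrix.det_succ_row_zero]
  simp only [dotProduct, wedge]
  refine Finset.sum_congr rfl fun c _ => ?_
  rw [Matrix.det_succ_row_zero, Finset.sum_eq_single c]
  · simp only [Matrix.of_apply, Fin.cons_zero, Pi.single_eq_same]
    rw [mul_one, mul_right_comm]
    congr 1
  · intro b _ hb
    simp [Pi.single_eq_of_ne hb]
  · simp

theorem inner_wedge_self {n : ℕ} (u : Fin n → E n) (k : Fin n) : inner ℝ (wedge u) (u k) = 0 := by
  rw [inner_wedge]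
  refine Matrix.det_zero_of_row_eq (i := 0) (j := k.succ) (Fin.succ_ne_zero k).symm ?_
  rfl

/-! ### Energy stability -/

section mInner

variable {n : ℕ} (M : Matrix (Fin (n + 1)) (Fin (n + 1)) ℝ)

theorem mInner_add_left (u v w : E n) : mInner M (u + v) w = mInner M u w + mInner M v w := by
  simp [mInner, add_dotProduct]

theorem mInner_add_right (u v w : E n) : mInner M u (v + w) = mInner M u v + mInner M u w := by
  simp [mInner, Matrix.mulVec_add, dotProduct_add]

theorem mInner_smul_left (a : ℝ) (u v : E n) : mInner M (a • u) v = a * mInner M u v := by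
  simp [mInner]

theorem mInner_smul_right (a : ℝ) (u v : E n) : mInner M u (a • v) = a * mInner M u v := by
  simp [mInner, Matrix.mulVec_smul]

theorem mInner_sub_left (u v w : E n) : mInner M (u - v) w = mInner M u w - mInner M v w := by
  simp [mInner, sub_dotProduct]

theorem mInner_sub_right (u v w : E n) : mInner M u (v - w) = mInner M u v - mInner M u w := by
  simp [mInner, Matrix.mulVec_sub, dotProduct_sub]

theorem mInner_sum_left {ι : Type*} (s : Finset ι) (u : ι → E n) (v : E n) :
    mInner M (∑ i ∈ s, u i) v = ∑ i ∈ s, mInner M (u i) v := by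
  classical
  induction s using Finset.induction_on with
  | empty => simp [mInner]
  | insert a s ha ih => rw [Finset.sum_insert ha, Finset.sum_insert ha, mInner_add_left, ih]

theorem mInner_sum_right {ι : Type*} (s : Finset ι) (u : E n) (v : ι → E n) :
    mInner M u (∑ i ∈ s, v i) = ∑ i ∈ s, mInner M u (v i) := by
  classical
  induction s using Finset.induction_on with
  | empty => simp [mInner]
  | insert a s ha ih => rw [Finset.sum_insert ha, Finset.sum_insert ha, mInner_add_right, ih]

variable {M}

theorem mInner_comm (hM : M.IsHermitian) (u v : E n) : mInner M u v = mInner M v u := by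
  have h : Mᵀ = M := by simpa [Matrix.IsSymm] using hM
  simp only [mInner]
  rw [Matrix.dotProduct_mulVec, ← Matrix.mulVec_transpose, h, dotProduct_comm]

theorem mInner_self_nonneg (hM : M.PosSemidef) (u : E n) : 0 ≤ mInner M u u := by
  simpa [mInner] using hM.dotProduct_mulVec_nonneg u.ofLp

theorem mInner_self_pos (hM : M.PosDef) {u : E n} (hu : u ≠ 0) : 0 < mInner M u u := by
  simpa [mInner] using hM.dotProduct_mulVec_pos (x := u.ofLp) (by simpa using hu)

/-- The Gram matrix of a tuple of vectors for the bilinear form `(·, ·)_M`. -/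
def mGram (M : Matrix (Fin (n + 1)) (Fin (n + 1)) ℝ) {ι : Type*} (u : ι → E n) : Matrix ι ι ℝ :=
  Matrix.of fun i j => mInner M (u i) (u j)

/-- The anisotropic area of a parallelotope is a Gram determinant: with `w = u₁ ∧ ⋯ ∧ u_n`, the
rows `G w, u₁, …, u_n` have the Gram matrix `diag (w · G w, (u_i · G⁻¹ u_j))` with respect to
`G⁻¹`, and their determinant is `w · G w`. -/
theorem mInner_wedge {G : Matrix (Fin (n + 1)) (Fin (n + 1)) ℝ} (hG : G.PosDef) (u : Fin n → E n) :
    mInner G (wedge u) (wedge u) = G.det * (mGram G⁻¹ u).det := by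
  have hdet : 0 < G.det := hG.det_pos
  have hunit : IsUnit G.det := hdet.ne'.isUnit
  set w := wedge u with hw
  set s := mInner G w w with hs
  by_cases hw0 : w = 0
  · have hs0 : s = 0 := by rw [hs, hw0]; simp [mInner]
    -- a vanishing wedge product forces a linear dependence of the `u i`
    have hdep : ¬ LinearIndependent ℝ (fun k => (u k).ofLp) := by
      intro hli
      have hlt : Submodule.span ℝ (Set.range fun k => (u k).ofLp) < ⊤ := by
        refine lt_top_iff_ne_top.2 fun htop => ?_
        have := finrank_span_eq_card hli
        rw [htop] at this
        simp at this
      obtain ⟨x, -, hx⟩ := SetLike.exists_of_lt hlt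
      have hli' : LinearIndependent ℝ (Fin.cons x (fun k => (u k).ofLp) : Fin (n + 1) → _) :=
        linearIndependent_finCons.2 ⟨hli, hx⟩
      have h1 := inner_wedge u (WithLp.toLp 2 x)
      rw [← hw, hw0, inner_zero_left] at h1
      have h2 : IsUnit (Matrix.of (Fin.cons x (fun k => (u k).ofLp) :
        Fin (n + 1) → Fin (n + 1) → ℝ)) := Matrix.linearIndependent_rows_iff_isUnit.1 hli'
      exact (((Matrix.isUnit_iff_isUnit_det _).1 h2).ne_zero) h1.symm
    obtain ⟨c, hc, k, hk⟩ := Fintype.not_linearIndependent_iff.1 hdep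
    have hc' : ∑ i, c i • u i = 0 := by
      apply (WithLp.linearEquiv 2 ℝ (Fin (n + 1) → ℝ)).injective
      simpa using hc
    have hz : c ᵥ* (mGram G⁻¹ u) = 0 := by
      ext j
      simp only [Matrix.vecMul, dotProduct, mGram, Matrix.of_apply, ← mInner_smul_left,
        ← mInner_sum_left, hc']
      simp [mInner]
    have hdet0 : (mGram G⁻¹ u).det = 0 :=
      Matrix.exists_vecMul_eq_zero_iff.1 ⟨c, fun h => hk (congrFun h k), hz⟩
    rw [hs0, hdet0, mul_zero]
  · have hs0 : 0 < s := mInner_self_pos hG hw0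
    set Gw : E n := WithLp.toLp 2 (G *ᵥ w.ofLp) with hGw
    set r : Fin (n + 1) → E n := Fin.cons Gw u with hr
    set N : Matrix (Fin (n + 1)) (Fin (n + 1)) ℝ := Matrix.of fun i => (r i).ofLp with hN
    have hN' : N = Matrix.of (Fin.cons Gw.ofLp (fun k => (u k).ofLp) :
        Fin (n + 1) → Fin (n + 1) → ℝ) := by
      ext i j
      refine Fin.cases ?_ (fun k => ?_) i <;> simp [hN, hr]
    have hNdet : N.det = s := by
      rw [hN', ← inner_wedge, inner_eq_dotProduct]
      rfl
    have hprod : N * G⁻¹ * Nᵀ = mGram G⁻¹ r := by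
      ext i j
      simp only [mGram, mInner, Matrix.of_apply]
      rw [Matrix.dotProduct_mulVec, Matrix.mul_apply', dotProduct]
      simp only [dotProduct, Matrix.mul_apply, Matrix.vecMul, Matrix.transpose_apply]
      rfl
    have h0 : ∀ v : E n, mInner G⁻¹ v Gw = inner ℝ w v := by
      intro v
      simp only [mInner, hGw, Matrix.mulVec_mulVec, Matrix.nonsing_inv_mul _ hunit,
        Matrix.one_mulVec]
      rw [inner_eq_dotProduct, dotProduct_comm]
    have hcol : ∀ i : Fin n, mGram G⁻¹ r i.succ 0 = 0 := by
      intro i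
      simp only [mGram, Matrix.of_apply, hr, Fin.cons_succ, Fin.cons_zero, h0]
      exact inner_wedge_self u i
    have hgram : (mGram G⁻¹ r).det = s * (mGram G⁻¹ u).det := by
      rw [Matrix.det_succ_column_zero, Fin.sum_univ_succ]
      rw [Finset.sum_eq_zero (fun i _ => by rw [hcol]; ring), add_zero]
      congr 1
      simp only [mGram, Matrix.of_apply, hr, Fin.cons_zero, h0]
      rw [inner_eq_dotProduct]
      simp [hs, mInner, hGw]
    have key := congrArg Matrix.det hprod
    rw [Matrix.det_mul, Matrix.det_mul, Matrix.det_transpose, hNdet, hgram,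
      Matrix.det_nonsing_inv, Ring.inverse_eq_inv'] at key
    field_simp at key
    exact key

end mInner

theorem mGram_smul {n : ℕ} (c : ℝ) (M : Matrix (Fin (n + 1)) (Fin (n + 1)) ℝ) {ι : Type*}
    (u : ι → E n) : mGram (c • M) u = c • mGram M u := by
  ext i j
  simp [mGram, mInner, Matrix.smul_mulVec]

/-- If `e = C τ` for a square matrix `C`, then the Gram matrices are congruent. -/
theorem mGram_of_sum {n : ℕ} (M : Matrix (Fin (n + 1)) (Fin (n + 1)) ℝ) {m : ℕ}
    (C : Matrix (Fin m) (Fin m) ℝ) (τ e : Fin m → E n) (h : ∀ k, e k = ∑ j, C k j • τ j) :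
    mGram M e = C * mGram M τ * Cᵀ := by
  ext i j
  simp only [mGram, Matrix.of_apply, h, mInner_sum_left, mInner_sum_right, mInner_smul_left,
    mInner_smul_right, Matrix.mul_apply, Matrix.transpose_apply, Finset.sum_mul, Finset.mul_sum]
  refine Finset.sum_congr rfl fun a _ => Finset.sum_congr rfl fun b _ => ?_
  ring

namespace Anisotropy

variable {n : ℕ} (g : Anisotropy n)

theorem gammaPart_nonneg (l : Fin g.L) (p : E n) : 0 ≤ g.gammaPart l p := Real.sqrt_nonneg _

theorem gamma_nonneg (p : E n) : 0 ≤ g.gamma p :=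
  Real.rpow_nonneg (Finset.sum_nonneg fun l _ => Real.rpow_nonneg (g.gammaPart_nonneg l p) _) _

theorem r_pos : 0 < g.r := lt_of_lt_of_le one_pos g.one_le_r

theorem gammaPart_smul (l : Fin g.L) {a : ℝ} (ha : 0 ≤ a) (p : E n) :
    g.gammaPart l (a • p) = a * g.gammaPart l p := by
  simp only [gammaPart, mInner_smul_left, mInner_smul_right]
  rw [← mul_assoc, Real.sqrt_mul (mul_nonneg ha ha), Real.sqrt_mul_self ha]

theorem gamma_smul {a : ℝ} (ha : 0 ≤ a) (p : E n) : g.gamma (a • p) = a * g.gamma p := by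
  simp only [gamma, g.gammaPart_smul _ ha]
  simp only [Real.mul_rpow ha (g.gammaPart_nonneg _ _), ← Finset.mul_sum]
  rw [Real.mul_rpow (Real.rpow_nonneg ha _)
    (Finset.sum_nonneg fun l _ => Real.rpow_nonneg (g.gammaPart_nonneg l p) _),
    ← Real.rpow_mul ha, mul_one_div_cancel g.r_pos.ne', Real.rpow_one]

theorem gammaPart_pos (l : Fin g.L) {p : E n} (hp : p ≠ 0) : 0 < g.gammaPart l p :=
  Real.sqrt_pos.2 (mInner_self_pos (g.posDef l) hp)

theorem sum_rpow_gammaPart (p : E n) : ∑ l, g.gammaPart l p ^ g.r = g.gamma p ^ g.r := by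
  rw [gamma, ← Real.rpow_mul (Finset.sum_nonneg fun l _ =>
    Real.rpow_nonneg (g.gammaPart_nonneg l p) _), one_div_mul_cancel g.r_pos.ne', Real.rpow_one]

theorem gamma_pos {p : E n} (hp : p ≠ 0) : 0 < g.gamma p := by
  refine Real.rpow_pos_of_pos (Finset.sum_pos (fun l _ => ?_) ⟨⟨0, g.L_pos⟩, Finset.mem_univ _⟩) _
  exact Real.rpow_pos_of_pos (g.gammaPart_pos l hp) _

theorem gamma_zero : g.gamma (0 : E n) = 0 := by
  have := g.gamma_smul le_rfl (0 : E n)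
  simpa using this

/-- The weights `(γ_ℓ/γ)^{r-1}` linearize `γ` from below: this is Hölder's inequality. For a
degenerate simplex, `p' = 0`, the weights are `0^{r-1}`, that is `1` for `r = 1` and `0` for
`r > 1`. -/
theorem gamma_sub_le (p p' : E n) :
    g.gamma p' - g.gamma p ≤
      ∑ l, (g.gammaPart l p' / g.gamma p') ^ (g.r - 1) * (g.gammaPart l p' - g.gammaPart l p) := by
  have hr := g.r_pos
  rcases eq_or_lt_of_le g.one_le_r with h1 | h1
  · have hg : ∀ q, g.gamma q = ∑ l, g.gammaPart l q := by
      intro q; simp [gamma, ← h1]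
    simp [← h1, hg]
  by_cases hp : p' = 0
  · subst hp
    rw [g.gamma_zero]
    have : ∀ l, (g.gammaPart l 0 / (0 : ℝ)) ^ (g.r - 1) = 0 := fun l => by
      rw [div_zero, Real.zero_rpow (by linarith)]
    simp only [this, zero_mul, Finset.sum_const_zero]
    linarith [g.gamma_nonneg p]
  have hβ := g.gamma_pos hp
  set w : Fin g.L → ℝ := fun l => g.gammaPart l p' / g.gamma p' with hw
  have hw0 : ∀ l, 0 ≤ w l := fun l => div_nonneg (g.gammaPart_nonneg l p') hβ.le
  have hwr : ∑ l, w l ^ g.r = 1 := by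
    simp only [hw, Real.div_rpow (g.gammaPart_nonneg _ p') hβ.le, ← Finset.sum_div]
    rw [g.sum_rpow_gammaPart, div_self (Real.rpow_pos_of_pos hβ _).ne']
  have hA : ∑ l, w l ^ (g.r - 1) * g.gammaPart l p' = g.gamma p' := by
    have : ∀ l, w l ^ (g.r - 1) * g.gammaPart l p' = g.gamma p' * w l ^ g.r := by
      intro l
      have e : g.gammaPart l p' = w l * g.gamma p' := by simp only [hw]; field_simp
      rw [e, mul_comm (w l) (g.gamma p'), ← mul_assoc, mul_comm _ (g.gamma p'), mul_assoc,
        ← Real.rpow_add_one' (hw0 l) (by linarith), sub_add_cancel]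
    simp only [this, ← Finset.mul_sum, hwr, mul_one]
  have hB : ∑ l, w l ^ (g.r - 1) * g.gammaPart l p ≤ g.gamma p := by
    have hpq : (g.r / (g.r - 1)).HolderConjugate g.r := by
      have := (Real.HolderConjugate.conjExponent h1).symm
      simpa [Real.conjExponent] using this
    have h := Real.inner_le_Lp_mul_Lq_of_nonneg Finset.univ hpq
      (f := fun l => w l ^ (g.r - 1)) (g := fun l => g.gammaPart l p)
      (fun l _ => Real.rpow_nonneg (hw0 l) _) (fun l _ => g.gammaPart_nonneg l p)
    have hw1 : ∀ l, (w l ^ (g.r - 1)) ^ (g.r / (g.r - 1)) = w l ^ g.r := by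
      intro l
      rw [← Real.rpow_mul (hw0 l), mul_div_cancel₀ _ (by linarith : g.r - 1 ≠ 0)]
    simp only [hw1, hwr, Real.one_rpow, one_mul] at h
    exact h
  have : ∑ l, w l ^ (g.r - 1) * (g.gammaPart l p' - g.gammaPart l p) =
      ∑ l, w l ^ (g.r - 1) * g.gammaPart l p' - ∑ l, w l ^ (g.r - 1) * g.gammaPart l p := by
    rw [← Finset.sum_sub_distrib]
    exact Finset.sum_congr rfl fun l _ => by ring
  rw [this]
  linarith

theorem Gtilde_posDef (l : Fin g.L) : (g.Gtilde l).PosDef :=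
  (g.posDef l).inv.smul (Real.rpow_pos_of_pos (g.posDef l).det_pos _)

/-- `γ_ℓ(A{σ})²` is the Gram determinant of the edges of `σ` with respect to `G̃_ℓ`. -/
theorem gammaPart_orientVec_sq (hn : n ≠ 0) (l : Fin g.L) (q : Fin (n + 1) → E n) :
    g.gammaPart l (orientVec q) ^ 2 = (mGram (g.Gtilde l) (edge q)).det := by
  rw [gammaPart, Real.sq_sqrt (mInner_self_nonneg (g.posDef l).posSemidef _), orientVec,
    mInner_wedge (g.posDef l), Gtilde, mGram_smul, Matrix.det_smul, Fintype.card_fin,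
    ← Real.rpow_natCast, ← Real.rpow_mul (g.posDef l).det_pos.le,
    one_div_mul_cancel (by exact_mod_cast hn), Real.rpow_one]

end Anisotropy

end SurfaceCluster

namespace SurfaceCluster

theorem linearIndependent_edge {n : ℕ} {q : Fin (n + 1) → E n} (hq : AffineIndependent ℝ q) :
    LinearIndependent ℝ (edge q) :=
  ((affineIndependent_iff_linearIndependent_vsub ℝ q 0).1 hq).comp
    (fun k : Fin n => (⟨k.succ, Fin.succ_ne_zero k⟩ : {x // x ≠ (0 : Fin (n + 1))}))
    (fun a b hab => by simpa using hab)

theorem wedge_ne_zero {n : ℕ} {u : Fin n → E n} (hu : LinearIndependent ℝ u) : wedge u ≠ 0 := by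
  intro h0
  have hlt : Submodule.span ℝ (Set.range u) < ⊤ := by
    refine lt_top_iff_ne_top.2 fun htop => ?_
    have := finrank_span_eq_card hu
    rw [htop] at this
    simp at this
  obtain ⟨x, -, hx⟩ := SetLike.exists_of_lt hlt
  have hli : LinearIndependent ℝ (Fin.cons x u : Fin (n + 1) → E n) :=
    linearIndependent_finCons.2 ⟨hu, hx⟩
  have hli' := hli.map' (WithLp.linearEquiv 2 ℝ (Fin (n + 1) → ℝ)).toLinearMap
    (LinearEquiv.ker _)
  have heq : (WithLp.linearEquiv 2 ℝ (Fin (n + 1) → ℝ)).toLinearMap ∘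
      (Fin.cons x u : Fin (n + 1) → E n) =
      (Fin.cons x.ofLp (fun k => (u k).ofLp) : Fin (n + 1) → Fin (n + 1) → ℝ) := by
    funext i
    refine Fin.cases rfl (fun k => rfl) i
  rw [heq] at hli'
  have h1 := inner_wedge u x
  rw [h0, inner_zero_left] at h1
  have h2 : IsUnit (Matrix.of (Fin.cons x.ofLp (fun k => (u k).ofLp) :
    Fin (n + 1) → Fin (n + 1) → ℝ)) := Matrix.linearIndependent_rows_iff_isUnit.1 hli'
  exact (((Matrix.isUnit_iff_isUnit_det _).1 h2).ne_zero) h1.symm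

theorem orientVec_ne_zero {n : ℕ} {q : Fin (n + 1) → E n} (hq : AffineIndependent ℝ q) :
    orientVec q ≠ 0 := wedge_ne_zero (linearIndependent_edge hq)

/-- Independent vectors orthogonal to `v ≠ 0` span the hyperplane orthogonal to `v`. -/
theorem span_eq_orthogonal {n : ℕ} {u : Fin n → E n} (hu : LinearIndependent ℝ u) {v : E n}
    (hv : v ≠ 0) (huv : ∀ k, inner ℝ v (u k) = 0) :
    Submodule.span ℝ (Set.range u) = (ℝ ∙ v)ᗮ := by
  refine Submodule.eq_of_le_of_finrank_eq ?_ ?_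
  · rw [Submodule.span_le]
    rintro _ ⟨k, rfl⟩
    exact Submodule.mem_orthogonal_singleton_iff_inner_right.2 (huv k)
  · have h1 := finrank_span_eq_card hu
    have h2 := Submodule.finrank_add_finrank_orthogonal (ℝ ∙ v)
    rw [finrank_span_singleton hv] at h2
    simp at h1 h2
    omega

section dirDeriv

variable {n : ℕ} (q : Fin (n + 1) → E n)

theorem surfGrad_sub (f f' : Fin (n + 1) → ℝ) :
    surfGrad q (fun k => f k - f' k) = surfGrad q f - surfGrad q f' := by
  simp only [surfGrad, ← Finset.sum_sub_distrib, ← sub_smul]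
  refine Finset.sum_congr rfl fun a _ => ?_
  congr 1
  refine Finset.sum_congr rfl fun b _ => by ring

theorem surfGrad_const (c : ℝ) : surfGrad q (fun _ => c) = 0 := by
  simp [surfGrad]

theorem dirDeriv_sub_left (η χ : Fin (n + 1) → E n) (t : E n) :
    dirDeriv q (fun k => η k - χ k) t = dirDeriv q η t - dirDeriv q χ t := by
  ext c
  simp only [dirDeriv, PiLp.sub_apply]
  rw [surfGrad_sub, inner_sub_left]

theorem dirDeriv_sum_smul (η : Fin (n + 1) → E n) {ι : Type*} (s : Finset ι) (a : ι → ℝ)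
    (t : ι → E n) : dirDeriv q η (∑ i ∈ s, a i • t i) = ∑ i ∈ s, a i • dirDeriv q η (t i) := by
  ext c
  simp [dirDeriv, inner_sum, inner_smul_right]

variable {q}

theorem dirDeriv_edge (hq : AffineIndependent ℝ q) (η : Fin (n + 1) → E n) (k : Fin n) :
    dirDeriv q η (edge q k) = edge η k := by
  ext c
  exact inner_surfGrad_edge q hq (fun k => η k c) k

theorem dirDeriv_self (hq : AffineIndependent ℝ q) {t : E n}
    (ht : t ∈ Submodule.span ℝ (Set.range (edge q))) : dirDeriv q q t = t := by
  obtain ⟨c, rfl⟩ := (Submodule.mem_span_range_iff_exists_fun ℝ).1 ht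
  rw [dirDeriv_sum_smul]
  exact Finset.sum_congr rfl fun k _ => by rw [dirDeriv_edge hq]

end dirDeriv

/-- For `n = 1, 2`, half the excess of the trace of a positive semidefinite matrix over that of the
identity bounds the excess of the square root of the determinant: this is the inequality between
the arithmetic and the geometric mean for `n = 2`, and `x² + 1 ≥ 2 x` for `n = 1`. -/
theorem sqrt_det_sub_one_le {n : ℕ} (hn : n = 1 ∨ n = 2) {S : Matrix (Fin n) (Fin n) ℝ}
    (hdiag : ∀ i, 0 ≤ S i i) (hsymm : ∀ i j, S i j = S j i) :
    √S.det - 1 ≤ (∑ j, S j j - n) / 2 := by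
  rcases hn with rfl | rfl
  · have h0 := Real.sq_sqrt (hdiag 0)
    simp only [Matrix.det_unique, Fin.default_eq_zero, Finset.univ_unique, Finset.sum_singleton,
      Nat.cast_one]
    nlinarith [sq_nonneg (√(S 0 0) - 1)]
  · rw [Matrix.det_fin_two, Fin.sum_univ_two]
    have h0 := hdiag 0
    have h1 := hdiag 1
    have : √(S 0 0 * S 1 1 - S 0 1 * S 1 0) ≤ (S 0 0 + S 1 1) / 2 := by
      refine Real.sqrt_le_iff.2 ⟨by linarith, ?_⟩
      rw [hsymm 1 0]
      nlinarith [sq_nonneg (S 0 0 - S 1 1), sq_nonneg (S 0 1)]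
    push_cast
    linarith

/-- Stability on one simplex, for one of the summands of the anisotropy. -/
theorem Anisotropy.gammaPart_sub_le {n : ℕ} (hn : n = 1 ∨ n = 2) (g : Anisotropy n) (l : Fin g.L)
    {q : Fin (n + 1) → E n} (hq : AffineIndependent ℝ q) {t : Fin n → E n}
    (ht : IsTangentFrame (g.Gtilde l) q t) (q' : Fin (n + 1) → E n) :
    g.gammaPart l (orientVec q') - g.gammaPart l (orientVec q) ≤
      g.gammaPart l (orientVec q) * ∑ j, mInner (g.Gtilde l) (dirDeriv q q' (t j))
        (dirDeriv q (fun k => q' k - q k) (t j)) := by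
  have hn0 : n ≠ 0 := by omega
  set M := g.Gtilde l with hM
  have hMpos : M.PosDef := g.Gtilde_posDef l
  have hA := orientVec_ne_zero hq
  have hedge := span_eq_orthogonal (linearIndependent_edge hq) hA
    (fun k => inner_wedge_self (edge q) k)
  have htli : LinearIndependent ℝ t := by
    rw [Fintype.linearIndependent_iff]
    intro c hc j
    have h := congrArg (fun v => mInner M v (t j)) hc
    have h0 : mInner M 0 (t j) = 0 := by simp [mInner]
    simpa only [mInner_sum_left, mInner_smul_left, ht.orthonormal, mul_ite, mul_one, mul_zero,
      Finset.sum_ite_eq', Finset.mem_univ, if_true, h0] using h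
  have htA : ∀ k, inner ℝ (orientVec q) (t k) = 0 := by
    intro k
    have h := ht.tangent k
    rw [unitNormal, inner_smul_right, real_inner_comm] at h
    exact (mul_eq_zero.1 h).resolve_left (inv_ne_zero (norm_ne_zero_iff.2 hA))
  have hspan := span_eq_orthogonal htli hA htA
  have hmem : ∀ k, edge q k ∈ Submodule.span ℝ (Set.range t) := fun k => by
    rw [hspan, ← hedge]; exact Submodule.subset_span ⟨k, rfl⟩
  have hmem' : ∀ j, t j ∈ Submodule.span ℝ (Set.range (edge q)) := fun j => by
    rw [hedge, ← hspan]; exact Submodule.subset_span ⟨j, rfl⟩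
  choose C hC using fun k => (Submodule.mem_span_range_iff_exists_fun ℝ).1 (hmem k)
  set τ : Fin n → E n := fun j => dirDeriv q q' (t j) with hτ
  have he' : ∀ k, edge q' k = ∑ j, C k j • τ j := by
    intro k
    rw [← dirDeriv_edge hq q' k, ← hC k, dirDeriv_sum_smul]
  have hG' := mGram_of_sum M (Matrix.of C) τ (edge q') he'
  have hG := mGram_of_sum M (Matrix.of C) t (edge q) (fun k => (hC k).symm)
  have ht1 : mGram M t = 1 := by
    ext i j
    simp [mGram, ht.orthonormal, Matrix.one_apply]
  have hs' : g.gammaPart l (orientVec q') ^ 2 =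
      g.gammaPart l (orientVec q) ^ 2 * (mGram M τ).det := by
    rw [g.gammaPart_orientVec_sq hn0, g.gammaPart_orientVec_sq hn0, ← hM, hG', hG, ht1]
    simp only [Matrix.det_mul, Matrix.det_transpose, Matrix.det_one]
    ring
  have hpos := g.gammaPart_pos l hA
  have heq : g.gammaPart l (orientVec q') =
      g.gammaPart l (orientVec q) * √(mGram M τ).det := by
    have h2 : (mGram M τ).det = (g.gammaPart l (orientVec q') / g.gammaPart l (orientVec q)) ^ 2 := by
      rw [div_pow, hs']; field_simp
    rw [h2, Real.sqrt_sq (div_nonneg (g.gammaPart_nonneg _ _) hpos.le)]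
    field_simp
  have hS := sqrt_det_sub_one_le hn (S := mGram M τ)
    (fun i => mInner_self_nonneg hMpos.posSemidef (τ i))
    (fun i j => mInner_comm hMpos.isHermitian _ _)
  have hQ : (∑ j, mGram M τ j j - n) / 2 ≤
      ∑ j, mInner M (τ j) (dirDeriv q (fun k => q' k - q k) (t j)) := by
    have hterm : ∀ j, (mGram M τ j j - 1) / 2 ≤
        mInner M (τ j) (dirDeriv q (fun k => q' k - q k) (t j)) := by
      intro j
      rw [dirDeriv_sub_left, dirDeriv_self hq (hmem' j)]
      have h0 := mInner_self_nonneg hMpos.posSemidef (τ j - t j)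
      rw [mInner_sub_left, mInner_sub_right, mInner_sub_right,
        mInner_comm hMpos.isHermitian (t j) (τ j), ht.orthonormal j j, if_pos rfl] at h0
      rw [mInner_sub_right]
      simp only [mGram, Matrix.of_apply]
      change _ ≤ mInner M (τ j) (τ j) - mInner M (τ j) (t j)
      linarith
    calc (∑ j, mGram M τ j j - n) / 2 = ∑ j, (mGram M τ j j - 1) / 2 := by
          rw [← Finset.sum_div, Finset.sum_sub_distrib]; simp
      _ ≤ _ := Finset.sum_le_sum fun j _ => hterm j
  rw [heq]
  have := mul_le_mul_of_nonneg_left (hS.trans hQ) hpos.le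
  linarith

namespace ClusterMesh

variable {n : ℕ} {T : ClusterMesh n}

theorem onSimplex_sub (u v : T.VectorField) (i : Fin T.numSurf) (a : Fin (T.numSimp i)) :
    onSimplex (u - v) i a = fun k => onSimplex u i a k - onSimplex v i a k := rfl

theorem norm_mul_gamma_unitNormal (g : Anisotropy n) (q : Fin (n + 1) → E n) :
    ‖orientVec q‖ * g.gamma (unitNormal q) = g.gamma (orientVec q) := by
  by_cases h : orientVec q = 0
  · rw [h, norm_zero, zero_mul, g.gamma_zero]
  · rw [unitNormal, g.gamma_smul (inv_nonneg.2 (norm_nonneg _)), mul_inv_cancel_left₀]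
    exact norm_ne_zero_iff.2 h

theorem gammaPart_div_gamma_unitNormal (g : Anisotropy n) (l : Fin g.L) (q : Fin (n + 1) → E n) :
    g.gammaPart l (unitNormal q) / g.gamma (unitNormal q) =
      g.gammaPart l (orientVec q) / g.gamma (orientVec q) := by
  by_cases h : orientVec q = 0
  · rw [unitNormal, h, smul_zero]
  · have h0 : ‖orientVec q‖⁻¹ ≠ 0 := inv_ne_zero (norm_ne_zero_iff.2 h)
    rw [unitNormal, g.gamma_smul (inv_nonneg.2 (norm_nonneg _)),
      g.gammaPart_smul _ (inv_nonneg.2 (norm_nonneg _)), mul_div_mul_left _ _ h0]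

/-- The anisotropic Dirichlet form, with the weights of the new normals, bounds the increase of the
energy. -/
theorem energy_sub_le_anisoInner (hn : n = 1 ∨ n = 2) (g : Anisotropy n) (X X' : T.VectorField)
    (hX : ∀ i a, AffineIndependent ℝ (onSimplex X i a))
    (t : Fin g.L → ∀ i, Fin (T.numSimp i) → Fin n → E n)
    (hframe : ∀ l i a, IsTangentFrame (g.Gtilde l) (onSimplex X i a) (t l i a)) :
    energy g X' - energy g X ≤ anisoInner g X X' t X' (X' - X) := by
  rw [energy, energy, anisoInner, ← Finset.sum_sub_distrib]
  refine Finset.sum_le_sum fun i _ => ?_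
  rw [← Finset.sum_sub_distrib, Finset.sum_comm]
  refine Finset.sum_le_sum fun a _ => ?_
  set q := onSimplex X i a with hq
  set q' := onSimplex X' i a with hq'
  have hfac : (0 : ℝ) < (n ! : ℝ) := by exact_mod_cast Nat.factorial_pos n
  have he : ∀ p : Fin (n + 1) → E n, area p * g.gamma (unitNormal p) =
      (n ! : ℝ)⁻¹ * g.gamma (orientVec p) := by
    intro p
    rw [← norm_mul_gamma_unitNormal, area]; ring
  have he2 : ∀ l, area q * g.gammaPart l (unitNormal q) =
      (n ! : ℝ)⁻¹ * g.gammaPart l (orientVec q) := by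
    intro l
    have h0 := norm_ne_zero_iff.2 (orientVec_ne_zero (hX i a))
    rw [← hq] at h0
    rw [unitNormal, g.gammaPart_smul _ (inv_nonneg.2 (norm_nonneg _)), area]
    field_simp
  rw [he, he, ← mul_sub]
  refine (mul_le_mul_of_nonneg_left (g.gamma_sub_le (orientVec q) (orientVec q'))
    (inv_nonneg.2 hfac.le)).trans ?_
  rw [Finset.mul_sum]
  refine Finset.sum_le_sum fun l _ => ?_
  have hl := g.gammaPart_sub_le hn l (hX i a) (hframe l i a) q'
  rw [← hq] at hl
  rw [gammaPart_div_gamma_unitNormal]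
  set W := (g.gammaPart l (orientVec q') / g.gamma (orientVec q')) ^ (g.r - 1) with hW
  have hW0 : 0 ≤ W := Real.rpow_nonneg (div_nonneg (g.gammaPart_nonneg _ _) (g.gamma_nonneg _)) _
  have h2 := mul_le_mul_of_nonneg_left hl (mul_nonneg (inv_nonneg.2 hfac.le) hW0)
  rw [onSimplex_sub, ← hq, ← hq']
  calc _ = (n ! : ℝ)⁻¹ * W * (g.gammaPart l (orientVec q') - g.gammaPart l (orientVec q)) := by ring
    _ ≤ _ := h2
    _ = _ := by
      rw [show ∀ s : ℝ, area q * (W * s * g.gammaPart l (unitNormal q)) =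
        W * s * (area q * g.gammaPart l (unitNormal q)) from fun s => by ring, he2]
      ring

theorem lumped_smul_comm (X u : T.VectorField) (κ : T.ScalarField)
    (ν : ∀ i, Fin (T.numSimp i) → E n) :
    lumped X (onSimplex u) (fun i a k => onSimplex κ i a k • ν i a) =
      lumped X (fun i a k => onSimplex κ i a k • ν i a) (onSimplex u) := by
  simp only [lumped, real_inner_comm]

/-- Testing the first equation with `κ` and the second one with the displacement gives the energy
estimate. -/
theorem energy_add_le (hn : n = 1 ∨ n = 2) {g : Anisotropy n} {D : T.Walls} {t₀ t₁ : ℝ}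
    (ht : t₀ < t₁) {X : T.VectorField} (hX : IsCluster D X)
    {t : Fin g.L → ∀ i, Fin (T.numSimp i) → Fin n → E n}
    (hframe : ∀ l i a, IsTangentFrame (g.Gtilde l) (onSimplex X i a) (t l i a))
    {X' : T.VectorField} {κ : T.ScalarField} (hsol : IsSolution g D t₀ t₁ X t X' κ) :
    energy g X' + (t₁ - t₀) * gradInner X κ κ ≤ energy g X := by
  have h1 := hsol.eq_one κ hsol.mem_W
  have h2 := hsol.eq_two (X' - X) hsol.displacement
  have h3 := energy_sub_le_anisoInner hn g X X' hX.nondegenerate t hframe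
  rw [lumped_smul_comm X (X' - X) κ
    fun i a => weightedNormal t₀ t₁ (onSimplex X i a) (onSimplex X' i a)] at h1
  have hdt : t₁ - t₀ ≠ 0 := by linarith
  have h4 : (t₁ - t₀) * gradInner X κ κ = lumped X (fun i a k => onSimplex κ i a k •
      weightedNormal t₀ t₁ (onSimplex X i a) (onSimplex X' i a)) (onSimplex (X' - X)) := by
    rw [← sub_eq_zero.1 h1]; field_simp
  linarith

end ClusterMesh

end SurfaceCluster

namespace SurfaceCluster

/-! ### Determinants in homogeneous coordinates -/

section hvol

variable {n : ℕ}

/-- The coordinates of a point of `ℝ × ℝ^d`. -/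
def homCoord (n : ℕ) : (ℝ × E n) →ₗ[ℝ] (Fin (n + 2) → ℝ) where
  toFun p := Fin.cons p.1 p.2.ofLp
  map_add' p q := by
    ext i
    refine Fin.cases ?_ (fun k => ?_) i <;> simp
  map_smul' c p := by
    ext i
    refine Fin.cases ?_ (fun k => ?_) i <;> simp

/-- The determinant on `ℝ × ℝ^d`. Points `x` of `ℝ^d` enter as `(1, x)` and vectors `v` as
`(0, v)`. -/
def hvol (n : ℕ) : (ℝ × E n) [⋀^Fin (n + 2)]→ₗ[ℝ] ℝ :=
  (Matrix.detRowAlternating (n := Fin (n + 2)) (R := ℝ)).compLinearMap (homCoord n)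

theorem hvol_apply (v : Fin (n + 2) → ℝ × E n) :
    hvol n v = Matrix.det (Matrix.of fun i => (Fin.cons (v i).1 (v i).2.ofLp : Fin (n + 2) → ℝ)) :=
  rfl

/-- The homogeneous coordinates `(1, x)` of the points of a tuple. -/
def hom {ι : Type*} (w : ι → E n) (i : ι) : ℝ × E n := (1, w i)

/-- The oriented volume, up to the factor `d!`, of the `d`-simplex with vertices `w`. -/
def hdet (w : Fin (n + 2) → E n) : ℝ := hvol n (hom w)

theorem continuous_hvol : Continuous fun v : Fin (n + 2) → ℝ × E n => hvol n v := by
  simp only [hvol_apply]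
  refine Continuous.matrix_det ?_
  refine continuous_pi fun i => continuous_pi fun j => ?_
  refine Fin.cases ?_ (fun k => ?_) j
  · simp only [Matrix.of_apply, Fin.cons_zero]; fun_prop
  · simp only [Matrix.of_apply, Fin.cons_succ]; fun_prop

theorem cons_comp_decomposeFin {α : Type*} {m : ℕ} (a : α) (f : Fin m → α)
    (p : Equiv.Perm (Fin m)) :
    (Fin.cons a f : Fin (m + 1) → α) ∘ (Equiv.Perm.decomposeFin.symm (0, p)) =
      Fin.cons a (f ∘ p) := by
  funext i
  refine Fin.cases ?_ (fun k => ?_) i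
  · simp
  · simp

theorem comp_cycleRange_symm {α : Type*} {m : ℕ} (f : Fin (m + 1) → α) (k : Fin (m + 1)) :
    f ∘ (Fin.cycleRange k).symm = Fin.cons (f k) (f ∘ k.succAbove) := by
  funext i
  refine Fin.cases ?_ (fun j => ?_) i
  · simp
  · simp

theorem inner_orientVec (q : Fin (n + 1) → E n) (z : E n) :
    inner ℝ (orientVec q) z = -hvol n (Fin.cons (0, z) (hom q)) := by
  set v : Fin (n + 2) → ℝ × E n := Fin.cons (0, z) (hom q) with hv
  set v' : Fin (n + 2) → ℝ × E n := Fin.cons (0, z) (Fin.cons (1, q 0) fun k => (0, edge q k))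
    with hv'
  have v0 : v 0 = (0, z) := rfl
  have v1 : v 1 = (1, q 0) := rfl
  have vs : ∀ i : Fin n, v i.succ.succ = (1, q i.succ) := fun i => rfl
  have w0 : v' 0 = (0, z) := rfl
  have w1 : v' 1 = (1, q 0) := rfl
  have ws : ∀ i : Fin n, v' i.succ.succ = (0, edge q i) := fun i => rfl
  clear_value v v'
  have h1 : hvol n v = hvol n v' := by
    rw [hvol_apply, hvol_apply]
    refine Matrix.det_eq_of_forall_row_eq_smul_add_const
      (Fin.cons 0 (Fin.cons 0 fun _ => 1) : Fin (n + 2) → ℝ) 1 rfl fun i j => ?_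
    refine Fin.cases ?_ (fun i => Fin.cases ?_ (fun i => ?_) i) i
    · simp [v0, w0]
    · simp [v1, w1]
    · refine Fin.cases ?_ (fun j => ?_) j
      · simp [vs, ws, w1]
      · simp [vs, ws, w1, edge]
  rw [h1, hvol_apply, Matrix.det_succ_column_zero, Finset.sum_eq_single 1, orientVec, inner_wedge]
  · have : Matrix.of (Fin.cons z.ofLp (fun k => (edge q k).ofLp) : Fin (n + 1) → Fin (n + 1) → ℝ) =
        (Matrix.of fun i => (Fin.cons (v' i).1 (v' i).2.ofLp : Fin (n + 2) → ℝ)).submatrix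
          (Fin.succAbove 1) Fin.succ := by
      ext i j
      refine Fin.cases ?_ (fun k => ?_) i
      · simp [w0]
      · have : Fin.succAbove (1 : Fin (n + 2)) k.succ = k.succ.succ := by
          rw [← Fin.succ_zero_eq_one, Fin.succ_succAbove_succ, Fin.succAbove_zero]
        simp [ws, this]
    rw [this]
    simp [w1]
  · intro i _ hi
    have hz : (v' i).1 = 0 := by
      revert hi
      refine Fin.cases ?_ (fun i => Fin.cases ?_ (fun i => ?_) i) i
      · simp [w0]
      · exact fun h => absurd rfl h
      · simp [ws]
    simp [hz]
  · simp

theorem orientVec_perm (q : Fin (n + 1) → E n) (p : Equiv.Perm (Fin (n + 1))) :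
    orientVec (q ∘ p) = ((Equiv.Perm.sign p : ℤ) : ℝ) • orientVec q := by
  refine ext_inner_right ℝ fun z => ?_
  rw [inner_smul_left, inner_orientVec, inner_orientVec,
    show hom (q ∘ p) = hom q ∘ p from rfl, ← cons_comp_decomposeFin, AlternatingMap.map_perm,
    Equiv.Perm.decomposeFin.symm_sign]
  simp [Units.smul_def]

theorem hvol_eq_zero_of_not_linearIndependent {v : Fin (n + 2) → ℝ × E n}
    (h : ¬ LinearIndependent ℝ v) : hvol n v = 0 :=
  AlternatingMap.map_linearDependent _ _ h

theorem finrank_hom : Module.finrank ℝ (ℝ × E n) = n + 2 := by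
  simp [Module.finrank_prod]; omega

theorem exists_eq_sum_of_hvol_ne_zero {v : Fin (n + 2) → ℝ × E n} (h : hvol n v ≠ 0)
    (p : ℝ × E n) : ∃ c : Fin (n + 2) → ℝ, ∑ i, c i • v i = p := by
  have hli : LinearIndependent ℝ v := by
    by_contra hc
    exact h (hvol_eq_zero_of_not_linearIndependent hc)
  have htop := hli.span_eq_top_of_card_eq_finrank (by rw [finrank_hom, Fintype.card_fin])
  exact (Submodule.mem_span_range_iff_exists_fun ℝ).1 (htop ▸ Submodule.mem_top)

/-- Cramer's rule. -/
theorem hvol_update_sum (v : Fin (n + 2) → ℝ × E n) (c : Fin (n + 2) → ℝ) (k : Fin (n + 2)) :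
    hvol n (Function.update v k (∑ i, c i • v i)) = c k * hvol n v := by
  rw [AlternatingMap.map_update_sum, Finset.sum_eq_single k]
  · rw [AlternatingMap.map_update_smul, Function.update_eq_self, smul_eq_mul]
  · intro i _ hi
    rw [AlternatingMap.map_update_smul, AlternatingMap.map_update_self _ _ hi.symm, smul_zero]
  · simp

theorem hdet_cons (t : E n) (q : Fin (n + 1) → E n) :
    hdet (Fin.cons t q : Fin (n + 2) → E n) = inner ℝ (orientVec q) (q 0 - t) := by
  have h : hom (Fin.cons t q : Fin (n + 2) → E n) =
      Function.update (Fin.cons (0, q 0 - t) (hom q) : Fin (n + 2) → ℝ × E n) 0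
        (∑ i, (Fin.cons (-1) (Pi.single 0 1) : Fin (n + 2) → ℝ) i •
          (Fin.cons (0, q 0 - t) (hom q) : Fin (n + 2) → ℝ × E n) i) := by
    funext i
    refine Fin.cases ?_ (fun k => ?_) i
    · rw [Function.update_self, Fin.sum_univ_succ, Finset.sum_eq_single 0]
      · ext <;> simp [hom]
      · intro b _ hb
        simp [hb]
      · simp
    · simp [hom]
  rw [hdet, h, hvol_update_sum, inner_orientVec]
  simp

theorem sum_smul_hom {ι : Type*} [Fintype ι] (w : ι → E n) (c : ι → ℝ) :
    ∑ i, c i • hom w i = (∑ i, c i, ∑ i, c i • w i) := by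
  ext1
  · simp [hom, Prod.fst_sum]
  · simp [hom, Prod.snd_sum]

theorem inner_orientVec_face (w : Fin (n + 2) → E n) (c : Fin (n + 2) → ℝ) (hc : ∑ i, c i = 0)
    (m : Fin (n + 2)) :
    inner ℝ (orientVec (w ∘ m.succAbove)) (∑ i, c i • w i) = -(c m * ((-1) ^ (m : ℕ) * hdet w)) := by
  rw [inner_orientVec]
  have h1 : (Fin.cons (0, ∑ i, c i • w i) (hom (w ∘ m.succAbove)) : Fin (n + 2) → ℝ × E n) =
      Function.update (hom w) m (∑ i, c i • hom w i) ∘ (Fin.cycleRange m).symm := by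
    rw [comp_cycleRange_symm, sum_smul_hom, hc]
    congr 1
    · simp
    · funext i
      simp [hom, Fin.succAbove_ne]
  rw [h1, AlternatingMap.map_perm, hvol_update_sum, Equiv.Perm.sign_symm, Fin.sign_cycleRange, hdet]
  simp [Units.smul_def]
  ring

theorem affineIndependent_of_hdet_ne_zero {w : Fin (n + 2) → E n} (h : hdet w ≠ 0) :
    AffineIndependent ℝ w := by
  have hli : LinearIndependent ℝ (hom w) := by
    by_contra hc
    exact h (hvol_eq_zero_of_not_linearIndependent hc)
  rw [affineIndependent_iff]
  intro s c hc0 hc i hi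
  rw [linearIndependent_iff'] at hli
  refine hli s c ?_ i hi
  ext1
  · simpa [hom, Prod.fst_sum] using hc0
  · simpa [hom, Prod.snd_sum] using hc

theorem inner_orientVec_sub_eq_zero (q : Fin (n + 1) → E n) (c : Fin (n + 1) → ℝ)
    (hc : ∑ i, c i = 0) : inner ℝ (orientVec q) (∑ i, c i • q i) = 0 := by
  rw [inner_orientVec, neg_eq_zero]
  refine hvol_eq_zero_of_not_linearIndependent fun hli => ?_
  rw [Fintype.linearIndependent_iff] at hli
  have h := hli (Fin.cons (-1) c) (by
    rw [Fin.sum_univ_succ]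
    simp only [Fin.cons_zero, Fin.cons_succ, sum_smul_hom, hc]
    simp) 0
  simp at h

theorem continuous_orientVec : Continuous (orientVec : (Fin (n + 1) → E n) → E n) := by
  refine (PiLp.continuous_toLp 2 _).comp (continuous_pi fun c => ?_)
  refine Continuous.matrix_det (continuous_pi fun i => continuous_pi fun j => ?_)
  refine Fin.cases ?_ (fun k => ?_) i
  · simp only [Matrix.of_apply, Fin.cons_zero]; fun_prop
  · simp only [Matrix.of_apply, Fin.cons_succ, edge]; fun_prop

end hvol

end SurfaceCluster

namespace SurfaceCluster

/-! ### Crossing numbers of segments and simplices -/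

theorem mem_convexHull_range_iff {V ι : Type*} [AddCommGroup V] [Module ℝ V] [Fintype ι]
    (q : ι → V) (z : V) : z ∈ convexHull ℝ (Set.range q) ↔
      ∃ w : ι → ℝ, (∀ k, 0 ≤ w k) ∧ ∑ k, w k = 1 ∧ z = ∑ k, w k • q k := by
  classical
  constructor
  · intro hz
    refine convexHull_min (t := {z | ∃ w : ι → ℝ, (∀ k, 0 ≤ w k) ∧ ∑ k, w k = 1 ∧
      z = ∑ k, w k • q k}) ?_ ?_ hz
    · rintro _ ⟨k, rfl⟩
      refine ⟨Pi.single k 1, fun j => ?_, by simp, ?_⟩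
      · by_cases h : j = k
        · subst h; simp
        · simp [h]
      · rw [Finset.sum_eq_single k] <;> simp +contextual
    · rintro _ ⟨w, hw, hw1, rfl⟩ _ ⟨v, hv, hv1, rfl⟩ a b ha hb hab
      refine ⟨fun k => a * w k + b * v k, fun k => ?_, ?_, ?_⟩
      · have := mul_nonneg ha (hw k); have := mul_nonneg hb (hv k); linarith
      · rw [Finset.sum_add_distrib, ← Finset.mul_sum, ← Finset.mul_sum, hw1, hv1]; linarith
      · simp only [add_smul, Finset.sum_add_distrib, Finset.smul_sum, mul_smul]
  · rintro ⟨w, hw, hw1, rfl⟩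
    exact (convex_convexHull ℝ _).sum_mem (fun k _ => hw k) hw1
      fun k _ => subset_convexHull ℝ _ ⟨k, rfl⟩

theorem hvol_ne_zero_of_linearIndependent {n : ℕ} {v : Fin (n + 2) → ℝ × E n}
    (h : LinearIndependent ℝ v) : hvol n v ≠ 0 := by
  have hli : LinearIndependent ℝ (Matrix.of fun i =>
      (Fin.cons (v i).1 (v i).2.ofLp : Fin (n + 2) → ℝ)).row := by
    refine h.map' (homCoord n) (LinearMap.ker_eq_bot.2 fun a b hab => ?_)
    have h1 : (Fin.cons a.1 a.2.ofLp : Fin (n + 2) → ℝ) = Fin.cons b.1 b.2.ofLp := hab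
    obtain ⟨h2, h3⟩ := Fin.cons_inj.1 h1
    exact Prod.ext h2 (by ext i; exact congrFun h3 i)
  exact ((Matrix.isUnit_iff_isUnit_det _).1
    (Matrix.linearIndependent_rows_iff_isUnit.1 hli)).ne_zero

section crossing

variable {n : ℕ}

theorem openSimplex_subset_convexHull (q : Fin (n + 1) → E n) :
    openSimplex q ⊆ convexHull ℝ (Set.range q) := by
  rintro z ⟨w, hw, hw1, rfl⟩
  exact (mem_convexHull_range_iff _ _).2 ⟨w, fun k => (hw k).le, hw1, rfl⟩

open Classical in
/-- The algebraic number of crossings of the segment from `x` to `y` with the open simplex `q`: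
it is `1` or `-1` if the segment passes through the open simplex in the direction of the normal or
against it, and `0` if it misses the open simplex or is parallel to it. -/
noncomputable def crossing (x y : E n) (q : Fin (n + 1) → E n) : ℤ :=
  if ∃ s ∈ Set.Ioo (0 : ℝ) 1, AffineMap.lineMap x y s ∈ openSimplex q then
    ((SignType.sign (inner ℝ (orientVec q) (y - x)) : SignType) : ℤ) else 0

/-- The segment from `x` to `y` is in general position with respect to the simplex `q`: either it
misses the closed simplex, or it crosses the open simplex transversally at an inner point. -/
def InGenPos (x y : E n) (q : Fin (n + 1) → E n) : Prop :=
  crossing x y q ≠ 0 ∨ ∀ s ∈ Set.Icc (0 : ℝ) 1,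
    AffineMap.lineMap x y s ∉ convexHull ℝ (Set.range q)

theorem crossing_ne_zero_iff {x y : E n} {q : Fin (n + 1) → E n} : crossing x y q ≠ 0 ↔
    (∃ s ∈ Set.Ioo (0 : ℝ) 1, AffineMap.lineMap x y s ∈ openSimplex q) ∧
      inner ℝ (orientVec q) (y - x) ≠ 0 := by
  unfold crossing
  split_ifs with h
  · simp only [h, true_and, ne_eq]
    rw [not_iff_not, ← sign_eq_zero_iff (a := inner ℝ (orientVec q) (y - x))]
    generalize SignType.sign (inner ℝ (orientVec q) (y - x)) = s
    revert s; decide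
  · exact ⟨fun h0 => absurd rfl h0, fun h0 => absurd h0.1 h⟩

theorem crossing_of_mem {x y : E n} {q : Fin (n + 1) → E n} {s : ℝ} (hs : s ∈ Set.Ioo (0 : ℝ) 1)
    (h : AffineMap.lineMap x y s ∈ openSimplex q) :
    crossing x y q = ((SignType.sign (inner ℝ (orientVec q) (y - x)) : SignType) : ℤ) := by
  unfold crossing
  exact if_pos ⟨s, hs, h⟩

theorem crossing_eq_zero_of_forall {x y : E n} {q : Fin (n + 1) → E n}
    (h : ∀ s ∈ Set.Icc (0 : ℝ) 1, AffineMap.lineMap x y s ∉ convexHull ℝ (Set.range q)) :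
    crossing x y q = 0 := by
  unfold crossing
  refine if_neg ?_
  rintro ⟨s, hs, hq⟩
  exact h s ⟨hs.1.le, hs.2.le⟩ (openSimplex_subset_convexHull q hq)

theorem openSimplex_perm (q : Fin (n + 1) → E n) (p : Equiv.Perm (Fin (n + 1))) :
    openSimplex (q ∘ p) = openSimplex q := by
  ext z
  constructor
  · rintro ⟨w, hw, hw1, rfl⟩
    refine ⟨w ∘ p.symm, fun k => hw _, ?_, ?_⟩
    · rw [← hw1]; exact Equiv.sum_comp p.symm w
    · exact Fintype.sum_equiv p _ _ fun k => by simp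
  · rintro ⟨w, hw, hw1, rfl⟩
    refine ⟨w ∘ p, fun k => hw _, ?_, ?_⟩
    · rw [← hw1]; exact Equiv.sum_comp p w
    · exact Fintype.sum_equiv p.symm _ _ fun k => by simp

theorem crossing_perm (x y : E n) (q : Fin (n + 1) → E n) (p : Equiv.Perm (Fin (n + 1))) :
    crossing x y (q ∘ p) = (Equiv.Perm.sign p : ℤ) * crossing x y q := by
  unfold crossing
  rw [openSimplex_perm]
  split_ifs with h
  · rw [orientVec_perm, inner_smul_left]
    rcases Int.units_eq_one_or (Equiv.Perm.sign p) with hp | hp <;> rw [hp]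
    · simp
    · have : ∀ r : ℝ, ((SignType.sign (-r) : SignType) : ℤ) = -((SignType.sign r : SignType) : ℤ) := by
        intro r
        rw [Left.sign_neg]
        generalize SignType.sign r = s
        revert s; decide
      simp [this]
  · simp

theorem inner_orientVec_eq_zero_of_mem {q : Fin (n + 1) → E n} {z z' : E n}
    (hz : z ∈ convexHull ℝ (Set.range q)) (hz' : z' ∈ convexHull ℝ (Set.range q)) :
    inner ℝ (orientVec q) (z' - z) = 0 := by
  obtain ⟨w, -, hw1, rfl⟩ := (mem_convexHull_range_iff _ _).1 hz
  obtain ⟨w', -, hw1', rfl⟩ := (mem_convexHull_range_iff _ _).1 hz'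
  have := inner_orientVec_sub_eq_zero q (fun k => w' k - w k) (by
    rw [Finset.sum_sub_distrib, hw1, hw1', sub_self])
  simpa only [sub_smul, Finset.sum_sub_distrib] using this

theorem eq_of_lineMap_mem {x y : E n} {q : Fin (n + 1) → E n}
    (h : inner ℝ (orientVec q) (y - x) ≠ 0) {s s' : ℝ}
    (hs : AffineMap.lineMap x y s ∈ convexHull ℝ (Set.range q))
    (hs' : AffineMap.lineMap x y s' ∈ convexHull ℝ (Set.range q)) : s' = s := by
  have h1 := inner_orientVec_eq_zero_of_mem hs hs'
  have h2 : AffineMap.lineMap x y s' - AffineMap.lineMap x y s = (s' - s) • (y - x) := by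
    simp only [AffineMap.lineMap_apply_module']
    module
  rw [h2, inner_smul_right] at h1
  have := (mul_eq_zero.1 h1).resolve_right h
  linarith

/-- A transversal crossing survives small perturbations of the simplex: the crossing point and its
barycentric coordinates depend continuously on the vertices, by Cramer's rule. -/
theorem eventually_crossing_eq_of_ne_zero {x y : E n} {q : Fin (n + 1) → E n}
    (h : crossing x y q ≠ 0) : ∀ᶠ q' in 𝓝 q, crossing x y q' = crossing x y q := by
  obtain ⟨⟨s, hs, w, hw, hw1, hz⟩, hA⟩ := crossing_ne_zero_iff.1 h
  set V : (Fin (n + 1) → E n) → Fin (n + 2) → ℝ × E n := fun q' => Fin.cons (0, y - x) (hom q')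
    with hV
  have hVc : Continuous V := by
    refine continuous_pi fun i => ?_
    refine Fin.cases ?_ (fun k => ?_) i
    · simp only [hV, Fin.cons_zero]; fun_prop
    · simp only [hV, Fin.cons_succ, hom]; fun_prop
  -- numerators of Cramer's rule
  set N : (Fin (n + 1) → E n) → Fin (n + 2) → ℝ := fun q' i =>
    hvol n (Function.update (V q') i (1, x)) with hN
  have hNc : ∀ i, Continuous fun q' => N q' i := fun i =>
    continuous_hvol.comp (hVc.update i continuous_const)
  have hDc : Continuous fun q' => hvol n (V q') := continuous_hvol.comp hVc
  have hD : hvol n (V q) ≠ 0 := by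
    rw [inner_orientVec] at hA
    exact fun h0 => hA (by rw [neg_eq_zero]; exact h0)
  have hsol : ∀ q' (c : Fin (n + 2) → ℝ), ∑ i, c i • V q' i = (1, x) →
      ∀ i, N q' i = c i * hvol n (V q') := by
    intro q' c hc i
    simp only [hN]
    rw [← hc, hvol_update_sum]
  have hq : ∑ i, (Fin.cons (-s) w : Fin (n + 2) → ℝ) i • V q i = (1, x) := by
    rw [Fin.sum_univ_succ]
    simp only [hV, Fin.cons_zero, Fin.cons_succ, sum_smul_hom, hw1, ← hz]
    ext1
    · simp
    · simp only [AffineMap.lineMap_apply_module', Prod.snd_add, Prod.smul_snd]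
      module
  have hNq := hsol q _ hq
  have hdivc : ∀ i, ContinuousAt (fun q' => N q' i / hvol n (V q')) q := fun i =>
    (hNc i).continuousAt.div hDc.continuousAt hD
  have hval : ∀ i, N q i / hvol n (V q) = (Fin.cons (-s) w : Fin (n + 2) → ℝ) i := fun i => by
    rw [hNq, mul_div_cancel_right₀ _ hD]
  have e1 : ∀ᶠ q' in 𝓝 q, hvol n (V q') ≠ 0 := hDc.continuousAt.eventually_ne hD
  have e2 : ∀ᶠ q' in 𝓝 q, ∀ k : Fin (n + 1), 0 < N q' k.succ / hvol n (V q') := by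
    rw [Filter.eventually_all]
    intro k
    refine (hdivc k.succ).eventually (lt_mem_nhds ?_)
    exact (hw k).trans_eq (hval k.succ).symm
  have e3 : ∀ᶠ q' in 𝓝 q, N q' 0 / hvol n (V q') ∈ Set.Ioo (-1 : ℝ) 0 := by
    refine (hdivc 0).eventually (Ioo_mem_nhds ?_ ?_)
    · exact (neg_lt_neg hs.2).trans_eq (hval 0).symm
    · exact (hval 0).trans_lt (neg_lt_zero.2 hs.1)
  have e4 : ∀ᶠ q' in 𝓝 q, SignType.sign (inner ℝ (orientVec q') (y - x)) =
      SignType.sign (inner ℝ (orientVec q) (y - x)) := by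
    have hc : ContinuousAt (fun q' : Fin (n + 1) → E n => inner ℝ (orientVec q') (y - x)) q :=
      (continuous_orientVec.inner continuous_const).continuousAt
    rcases lt_or_gt_of_ne hA with h0 | h0
    · filter_upwards [hc.eventually (gt_mem_nhds h0)] with q' hq'
      rw [sign_neg hq', sign_neg h0]
    · filter_upwards [hc.eventually (lt_mem_nhds h0)] with q' hq'
      rw [sign_pos hq', sign_pos h0]
  filter_upwards [e1, e2, e3, e4] with q' h1 h2 h3 h4
  obtain ⟨c, hc⟩ := exists_eq_sum_of_hvol_ne_zero h1 (1, x)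
  have hcN : ∀ i, N q' i / hvol n (V q') = c i := fun i => by
    rw [hsol q' c hc, mul_div_cancel_right₀ _ h1]
  rw [Fin.sum_univ_succ] at hc
  simp only [hV, Fin.cons_zero, Fin.cons_succ, sum_smul_hom] at hc
  have hc1 : ∑ k : Fin (n + 1), c k.succ = 1 := by simpa using congrArg Prod.fst hc
  have hc2 : c 0 • (y - x) + ∑ k : Fin (n + 1), c k.succ • q' k = x := by
    simpa using congrArg Prod.snd hc
  rw [hcN] at h3
  have hmem : AffineMap.lineMap x y (-c 0) ∈ openSimplex q' := by
    refine ⟨fun k => c k.succ, fun k => (h2 k).trans_eq (hcN k.succ), hc1, ?_⟩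
    rw [AffineMap.lineMap_apply_module', ← sub_eq_zero]
    rw [← sub_eq_zero] at hc2
    rw [← neg_eq_zero, ← hc2]
    module
  rw [crossing_of_mem ⟨by linarith [h3.2], by linarith [h3.1]⟩ hmem, h4,
    crossing_of_mem hs ⟨w, hw, hw1, hz⟩]

theorem eventually_forall_notMem {x y : E n} {ι : Type*} [Fintype ι] {q : ι → E n}
    (h : ∀ s ∈ Set.Icc (0 : ℝ) 1, AffineMap.lineMap x y s ∉ convexHull ℝ (Set.range q)) :
    ∀ᶠ q' in 𝓝 q, ∀ s ∈ Set.Icc (0 : ℝ) 1,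
      AffineMap.lineMap x y s ∉ convexHull ℝ (Set.range q') := by
  have hK : IsCompact (Set.Icc (0 : ℝ) 1 ×ˢ stdSimplex ℝ ι) :=
    isCompact_Icc.prod (isCompact_stdSimplex ℝ ι)
  have h1 := hK.eventually_forall_of_forall_eventually (x₀ := q)
    (P := fun q' p => AffineMap.lineMap x y p.1 ≠ ∑ k, p.2 k • q' k) (by
      rintro ⟨s, w⟩ ⟨hs, hw⟩
      have hc : Continuous fun z : (ι → E n) × ℝ × (ι → ℝ) =>
          AffineMap.lineMap x y z.2.1 - ∑ k, z.2.2 k • z.1 k := by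
        simp only [AffineMap.lineMap_apply_module']
        fun_prop
      have hne : AffineMap.lineMap x y s - ∑ k, w k • q k ≠ 0 := fun heq =>
        h s hs ((mem_convexHull_range_iff _ _).2 ⟨w, hw.1, hw.2, sub_eq_zero.1 heq⟩)
      filter_upwards [(hc.continuousAt (x := (q, s, w))).eventually_ne hne] with z hz
      exact sub_ne_zero.1 hz)
  filter_upwards [h1] with q' hq' s hs hmem
  obtain ⟨w, hw, hw1, hz⟩ := (mem_convexHull_range_iff _ _).1 hmem
  exact hq' (s, w) ⟨hs, hw, hw1⟩ hz

theorem InGenPos.eventually {x y : E n} {q : Fin (n + 1) → E n} (h : InGenPos x y q) :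
    ∀ᶠ q' in 𝓝 q, crossing x y q' = crossing x y q ∧ InGenPos x y q' := by
  rcases h with h | h
  · filter_upwards [eventually_crossing_eq_of_ne_zero h] with q' hq'
    exact ⟨hq', Or.inl (hq' ▸ h)⟩
  · filter_upwards [eventually_forall_notMem h] with q' hq'
    exact ⟨by rw [crossing_eq_zero_of_forall h, crossing_eq_zero_of_forall hq'], Or.inr hq'⟩

/-- Sufficient conditions for general position: the end points avoid the affine span of the
simplex, and the end point `y` avoids the cones with apex `x` over the facets. -/
theorem inGenPos_of_notMem {x y : E n} {q : Fin (n + 1) → E n}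
    (hx : x ∉ affineSpan ℝ (Set.range q)) (hy : y ∉ affineSpan ℝ (Set.range q))
    (hxy : ∀ k : Fin (n + 1),
      y ∉ affineSpan ℝ (insert x (Set.range fun j : {j // j ≠ k} => q j))) :
    InGenPos x y q := by
  have hmemspan : ∀ c : Fin (n + 1) → ℝ, ∑ k, c k = 1 →
      ∑ k, c k • q k ∈ affineSpan ℝ (Set.range q) := by
    intro c hc
    rw [← Finset.affineCombination_eq_linear_combination _ _ _ hc]
    exact affineCombination_mem_affineSpan hc q
  -- an affine combination on the line through `x` and `y`, in which a coefficient vanishes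
  have hbad : ∀ (s : ℝ) (c : Fin (n + 1) → ℝ) (k : Fin (n + 1)), ∑ k, c k = 1 → c k = 0 →
      AffineMap.lineMap x y s = ∑ k, c k • q k → False := by
    intro s c k hc hk hz
    have hmem : ∑ k, c k • q k ∈
        affineSpan ℝ (insert x (Set.range fun j : {j // j ≠ k} => q j)) := by
      have h1 : ∑ j, c j • q j = ∑ j ∈ Finset.univ.erase k, c j • q j := by
        rw [← Finset.add_sum_erase _ _ (Finset.mem_univ k), hk, zero_smul, zero_add]
      have h2 : ∑ j ∈ Finset.univ.erase k, c j = 1 := by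
        rw [← hc, ← Finset.add_sum_erase Finset.univ c (Finset.mem_univ k), hk, zero_add]
      rw [h1, ← Finset.affineCombination_eq_linear_combination _ _ _ h2]
      refine affineSpan_mono ℝ (s₁ := q '' (Finset.univ.erase k : Finset _)) ?_
        (affineCombination_mem_affineSpan_image h2 (fun i hi hi' => absurd hi hi') q)
      rintro _ ⟨j, hj, rfl⟩
      exact Or.inr ⟨⟨j, by simpa using hj⟩, rfl⟩
    have hxm : x ∈ affineSpan ℝ (insert x (Set.range fun j : {j // j ≠ k} => q j)) :=
      subset_affineSpan ℝ _ (Set.mem_insert _ _)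
    have hs0 : s ≠ 0 := by
      rintro rfl
      rw [AffineMap.lineMap_apply_zero] at hz
      exact hx (hz ▸ hmemspan c hc)
    refine hxy k ?_
    have := AffineMap.lineMap_mem (s⁻¹) hxm (hz ▸ hmem)
    have h3 : AffineMap.lineMap x (AffineMap.lineMap x y s) s⁻¹ = y := by
      simp only [AffineMap.lineMap_apply_module']
      rw [add_sub_cancel_right, smul_smul, inv_mul_cancel₀ hs0, one_smul, sub_add_cancel]
    rwa [h3] at this
  by_cases h : ∀ s ∈ Set.Icc (0 : ℝ) 1, AffineMap.lineMap x y s ∉ convexHull ℝ (Set.range q)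
  · exact Or.inr h
  left
  push Not at h
  obtain ⟨s, hs, hmem⟩ := h
  obtain ⟨w, hw, hw1, hz⟩ := (mem_convexHull_range_iff _ _).1 hmem
  have hs0 : s ≠ 0 := by
    rintro rfl
    rw [AffineMap.lineMap_apply_zero] at hz
    exact hx (hz ▸ hmemspan w hw1)
  have hs1 : s ≠ 1 := by
    rintro rfl
    rw [AffineMap.lineMap_apply_one] at hz
    exact hy (hz ▸ hmemspan w hw1)
  refine crossing_ne_zero_iff.2 ⟨⟨s, ⟨lt_of_le_of_ne hs.1 hs0.symm, lt_of_le_of_ne hs.2 hs1⟩, w,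
    fun k => lt_of_le_of_ne (hw k) fun h => hbad s w k hw1 h.symm hz, hw1, hz⟩, ?_⟩
  -- if the line were parallel to the simplex, it could be followed to a facet
  intro h0
  rw [inner_orientVec, neg_eq_zero] at h0
  have hdep : ¬ LinearIndependent ℝ (Fin.cons (0, y - x) (hom q) : Fin (n + 2) → ℝ × E n) :=
    fun hli => hvol_ne_zero_of_linearIndependent hli h0
  obtain ⟨c, hc, i, hi⟩ := Fintype.not_linearIndependent_iff.1 hdep
  rw [Fin.sum_univ_succ] at hc
  simp only [Fin.cons_zero, Fin.cons_succ, sum_smul_hom] at hc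
  have hc1 : ∑ k : Fin (n + 1), c k.succ = 0 := by simpa using congrArg Prod.fst hc
  have hc2 : c 0 • (y - x) + ∑ k : Fin (n + 1), c k.succ • q k = 0 := by
    simpa using congrArg Prod.snd hc
  obtain ⟨k, hk⟩ : ∃ k : Fin (n + 1), c k.succ ≠ 0 := by
    by_contra hall
    push Not at hall
    simp only [hall, zero_smul, Finset.sum_const_zero, add_zero] at hc2
    rcases smul_eq_zero.1 hc2 with h4 | h4
    · refine hi ?_
      refine Fin.cases h4 hall i
    · have hyx : y = x := sub_eq_zero.1 h4
      subst hyx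
      rw [AffineMap.lineMap_same_apply] at hz
      exact hx (hz ▸ hmemspan w hw1)
  refine hbad (s + w k / c k.succ * c 0) (fun j => w j - w k / c k.succ * c j.succ) k ?_ ?_ ?_
  · rw [Finset.sum_sub_distrib, ← Finset.mul_sum, hc1, hw1]; ring
  · field_simp; ring
  · simp only [sub_smul, Finset.sum_sub_distrib, ← hz, mul_smul, ← Finset.smul_sum]
    have h5 : ∑ k : Fin (n + 1), c k.succ • q k = -(c 0 • (y - x)) :=
      (neg_eq_of_add_eq_zero_right hc2).symm
    rw [h5]
    simp only [AffineMap.lineMap_apply_module']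
    module

end crossing

end SurfaceCluster

namespace SurfaceCluster

/-! ### Crossing numbers with the boundary of a simplex -/

/-- The total variation of a step function: a function on the line that is constant on both sides
of each point of `[0, 1]`, with jump `∑_{τ i = s} ε i` at `s`, changes by `∑ ε i` from `0` to
`1`. -/
theorem sub_eq_sum_jumps {ι : Type*} [Fintype ι] (g : ℝ → ℤ) (τ : ι → ℝ) (ε : ι → ℤ)
    (hτ : ∀ i, τ i ∈ Set.Ioo (0 : ℝ) 1) (h0 : ∀ᶠ u in 𝓝[>] (0 : ℝ), g u = g 0)
    (h1 : ∀ᶠ u in 𝓝[<] (1 : ℝ), g u = g 1)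
    (h : ∀ s ∈ Set.Icc (0 : ℝ) 1, ∃ a b : ℤ, (∀ᶠ u in 𝓝[<] s, g u = a) ∧
      (∀ᶠ u in 𝓝[>] s, g u = b) ∧ b - a = ∑ i, if τ i = s then ε i else 0) :
    g 1 - g 0 = ∑ i, ε i := by
  classical
  choose! a b ha hb hab using h
  -- subtracting the jumps leaves a function that is locally constant off the jump points
  set G : ℝ → ℤ := fun u => g u - ∑ i, if τ i < u then ε i else 0 with hG
  set L : ℝ → ℤ := fun s => a s - ∑ i, if τ i < s then ε i else 0 with hL
  have hleft : ∀ s ∈ Set.Icc (0 : ℝ) 1, ∀ᶠ u in 𝓝[<] s, G u = L s := by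
    intro s hs
    have e : ∀ᶠ u in 𝓝[<] s, ∀ i, τ i < s → τ i < u := by
      rw [Filter.eventually_all]
      intro i
      by_cases hi : τ i < s
      · filter_upwards [nhdsWithin_le_nhds (lt_mem_nhds hi)] with u hu _ using hu
      · exact Filter.Eventually.of_forall fun u h => absurd h hi
    filter_upwards [ha s hs, e, self_mem_nhdsWithin] with u hu hi hus
    simp only [hG, hL, hu]
    congr 1
    refine Finset.sum_congr rfl fun i _ => ?_
    have hiff : τ i < u ↔ τ i < s := ⟨fun h => h.trans hus, hi i⟩
    simp only [hiff]
  have hright : ∀ s ∈ Set.Icc (0 : ℝ) 1, ∀ᶠ u in 𝓝[>] s, G u = L s := by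
    intro s hs
    have e : ∀ᶠ u in 𝓝[>] s, ∀ i, s < τ i → u < τ i := by
      rw [Filter.eventually_all]
      intro i
      by_cases hi : s < τ i
      · filter_upwards [nhdsWithin_le_nhds (gt_mem_nhds hi)] with u hu _ using hu
      · exact Filter.Eventually.of_forall fun u h => absurd h hi
    filter_upwards [hb s hs, e, self_mem_nhdsWithin] with u hu hi hus
    have hbs : b s = a s + ∑ i, if τ i = s then ε i else 0 := by rw [← hab s hs]; ring
    simp only [hG, hL, hu]
    rw [hbs, add_sub_assoc, sub_eq_add_neg (a s)]
    congr 1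
    rw [sub_eq_iff_eq_add, neg_add_eq_sub, eq_sub_iff_add_eq, ← Finset.sum_add_distrib]
    refine Finset.sum_congr rfl fun i _ => ?_
    have hus' : s < u := hus
    rcases lt_trichotomy (τ i) s with h2 | h2 | h2
    · rw [if_neg h2.ne, if_pos h2, if_pos (h2.trans hus'), zero_add]
    · rw [if_pos h2, if_neg (by rw [h2]; exact lt_irrefl _), if_pos (by rw [h2]; exact hus'),
        add_zero]
    · rw [if_neg h2.ne', if_neg h2.le.not_gt, if_neg (hi i h2).le.not_gt, zero_add]
  have hconst : ∀ s ∈ Set.Icc (0 : ℝ) 1, ∀ᶠ u in 𝓝 s, u ∈ Set.Icc (0 : ℝ) 1 → L u = L s := by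
    intro s hs
    have el : ∀ᶠ u in 𝓝[<] s, u ∈ Set.Icc (0 : ℝ) 1 → L u = L s := by
      have := eventually_eventually_nhdsWithin.2 (hleft s hs)
      filter_upwards [this, self_mem_nhdsWithin] with u hu hus hu01
      have h2 : ∀ᶠ v in 𝓝 u, G v = L s := by
        rwa [IsOpen.nhdsWithin_eq isOpen_Iio hus] at hu
      obtain ⟨v, hv1, hv2⟩ := ((hleft u hu01).and (nhdsWithin_le_nhds h2)).exists
      rw [← hv1, hv2]
    have er : ∀ᶠ u in 𝓝[>] s, u ∈ Set.Icc (0 : ℝ) 1 → L u = L s := by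
      have := eventually_eventually_nhdsWithin.2 (hright s hs)
      filter_upwards [this, self_mem_nhdsWithin] with u hu hus hu01
      have h2 : ∀ᶠ v in 𝓝 u, G v = L s := by
        rwa [IsOpen.nhdsWithin_eq isOpen_Ioi hus] at hu
      obtain ⟨v, hv1, hv2⟩ := ((hleft u hu01).and (nhdsWithin_le_nhds h2)).exists
      rw [← hv1, hv2]
    rw [← nhdsNE_sup_pure, ← nhdsLT_sup_nhdsGT, Filter.eventually_sup, Filter.eventually_sup]
    exact ⟨⟨el, er⟩, Filter.eventually_pure.2 fun _ => rfl⟩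
  have hcont : ContinuousOn L (Set.Icc 0 1) := by
    intro s hs
    refine ContinuousWithinAt.congr_of_eventuallyEq
      (continuousWithinAt_const (b := L s)) ?_ rfl
    rw [Filter.EventuallyEq, eventually_nhdsWithin_iff]
    exact hconst s hs
  have hL01 := isPreconnected_Icc.constant hcont (Set.left_mem_Icc.2 zero_le_one)
    (Set.right_mem_Icc.2 zero_le_one)
  have hb0 : b 0 = g 0 := by
    obtain ⟨u, hu1, hu2⟩ := ((hb 0 (by simp)).and h0).exists
    rw [← hu1, hu2]
  have ha1 : a 1 = g 1 := by
    obtain ⟨u, hu1, hu2⟩ := ((ha 1 (by simp)).and h1).exists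
    rw [← hu1, hu2]
  have hz : b 0 - a 0 = 0 := by
    rw [hab 0 (by simp)]
    exact Finset.sum_eq_zero fun i _ => if_neg (hτ i).1.ne'
  have hs0 : (∑ i, if τ i < 0 then ε i else 0) = 0 :=
    Finset.sum_eq_zero fun i _ => if_neg (hτ i).1.le.not_gt
  have hs1 : (∑ i, if τ i < 1 then ε i else 0) = ∑ i, ε i :=
    Finset.sum_congr rfl fun i _ => if_pos (hτ i).2
  simp only [hL, hs0, hs1] at hL01
  linarith

theorem int_sign_mul (a b : ℝ) : ((SignType.sign (a * b) : SignType) : ℤ) =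
    ((SignType.sign a : SignType) : ℤ) * ((SignType.sign b : SignType) : ℤ) := by
  rw [sign_mul]
  generalize SignType.sign a = s
  generalize SignType.sign b = t
  revert s t; decide

theorem int_sign_neg (a : ℝ) : ((SignType.sign (-a) : SignType) : ℤ) =
    -((SignType.sign a : SignType) : ℤ) := by
  rw [Left.sign_neg]
  generalize SignType.sign a = s
  revert s; decide

theorem int_sign_neg_one_pow (m : ℕ) : ((SignType.sign ((-1 : ℝ) ^ m) : SignType) : ℤ) =
    (-1) ^ m := by
  rcases Nat.even_or_odd m with h | h
  · simp [h.neg_one_pow]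
  · simp [h.neg_one_pow]

section boundary

variable {n : ℕ}

open Classical in
/-- The indicator function of the `d`-simplex with vertices `w`, with the sign of the orientation
of the simplex. It vanishes for degenerate simplices. -/
noncomputable def signedIndicator (w : Fin (n + 2) → E n) (x : E n) : ℤ :=
  if x ∈ convexHull ℝ (Set.range w) then ((SignType.sign (hdet w) : SignType) : ℤ) else 0

theorem AffineBasis.coord_sum {ι V : Type*} [Fintype ι] [AddCommGroup V] [Module ℝ V]
    (b : AffineBasis ι ℝ V) (c : ι → ℝ) (hc : ∑ i, c i = 1) (l : ι) :
    b.coord l (∑ i, c i • b i) = c l := by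
  rw [← Finset.affineCombination_eq_linear_combination _ _ _ hc]
  exact b.coord_apply_combination_of_mem (Finset.mem_univ l) hc

theorem AffineBasis.sum_coord_smul {ι V : Type*} [Fintype ι] [AddCommGroup V] [Module ℝ V]
    (b : AffineBasis ι ℝ V) (z : V) : ∑ i, b.coord i z • b i = z :=
  b.linear_combination_coord_eq_self z

/-- The signed crossings of a segment with the facets of a nondegenerate simplex are the jumps of the
indicator function of the simplex along the segment, as the barycentric coordinates show. -/
theorem sum_crossing_faces_of_hdet_ne_zero {w : Fin (n + 2) → E n} (hw : hdet w ≠ 0) {x y : E n}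
    (hgen : ∀ m : Fin (n + 2), InGenPos x y (w ∘ m.succAbove)) :
    ∑ m : Fin (n + 2), (-1) ^ (m : ℕ) * crossing x y (w ∘ m.succAbove) =
      signedIndicator w x - signedIndicator w y := by
  classical
  have hind := affineIndependent_of_hdet_ne_zero hw
  let b : AffineBasis (Fin (n + 2)) ℝ (E n) := ⟨w, hind,
    hind.affineSpan_eq_top_iff_card_eq_finrank_add_one.2 (by simp)⟩
  have hbw : ∀ m, b m = w m := fun m => rfl
  set z : ℝ → E n := fun s => AffineMap.lineMap x y s with hz
  set Δ : Fin (n + 2) → ℝ := fun m => b.coord m y - b.coord m x with hΔ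
  have hφ : ∀ m s, b.coord m (z s) = b.coord m x + s * Δ m := by
    intro m s
    simp only [hz, hΔ]
    rw [AffineMap.apply_lineMap, AffineMap.lineMap_apply_module', smul_eq_mul]; ring
  have hφc : ∀ m, Continuous fun s => b.coord m (z s) := fun m => by
    simp only [hφ]; fun_prop
  have hface : ∀ m s, b.coord m (z s) = 0 → (∀ l, 0 ≤ b.coord l (z s)) →
      z s ∈ convexHull ℝ (Set.range (w ∘ m.succAbove)) := by
    intro m s hm hl
    refine (mem_convexHull_range_iff _ _).2 ⟨fun k => b.coord (m.succAbove k) (z s),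
      fun k => hl _, ?_, ?_⟩
    · have := b.sum_coord_apply_eq_one (z s)
      rwa [Fin.sum_univ_succAbove _ m, hm, zero_add] at this
    · have := AffineBasis.sum_coord_smul b (z s)
      rw [Fin.sum_univ_succAbove _ m, hm, zero_smul, zero_add] at this
      exact this.symm
  have hopen : ∀ m s, z s ∈ openSimplex (w ∘ m.succAbove) →
      b.coord m (z s) = 0 ∧ ∀ l, l ≠ m → 0 < b.coord l (z s) := by
    rintro m s ⟨c, hc, hc1, hzs⟩
    have h1 : ∑ i, (m.insertNth 0 c : Fin (n + 2) → ℝ) i = 1 := by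
      rw [Fin.sum_univ_succAbove _ m]; simp [hc1]
    have h2 : z s = ∑ i, (m.insertNth 0 c : Fin (n + 2) → ℝ) i • b i := by
      rw [Fin.sum_univ_succAbove _ m, hzs]; simp [hbw]
    rw [h2]
    refine ⟨by rw [AffineBasis.coord_sum b _ h1]; simp, fun l hl => ?_⟩
    rw [AffineBasis.coord_sum b _ h1]
    obtain ⟨k, rfl⟩ := Fin.exists_succAbove_eq hl
    simpa using hc k
  have hAe : ∀ m : Fin (n + 2), inner ℝ (orientVec (w ∘ m.succAbove)) (y - x) =
      -(Δ m * ((-1) ^ (m : ℕ) * hdet w)) := by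
    intro m
    rw [← inner_orientVec_face w Δ]
    · simp only [hΔ, sub_smul, Finset.sum_sub_distrib]
      have h1 := AffineBasis.sum_coord_smul b y
      have h2 := AffineBasis.sum_coord_smul b x
      simp only [hbw] at h1 h2
      rw [h1, h2]
    · simp only [hΔ, Finset.sum_sub_distrib]
      rw [b.sum_coord_apply_eq_one, b.sum_coord_apply_eq_one, sub_self]
  -- a point of a closed face on the segment is a transversal crossing of the open face
  have hcross : ∀ m, ∀ s ∈ Set.Icc (0 : ℝ) 1, b.coord m (z s) = 0 →
      (∀ l, 0 ≤ b.coord l (z s)) → s ∈ Set.Ioo (0 : ℝ) 1 ∧ Δ m ≠ 0 ∧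
        (∀ l, l ≠ m → 0 < b.coord l (z s)) ∧ z s ∈ openSimplex (w ∘ m.succAbove) := by
    intro m s hs hm hl
    have hmem := hface m s hm hl
    have hne := (hgen m).resolve_right fun h => h s hs hmem
    obtain ⟨⟨s', hs', ho⟩, hA⟩ := crossing_ne_zero_iff.1 hne
    have hss : s' = s := eq_of_lineMap_mem hA hmem (openSimplex_subset_convexHull _ ho)
    subst hss
    refine ⟨hs', ?_, (hopen m _ ho).2, ho⟩
    rintro h0
    rw [hAe, h0] at hA
    simp at hA
  set P : Fin (n + 2) → Prop := fun m => ∃ s ∈ Set.Ioo (0 : ℝ) 1, z s ∈ openSimplex (w ∘ m.succAbove)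
    with hP
  set τ : Fin (n + 2) → ℝ := fun m => if h : P m then h.choose else 1 / 2 with hτ
  set ε : Fin (n + 2) → ℤ := fun m => if P m then ((SignType.sign (Δ m) : SignType) : ℤ) else 0
    with hε
  set g : ℝ → ℤ := fun s => if z s ∈ convexHull ℝ (Set.range w) then 1 else 0 with hg
  have hmemw : ∀ s, z s ∈ convexHull ℝ (Set.range w) ↔ ∀ l, 0 ≤ b.coord l (z s) := by
    intro s
    have := b.convexHull_eq_nonneg_coord
    rw [Set.ext_iff] at this
    exact this (z s)
  have hτspec : ∀ m, P m → τ m ∈ Set.Ioo (0 : ℝ) 1 ∧ z (τ m) ∈ openSimplex (w ∘ m.succAbove) := by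
    intro m hm
    simp only [hτ, dif_pos hm]
    exact hm.choose_spec
  have hτI : ∀ m, τ m ∈ Set.Ioo (0 : ℝ) 1 := by
    intro m
    by_cases hm : P m
    · exact (hτspec m hm).1
    · simp only [hτ, dif_neg hm]; norm_num
  have hg1 : ∀ s, (∀ l, 0 < b.coord l (z s)) → ∀ᶠ u in 𝓝 s, g u = 1 := by
    intro s hl
    have : ∀ᶠ u in 𝓝 s, ∀ l, 0 < b.coord l (z u) :=
      Filter.eventually_all.2 fun l => (hφc l).continuousAt.eventually (lt_mem_nhds (hl l))
    filter_upwards [this] with u hu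
    exact if_pos ((hmemw u).2 fun l => (hu l).le)
  have hg0 : ∀ s l, b.coord l (z s) < 0 → ∀ᶠ u in 𝓝 s, g u = 0 := by
    intro s l hl
    filter_upwards [(hφc l).continuousAt.eventually (gt_mem_nhds hl)] with u hu
    exact if_neg fun h => ((hmemw u).1 h l).not_gt hu
  have htri : ∀ s, (∃ l, b.coord l (z s) < 0) ∨ (∀ l, 0 < b.coord l (z s)) ∨
      ((∀ l, 0 ≤ b.coord l (z s)) ∧ ∃ m, b.coord m (z s) = 0) := by
    intro s
    by_cases h1 : ∃ l, b.coord l (z s) < 0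
    · exact Or.inl h1
    · push Not at h1
      by_cases h2 : ∃ m, b.coord m (z s) = 0
      · exact Or.inr (Or.inr ⟨h1, h2⟩)
      · push Not at h2
        exact Or.inr (Or.inl fun l => lt_of_le_of_ne (h1 l) (h2 l).symm)
  have hend : ∀ s ∈ Set.Icc (0 : ℝ) 1, s ∉ Set.Ioo (0 : ℝ) 1 → ∀ᶠ u in 𝓝 s, g u = g s := by
    intro s hs hs'
    rcases htri s with ⟨l, hl⟩ | hl | ⟨hl, m, hm⟩
    · have := hg0 s l hl
      filter_upwards [this] with u hu
      rw [hu, this.self_of_nhds]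
    · have := hg1 s hl
      filter_upwards [this] with u hu
      rw [hu, this.self_of_nhds]
    · exact absurd (hcross m s hs hm hl).1 hs'
  have hsum := sub_eq_sum_jumps g τ ε hτI
    (nhdsWithin_le_nhds (hend 0 (by simp) (by simp)))
    (nhdsWithin_le_nhds (hend 1 (by simp) (by simp))) (by
      intro s hs
      have hzero : (∀ m, ¬ (b.coord m (z s) = 0 ∧ ∀ l, 0 ≤ b.coord l (z s))) →
          (∑ i, if τ i = s then ε i else 0) = 0 := by
        intro hno
        refine Finset.sum_eq_zero fun m _ => ?_
        split_ifs with hm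
        · simp only [hε]
          refine if_neg fun hPm => ?_
          obtain ⟨h1, h2⟩ := hopen m _ (hτspec m hPm).2
          rw [hm] at h1 h2
          refine hno m ⟨h1, fun l => ?_⟩
          by_cases hl : l = m
          · rw [hl, h1]
          · exact (h2 l hl).le
        · rfl
      rcases htri s with ⟨l, hl⟩ | hl | ⟨hl, m, hm⟩
      · refine ⟨0, 0, nhdsWithin_le_nhds (hg0 s l hl), nhdsWithin_le_nhds (hg0 s l hl), ?_⟩
        rw [hzero fun m h => (h.2 l).not_gt hl, sub_zero]
      · refine ⟨1, 1, nhdsWithin_le_nhds (hg1 s hl), nhdsWithin_le_nhds (hg1 s hl), ?_⟩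
        rw [hzero fun m h => (hl m).ne' h.1, sub_self]
      · obtain ⟨hs', hΔm, hpos, ho⟩ := hcross m s hs hm hl
        have hPm : P m := ⟨s, hs', ho⟩
        have hτm : τ m = s := by
          have hA : inner ℝ (orientVec (w ∘ m.succAbove)) (y - x) ≠ 0 := by
            rw [hAe]
            exact neg_ne_zero.2 (mul_ne_zero hΔm (mul_ne_zero (pow_ne_zero _ (by norm_num)) hw))
          exact eq_of_lineMap_mem hA (openSimplex_subset_convexHull _ ho)
            (openSimplex_subset_convexHull _ (hτspec m hPm).2)
        have hjump : (∑ i, if τ i = s then ε i else 0) =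
            ((SignType.sign (Δ m) : SignType) : ℤ) := by
          rw [Finset.sum_eq_single m]
          · rw [if_pos hτm]; exact if_pos hPm
          · intro i _ hi
            split_ifs with h1
            · simp only [hε]
              refine if_neg fun hPi => ?_
              have h2 := (hopen i _ (hτspec i hPi).2).1
              rw [h1] at h2
              exact (hpos i hi).ne' h2
            · rfl
          · simp
        have hoth : ∀ᶠ u in 𝓝 s, ∀ l, l ≠ m → 0 < b.coord l (z u) := by
          rw [Filter.eventually_all]
          intro l
          by_cases hlm : l = m
          · exact Filter.Eventually.of_forall fun u h => absurd hlm h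
          · filter_upwards [(hφc l).continuousAt.eventually (lt_mem_nhds (hpos l hlm))] with u hu _
            exact hu
        have hφm : ∀ u, b.coord m (z u) = (u - s) * Δ m := by
          intro u
          have := hφ m u
          have h2 := hφ m s
          rw [hm] at h2
          rw [this]; linarith
        have hgu1 : ∀ u, (∀ l, l ≠ m → 0 < b.coord l (z u)) → 0 < (u - s) * Δ m → g u = 1 := by
          intro u hu hu2
          refine if_pos ((hmemw u).2 fun l => ?_)
          by_cases hlm : l = m
          · rw [hlm, hφm]; exact hu2.le
          · exact (hu l hlm).le
        have hgu0 : ∀ u, (u - s) * Δ m < 0 → g u = 0 := by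
          intro u hu2
          refine if_neg fun h => ?_
          have := (hmemw u).1 h m
          rw [hφm] at this
          linarith
        rcases lt_or_gt_of_ne hΔm with hneg | hpos'
        · refine ⟨1, 0, ?_, ?_, by rw [hjump, sign_neg hneg]; rfl⟩
          · filter_upwards [nhdsWithin_le_nhds hoth, self_mem_nhdsWithin] with u hu hus
            exact hgu1 u hu (mul_pos_of_neg_of_neg (sub_neg.2 hus) hneg)
          · filter_upwards [self_mem_nhdsWithin] with u hus
            exact hgu0 u (mul_neg_of_pos_of_neg (sub_pos.2 hus) hneg)
        · refine ⟨0, 1, ?_, ?_, by rw [hjump, sign_pos hpos']; rfl⟩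
          · filter_upwards [self_mem_nhdsWithin] with u hus
            exact hgu0 u (mul_neg_of_neg_of_pos (sub_neg.2 hus) hpos')
          · filter_upwards [nhdsWithin_le_nhds hoth, self_mem_nhdsWithin] with u hu hus
            exact hgu1 u hu (mul_pos (sub_pos.2 hus) hpos'))
  have hterm : ∀ m : Fin (n + 2), (-1) ^ (m : ℕ) * crossing x y (w ∘ m.succAbove) =
      -((SignType.sign (hdet w) : SignType) : ℤ) * ε m := by
    intro m
    by_cases hm : P m
    · have : crossing x y (w ∘ m.succAbove) = _ := if_pos hm
      rw [this, hAe, int_sign_neg, int_sign_mul, int_sign_mul, int_sign_neg_one_pow]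
      simp only [hε, if_pos hm]
      have h1 : ((-1 : ℤ) ^ (m : ℕ)) * (-1) ^ (m : ℕ) = 1 := by
        rw [← mul_pow]; simp
      linear_combination (-((SignType.sign (Δ m) : SignType) : ℤ) *
        ((SignType.sign (hdet w) : SignType) : ℤ)) * h1
    · have : crossing x y (w ∘ m.succAbove) = _ := if_neg hm
      rw [this]
      simp only [hε, if_neg hm, mul_zero]
  rw [Finset.sum_congr rfl fun m _ => hterm m, ← Finset.mul_sum, ← hsum]
  have hz0 : z 0 = x := AffineMap.lineMap_apply_zero _ _
  have hz1 : z 1 = y := AffineMap.lineMap_apply_one _ _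
  simp only [hg, signedIndicator, hz0, hz1]
  split_ifs <;> ring

end boundary

end SurfaceCluster

namespace SurfaceCluster

section boundary

variable {n : ℕ}

theorem exists_hdet_ne_zero (n : ℕ) : ∃ u : Fin (n + 2) → E n, hdet u ≠ 0 := by
  refine ⟨Fin.cons 0 fun i => EuclideanSpace.single i 1, hvol_ne_zero_of_linearIndependent ?_⟩
  rw [Fintype.linearIndependent_iff]
  intro c hc
  rw [sum_smul_hom] at hc
  have h1 : ∑ i, c i = 0 := congrArg Prod.fst hc
  have h2 : ∑ i, c i • (Fin.cons 0 (fun i => EuclideanSpace.single i 1) : Fin (n + 2) → E n) i = 0 :=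
    congrArg Prod.snd hc
  rw [Fin.sum_univ_succ] at h1 h2
  simp only [Fin.cons_zero, smul_zero, Fin.cons_succ, zero_add] at h2
  have h3 : ∀ i : Fin (n + 1), c i.succ = 0 := by
    intro i
    have := congrArg (fun v : E n => v i) h2
    simpa [Pi.single_apply] using this
  refine Fin.cases ?_ h3
  simpa [h3] using h1

/-- Degenerate simplices are limits of nondegenerate ones: along a line through a nondegenerate
simplex, `hdet` is a nonzero polynomial. -/
theorem frequently_hdet_ne_zero (w : Fin (n + 2) → E n) : ∃ᶠ w' in 𝓝 w, hdet w' ≠ 0 := by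
  obtain ⟨u, hu⟩ := exists_hdet_ne_zero n
  set γ : ℝ → Fin (n + 2) → E n := fun t i => (1 - t) • w i + t • u i with hγ
  have hγ0 : γ 0 = w := by funext i; simp [hγ]
  have hγc : Continuous γ := by
    refine continuous_pi fun i => ?_
    simp only [hγ]; fun_prop
  let A : (Fin (n + 2) → E n) → Matrix (Fin (n + 2)) (Fin (n + 2)) ℝ := fun w =>
    Matrix.of fun i => (Fin.cons (hom w i).1 (hom w i).2.ofLp : Fin (n + 2) → ℝ)
  -- the determinant is a polynomial along the line from `w` to `u`
  let p : Polynomial ℝ := Matrix.det (Matrix.of fun i j =>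
    (1 - Polynomial.X) * Polynomial.C (A w i j) + Polynomial.X * Polynomial.C (A u i j))
  have hp : ∀ t, p.eval t = hdet (γ t) := by
    intro t
    have h1 := (Polynomial.evalRingHom t).map_det (Matrix.of fun i j =>
      (1 - Polynomial.X) * Polynomial.C (A w i j) + Polynomial.X * Polynomial.C (A u i j))
    rw [Polynomial.coe_evalRingHom] at h1
    rw [h1, hdet, hvol_apply]
    congr 1
    ext i j
    refine Fin.cases ?_ (fun k => ?_) j
    · simp [A, hom]
    · simp [A, hom, hγ]
      ring
  have hp0 : p ≠ 0 := by
    intro h0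
    have := hp 1
    rw [h0, Polynomial.eval_zero] at this
    have h1 : γ 1 = u := by funext i; simp [hγ]
    exact hu (h1 ▸ this.symm)
  have hev : ∀ᶠ t in 𝓝[≠] (0 : ℝ), hdet (γ t) ≠ 0 := by
    have hfin : {t | p.IsRoot t}.Finite := Polynomial.finite_setOfPred_isRoot hp0
    have h2 : ∀ᶠ t in 𝓝[≠] (0 : ℝ), t ∉ {t | p.IsRoot t} \ {0} := by
      refine nhdsWithin_le_nhds ((hfin.subset Set.sdiff_subset).isClosed.isOpen_compl.mem_nhds ?_)
      simp
    filter_upwards [h2, self_mem_nhdsWithin] with t ht ht0 h3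
    exact ht ⟨by rw [Set.mem_ofPred_eq, Polynomial.IsRoot, hp, h3], ht0⟩
  have htend : Filter.Tendsto γ (𝓝[≠] 0) (𝓝 w) := by
    have := hγc.tendsto 0
    rw [hγ0] at this
    exact this.mono_left nhdsWithin_le_nhds
  exact htend.frequently hev.frequently

/-- The points of a degenerate simplex lie on its faces. -/
theorem exists_mem_face_of_not_affineIndependent {w : Fin (n + 2) → E n}
    (hw : ¬ AffineIndependent ℝ w) {z : E n} (hz : z ∈ convexHull ℝ (Set.range w)) :
    ∃ m : Fin (n + 2), z ∈ convexHull ℝ (Set.range (w ∘ m.succAbove)) := by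
  rw [convexHull_eq_union] at hz
  simp only [Set.mem_iUnion] at hz
  obtain ⟨t, ht, hind, hzt⟩ := hz
  choose σ hσ using fun p : t => ht p.2
  have hns : ¬ Function.Surjective σ := by
    intro hs
    refine hw ?_
    have hinj : Function.Injective σ := fun p p' h => by
      refine Subtype.ext ?_
      rw [← hσ p, ← hσ p', h]
    let e := Equiv.ofBijective σ ⟨hinj, hs⟩
    have h1 : w = (fun p : t => (p : E n)) ∘ e.symm := by
      funext i
      rw [Function.comp_apply, ← hσ (e.symm i)]
      congr 1
      exact (e.apply_symm_apply i).symm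
    rw [h1]
    exact hind.comp_embedding e.symm.toEmbedding
  rw [Function.Surjective] at hns
  push Not at hns
  obtain ⟨m, hm⟩ := hns
  refine ⟨m, convexHull_mono ?_ hzt⟩
  intro p hp
  obtain ⟨k, hk⟩ := Fin.exists_succAbove_eq (hm ⟨p, hp⟩)
  exact ⟨k, by rw [Function.comp_apply, hk]; exact hσ ⟨p, hp⟩⟩

theorem InGenPos.notMem {x y : E n} {q : Fin (n + 1) → E n} (h : InGenPos x y q) :
    x ∉ convexHull ℝ (Set.range q) ∧ y ∉ convexHull ℝ (Set.range q) := by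
  rcases h with h | h
  · obtain ⟨⟨s, hs, ho⟩, hA⟩ := crossing_ne_zero_iff.1 h
    have ho' := openSimplex_subset_convexHull _ ho
    constructor
    · intro hx
      have := eq_of_lineMap_mem hA ho' (s' := 0) (by rwa [AffineMap.lineMap_apply_zero])
      exact hs.1.ne this
    · intro hy
      have := eq_of_lineMap_mem hA ho' (s' := 1) (by rwa [AffineMap.lineMap_apply_one])
      exact hs.2.ne this.symm
  · exact ⟨by simpa using h 0 (by simp), by simpa using h 1 (by simp)⟩

/-- The crossing numbers of a segment with the faces of a `d`-simplex add up to the change of its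
indicator function. A degenerate `d`-simplex is perturbed, which changes no crossing number if the
segment is in general position. -/
theorem sum_crossing_faces {w : Fin (n + 2) → E n} {x y : E n}
    (hgen : ∀ m : Fin (n + 2), InGenPos x y (w ∘ m.succAbove)) :
    ∑ m : Fin (n + 2), (-1) ^ (m : ℕ) * crossing x y (w ∘ m.succAbove) =
      signedIndicator w x - signedIndicator w y := by
  by_cases hw : hdet w ≠ 0
  · exact sum_crossing_faces_of_hdet_ne_zero hw hgen
  rw [not_not] at hw
  have hdep : ¬ AffineIndependent ℝ w := fun h => by
    refine hvol_ne_zero_of_linearIndependent (v := hom w) ?_ hw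
    rw [Fintype.linearIndependent_iff]
    intro c hc
    rw [sum_smul_hom] at hc
    exact fun i => affineIndependent_iff.1 h Finset.univ c (congrArg Prod.fst hc)
      (congrArg Prod.snd hc) i (Finset.mem_univ i)
  have hout : ∀ z, (z = x ∨ z = y) → z ∉ convexHull ℝ (Set.range w) := by
    intro z hz hmem
    obtain ⟨m, hm⟩ := exists_mem_face_of_not_affineIndependent hdep hmem
    rcases hz with rfl | rfl
    · exact (hgen m).notMem.1 hm
    · exact (hgen m).notMem.2 hm
  have hev : ∀ z, (z = x ∨ z = y) → ∀ᶠ w' in 𝓝 w, signedIndicator w' z = 0 := by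
    intro z hz
    have := eventually_forall_notMem (x := z) (y := z) (q := w) (by
      intro s _
      rw [AffineMap.lineMap_same_apply]
      exact hout z hz)
    filter_upwards [this] with w' hw'
    have h0 := hw' 0 (by simp)
    rw [AffineMap.lineMap_same_apply] at h0
    exact if_neg h0
  have hfaces : ∀ᶠ w' in 𝓝 w, ∀ m : Fin (n + 2),
      crossing x y (w' ∘ m.succAbove) = crossing x y (w ∘ m.succAbove) ∧
        InGenPos x y (w' ∘ m.succAbove) := by
    rw [Filter.eventually_all]
    intro m
    have hc : Continuous fun w' : Fin (n + 2) → E n => w' ∘ m.succAbove :=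
      continuous_pi fun k => continuous_apply _
    exact (hc.tendsto w).eventually (hgen m).eventually
  obtain ⟨w', hw', ⟨hf, hx⟩, hy⟩ :=
    ((frequently_hdet_ne_zero w).and_eventually
      ((hfaces.and (hev x (Or.inl rfl))).and (hev y (Or.inr rfl)))).exists
  have key := sum_crossing_faces_of_hdet_ne_zero hw' fun m => (hf m).2
  rw [hx, hy] at key
  simp only [fun m => (hf m).1] at key
  rw [key]
  simp [signedIndicator, hw]

end boundary

end SurfaceCluster

namespace SurfaceCluster

/-! ### Cancellation over the facets of a cluster -/

/-- Removing an entry turns a permutation of `n + 1` indices into one of `n` indices. -/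
theorem Perm.exists_comp_succAbove {n : ℕ} (p : Equiv.Perm (Fin (n + 1))) (m : Fin (n + 1)) :
    ∃ π : Equiv.Perm (Fin n), (∀ j, p (m.succAbove j) = (p m).succAbove (π j)) ∧
      (Equiv.Perm.sign p : ℤ) = (-1) ^ ((m : ℕ) + (p m : ℕ)) * (Equiv.Perm.sign π : ℤ) := by
  set q : Equiv.Perm (Fin (n + 1)) := Fin.cycleRange (p m) * p * (Fin.cycleRange m)⁻¹ with hq
  obtain ⟨⟨e, π⟩, hπ⟩ := Equiv.Perm.decomposeFin.symm.surjective q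
  have hq0 : q 0 = 0 := by
    simp only [hq, Equiv.Perm.mul_apply]
    rw [Equiv.Perm.inv_def, Fin.cycleRange_symm_zero, Fin.cycleRange_self]
  have he : e = 0 := by
    rw [← hπ, Equiv.Perm.decomposeFin_symm_apply_zero] at hq0
    exact hq0
  subst he
  have hqs : ∀ j : Fin n, q j.succ = (π j).succ := by
    intro j
    rw [← hπ, Equiv.Perm.decomposeFin_symm_apply_succ]
    simp
  refine ⟨π, fun j => ?_, ?_⟩
  · have h1 := hqs j
    simp only [hq, Equiv.Perm.mul_apply] at h1
    rw [Equiv.Perm.inv_def, Fin.cycleRange_symm_succ] at h1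
    rw [← Fin.cycleRange_symm_succ (p m) (π j), ← h1, Equiv.symm_apply_apply]
  · have h2 : Equiv.Perm.sign q = Equiv.Perm.sign π := by
      rw [← hπ, Equiv.Perm.decomposeFin.symm_sign]; simp
    rw [hq, Equiv.Perm.sign_mul, Equiv.Perm.sign_mul, Equiv.Perm.sign_inv, Fin.sign_cycleRange,
      Fin.sign_cycleRange] at h2
    rw [← h2]
    push_cast
    have h3 : ((-1 : ℤ) ^ (m : ℕ)) * (-1) ^ (m : ℕ) = 1 := by
      rw [← mul_pow]; simp
    have h4 : ((-1 : ℤ) ^ (p m : ℕ)) * (-1) ^ (p m : ℕ) = 1 := by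
      rw [← mul_pow]; simp
    rw [pow_add]
    linear_combination (-(Equiv.Perm.sign p : ℤ)) * h3 -
      (Equiv.Perm.sign p : ℤ) * ((-1 : ℤ) ^ (m : ℕ)) * (-1) ^ (m : ℕ) * h4

theorem exists_perm_of_range_eq {α β : Type*} {f g : α → β} (hf : Function.Injective f)
    (hg : Function.Injective g) (h : Set.range f = Set.range g) :
    ∃ p : Equiv.Perm α, f = g ∘ p := by
  refine ⟨(Equiv.ofInjective f hf).trans ((Equiv.setCongr h).trans (Equiv.ofInjective g hg).symm),
    funext fun a => ?_⟩
  have := Equiv.apply_ofInjective_symm hg (Equiv.setCongr h (Equiv.ofInjective f hf a))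
  simpa using this.symm

namespace ClusterMesh

variable {n : ℕ} {T : ClusterMesh n}

/-- The facet of the simplex `a` opposite to its `m`-th vertex. -/
def facet (i : Fin T.numSurf) (a : Fin (T.numSimp i)) (m : Fin (n + 1)) :
    Finset (Fin (T.numVtx i)) :=
  Finset.univ.image (T.vert i a ∘ m.succAbove)

theorem card_facet (i : Fin T.numSurf) (a : Fin (T.numSimp i)) (m : Fin (n + 1)) :
    (facet i a m).card = n := by
  rw [facet, Finset.card_image_of_injective _
    ((T.vert_injective i a).comp Fin.succAbove_right_injective)]
  simp

theorem facet_subset (i : Fin T.numSurf) (a : Fin (T.numSimp i)) (m : Fin (n + 1)) :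
    (facet i a m : Set (Fin (T.numVtx i))) ⊆ Set.range (T.vert i a) := by
  intro v hv
  simp only [facet, Finset.coe_image, Finset.coe_univ, Set.image_univ] at hv
  obtain ⟨k, rfl⟩ := hv
  exact ⟨_, rfl⟩

theorem vert_mem_facet_iff (i : Fin T.numSurf) (a : Fin (T.numSimp i)) (m c : Fin (n + 1)) :
    T.vert i a c ∈ facet i a m ↔ c ≠ m := by
  simp only [facet, Finset.mem_image, Finset.mem_univ, true_and, Function.comp_apply]
  constructor
  · rintro ⟨k, hk⟩
    rw [← T.vert_injective i a hk]
    exact Fin.succAbove_ne m k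
  · intro h
    obtain ⟨k, hk⟩ := Fin.exists_succAbove_eq h
    exact ⟨k, by rw [hk]⟩

theorem facet_injective (i : Fin T.numSurf) (a : Fin (T.numSimp i)) :
    Function.Injective (facet i a) := by
  intro m m' h
  by_contra hne
  have := (vert_mem_facet_iff i a m' m).2 hne
  rw [← h] at this
  exact (vert_mem_facet_iff i a m m).1 this rfl

theorem exists_facet_eq {i : Fin T.numSurf} {a : Fin (T.numSimp i)} {F : Finset (Fin (T.numVtx i))}
    (hF : F.card = n) (h : (F : Set (Fin (T.numVtx i))) ⊆ Set.range (T.vert i a)) :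
    ∃ m, facet i a m = F := by
  have hex : ∃ m, T.vert i a m ∉ F := by
    by_contra hall
    push Not at hall
    have hle : (Finset.univ.image (T.vert i a)).card ≤ F.card :=
      Finset.card_le_card fun v hv => by
        obtain ⟨c, -, rfl⟩ := Finset.mem_image.1 hv
        exact hall c
    rw [Finset.card_image_of_injective _ (T.vert_injective i a), Finset.card_univ,
      Fintype.card_fin, hF] at hle
    omega
  obtain ⟨m, hm⟩ := hex
  refine ⟨m, (Finset.eq_of_subset_of_card_le (fun v hv => ?_) ?_).symm⟩
  · obtain ⟨c, rfl⟩ := h hv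
    rw [vert_mem_facet_iff]
    rintro rfl
    exact hm hv
  · rw [card_facet, hF]

theorem injective_of_image_mem_bdry {i : Fin T.numSurf} {p : Fin (T.numPart i)}
    {f : Fin n → Fin (T.numVtx i)} (hF : Finset.univ.image f ∈ T.bdry i p) :
    Function.Injective f := by
  have h1 : (Finset.univ.image f).card = (Finset.univ : Finset (Fin n)).card := by
    rw [((T.mem_bdry_iff i _).1 ⟨p, hF⟩).1, Finset.card_univ, Fintype.card_fin]
  exact fun c c' h => Finset.card_image_iff.1 h1 (by simp) (by simp) h

/-- The simplex adjacent to a boundary facet with ordered vertices `f`. -/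
theorem exists_simplex_of_mem_bdry {i : Fin T.numSurf} {p : Fin (T.numPart i)}
    {f : Fin n → Fin (T.numVtx i)} (hF : Finset.univ.image f ∈ T.bdry i p) :
    ∃ a m, ∃ σ : Equiv.Perm (Fin (n + 1)), T.vert i a ∘ σ = Fin.cons (T.vert i a m) f ∧ σ 0 = m ∧
      facet i a m = Finset.univ.image f ∧
      ∀ b, ((Finset.univ.image f : Finset _) : Set (Fin (T.numVtx i))) ⊆ Set.range (T.vert i b) →
        b = a := by
  classical
  obtain ⟨hcard, a, ha, huniq⟩ := (T.mem_bdry_iff i _).1 ⟨p, hF⟩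
  obtain ⟨m, hm⟩ := exists_facet_eq hcard ha
  have hvF : T.vert i a m ∉ Finset.univ.image f := by
    rw [← hm, vert_mem_facet_iff]; simp
  have hinj : Function.Injective (Fin.cons (T.vert i a m) f : Fin (n + 1) → Fin (T.numVtx i)) := by
    rw [Fin.cons_injective_iff]
    refine ⟨fun ⟨c, hc⟩ => hvF ?_, injective_of_image_mem_bdry hF⟩
    rw [← hc]; exact Finset.mem_image_of_mem _ (Finset.mem_univ _)
  have hrange : Set.range (Fin.cons (T.vert i a m) f : Fin (n + 1) → Fin (T.numVtx i)) =
      Set.range (T.vert i a) := by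
    refine Set.eq_of_subset_of_ncard_le ?_ ?_ (Set.toFinite _)
    · rintro _ ⟨c, rfl⟩
      refine Fin.cases ⟨_, rfl⟩ (fun c => ?_) c
      rw [Fin.cons_succ]
      exact ha (Finset.mem_coe.2 (Finset.mem_image_of_mem _ (Finset.mem_univ c)))
    · rw [Set.ncard_range_of_injective hinj, Set.ncard_range_of_injective (T.vert_injective i a)]
  obtain ⟨σ, hσ⟩ := exists_perm_of_range_eq hinj (T.vert_injective i a) hrange
  refine ⟨a, m, σ, hσ.symm, ?_, hm, huniq⟩
  have := congrFun hσ 0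
  rw [Fin.cons_zero] at this
  exact (T.vert_injective i a this).symm

section cancellation

variable {α R : Type*} [CommRing R] {u : ∀ i, Fin (T.numVtx i) → α} {Λ : (Fin n → α) → R}

/-- The contribution of a facet to the oriented sum of an alternating function `Λ` over all facets
of all simplices of a surface. -/
def facetSum (u : ∀ i, Fin (T.numVtx i) → α) (Λ : (Fin n → α) → R) (i : Fin T.numSurf)
    (F : Finset (Fin (T.numVtx i))) : R :=
  ∑ a, ∑ m : Fin (n + 1), if facet i a m = F then
    (-1) ^ (m : ℕ) * Λ (u i ∘ T.vert i a ∘ m.succAbove) else 0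

theorem sum_facetSum (i : Fin T.numSurf) : ∑ F, facetSum u Λ i F =
    ∑ a, ∑ m : Fin (n + 1), (-1) ^ (m : ℕ) * Λ (u i ∘ T.vert i a ∘ m.succAbove) := by
  simp only [facetSum]
  rw [Finset.sum_comm]
  refine Finset.sum_congr rfl fun a _ => ?_
  rw [Finset.sum_comm]
  refine Finset.sum_congr rfl fun m _ => ?_
  simp

theorem facetSum_eq_sum {i : Fin T.numSurf} {F : Finset (Fin (T.numVtx i))}
    (s : Finset (Fin (T.numSimp i)))
    (hs : ∀ a, a ∈ s ↔ (F : Set (Fin (T.numVtx i))) ⊆ Set.range (T.vert i a))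
    (k : Fin (T.numSimp i) → Fin (n + 1)) (hk : ∀ a ∈ s, facet i a (k a) = F) :
    facetSum u Λ i F = ∑ a ∈ s, (-1) ^ (k a : ℕ) * Λ (u i ∘ T.vert i a ∘ (k a).succAbove) := by
  rw [facetSum, ← Finset.sum_subset (Finset.subset_univ s)]
  · refine Finset.sum_congr rfl fun a ha => ?_
    rw [Finset.sum_eq_single (k a)]
    · rw [if_pos (hk a ha)]
    · intro m _ hm
      refine if_neg fun h => hm (facet_injective i a ?_)
      rw [h, hk a ha]
    · simp
  · intro a _ ha
    refine Finset.sum_eq_zero fun m _ => if_neg fun h => ha ((hs a).2 ?_)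
    rw [← h]
    exact facet_subset i a m

/-- An alternating function cancels on the facets between two neighbouring simplices. -/
theorem facetSum_eq_zero (hΛ : ∀ f (π : Equiv.Perm (Fin n)),
      Λ (f ∘ π) = ((Equiv.Perm.sign π : ℤ) : R) * Λ f) {i : Fin T.numSurf}
    {F : Finset (Fin (T.numVtx i))} (hF : ∀ p, F ∉ T.bdry i p) : facetSum u Λ i F = 0 := by
  classical
  by_cases hcard : F.card = n
  swap
  · refine Finset.sum_eq_zero fun a _ => Finset.sum_eq_zero fun m _ => if_neg fun h => hcard ?_
    rw [← h, card_facet]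
  set s : Finset (Fin (T.numSimp i)) := Finset.univ.filter fun a =>
    (F : Set (Fin (T.numVtx i))) ⊆ Set.range (T.vert i a) with hsdef
  have hs : ∀ a, a ∈ s ↔ (F : Set (Fin (T.numVtx i))) ⊆ Set.range (T.vert i a) := fun a => by
    simp [hsdef]
  have hk : ∀ a, ∃ m, a ∈ s → facet i a m = F := by
    intro a
    by_cases ha : a ∈ s
    · obtain ⟨m, hm⟩ := exists_facet_eq hcard ((hs a).1 ha)
      exact ⟨m, fun _ => hm⟩
    · exact ⟨0, fun h => absurd h ha⟩
  choose k hk using hk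
  rw [facetSum_eq_sum s hs k hk]
  have hle : s.card ≤ 2 := by
    have := T.facet_le_two i F hcard
    rwa [show {a | (F : Set (Fin (T.numVtx i))) ⊆ Set.range (T.vert i a)} = (s : Set _) by
      ext a; simp [hsdef], Set.ncard_coe_finset] at this
  have hne1 : s.card ≠ 1 := by
    intro h1
    obtain ⟨a, ha⟩ := Finset.card_eq_one.1 h1
    have : ∃ p, F ∈ T.bdry i p := (T.mem_bdry_iff i F).2 ⟨hcard, a, (hs a).1 (by simp [ha]),
      fun b hb => by simpa [ha] using (hs b).2 hb⟩
    obtain ⟨p, hp⟩ := this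
    exact hF p hp
  rcases Nat.lt_or_ge s.card 1 with h0 | h0
  · rw [Finset.card_eq_zero.1 (by omega : s.card = 0), Finset.sum_empty]
  obtain ⟨a, b, hab, hsab⟩ := Finset.card_eq_two.1 (by omega : s.card = 2)
  have ha : a ∈ s := by simp [hsab]
  have hb : b ∈ s := by simp [hsab]
  rw [hsab, Finset.sum_pair hab]
  have hbF : T.vert i b (k b) ∉ F := by
    rw [← hk b hb, vert_mem_facet_iff]; simp
  -- the neighbour `b` arises from `a` by replacing the vertex opposite to the common facet
  have hupd : ∀ c, c ≠ k a → Function.update (T.vert i a) (k a) (T.vert i b (k b)) c =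
      T.vert i a c ∧ T.vert i a c ∈ F := fun c hc => by
    refine ⟨Function.update_of_ne hc _ _, ?_⟩
    rw [← hk a ha]
    exact (vert_mem_facet_iff i a (k a) c).2 hc
  have hinj : Function.Injective (Function.update (T.vert i a) (k a) (T.vert i b (k b))) := by
    intro c c' h
    by_cases hc : c = k a <;> by_cases hc' : c' = k a
    · rw [hc, hc']
    · rw [hc, Function.update_self, (hupd c' hc').1] at h
      exact absurd (h ▸ (hupd c' hc').2) hbF
    · rw [hc', Function.update_self, (hupd c hc).1] at h
      exact absurd (h ▸ (hupd c hc).2) hbF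
    · rw [(hupd c hc).1, (hupd c' hc').1] at h
      exact T.vert_injective i a h
  have hrange : Set.range (Function.update (T.vert i a) (k a) (T.vert i b (k b))) =
      Set.range (T.vert i b) := by
    refine Set.eq_of_subset_of_ncard_le ?_ ?_ (Set.toFinite _)
    · rintro _ ⟨c, rfl⟩
      by_cases hc : c = k a
      · rw [hc, Function.update_self]; exact ⟨_, rfl⟩
      · rw [(hupd c hc).1]; exact (hs b).1 hb (hupd c hc).2
    · rw [Set.ncard_range_of_injective hinj, Set.ncard_range_of_injective (T.vert_injective i b)]
  obtain ⟨p, hp⟩ := exists_perm_of_range_eq hinj (T.vert_injective i b) hrange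
  have hsign := T.coherent i a b (k a) (T.vert i b (k b)) p hab hp
  have hpk : p (k a) = k b := by
    have := congrFun hp (k a)
    rw [Function.update_self] at this
    exact (T.vert_injective i b this).symm
  obtain ⟨π, hπ, hπs⟩ := Perm.exists_comp_succAbove p (k a)
  have hcomp : u i ∘ T.vert i a ∘ (k a).succAbove =
      (u i ∘ T.vert i b ∘ (k b).succAbove) ∘ π := by
    funext j
    have h1 := congrFun hp ((k a).succAbove j)
    rw [(hupd _ (Fin.succAbove_ne _ _)).1] at h1
    simp only [Function.comp_apply]
    rw [h1, Function.comp_apply, hπ, hpk]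
  rw [hcomp, hΛ]
  rw [hsign, hpk] at hπs
  have hπs' : (-1 : R) ^ ((k a : ℕ) + (k b : ℕ)) * ((Equiv.Perm.sign π : ℤ) : R) = -1 := by
    have := congrArg (Int.cast : ℤ → R) hπs
    push_cast at this
    rw [← this]
  have h4 : ((-1 : R) ^ (k b : ℕ)) * (-1) ^ (k b : ℕ) = 1 := by
    rw [← mul_pow]; simp
  rw [pow_add] at hπs'
  linear_combination ((-1 : R) ^ (k b : ℕ) * Λ (u i ∘ T.vert i b ∘ (k b).succAbove)) * hπs' -
    ((-1 : R) ^ (k a : ℕ) * ((Equiv.Perm.sign π : ℤ) : R) *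
      Λ (u i ∘ T.vert i b ∘ (k b).succAbove)) * h4

/-- The contribution of a boundary facet, in terms of an arbitrary order `f` of its vertices. -/
theorem exists_facetSum_eq (hΛ : ∀ f (π : Equiv.Perm (Fin n)),
      Λ (f ∘ π) = ((Equiv.Perm.sign π : ℤ) : R) * Λ f) {i : Fin T.numSurf} {p : Fin (T.numPart i)}
    {f : Fin n → Fin (T.numVtx i)} (hF : Finset.univ.image f ∈ T.bdry i p) :
    ∃ a v, ∃ σ : Equiv.Perm (Fin (n + 1)), T.vert i a ∘ σ = Fin.cons v f ∧
      facetSum u Λ i (Finset.univ.image f) = ((Equiv.Perm.sign σ : ℤ) : R) * Λ (u i ∘ f) := by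
  obtain ⟨a, m, σ, hσ, hσ0, hm, huniq⟩ := exists_simplex_of_mem_bdry hF
  refine ⟨a, T.vert i a m, σ, hσ, ?_⟩
  rw [facetSum_eq_sum {a} (fun b => ?_) (fun _ => m) (by simpa using hm),
    Finset.sum_singleton]
  swap
  · rw [Finset.mem_singleton]
    exact ⟨fun h => by rw [h, ← hm]; exact facet_subset i a m, fun h => huniq b h⟩
  obtain ⟨π, hπ, hπs⟩ := Perm.exists_comp_succAbove σ 0
  have hcomp : u i ∘ f = (u i ∘ T.vert i a ∘ m.succAbove) ∘ π := by
    funext j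
    have h1 := congrFun hσ j.succ
    have h2 := hπ j
    rw [Fin.succAbove_zero] at h2
    rw [Fin.cons_succ, Function.comp_apply, h2, hσ0] at h1
    simp only [Function.comp_apply]
    rw [h1]
  rw [hcomp, hΛ, hπs, hσ0]
  have h5 : ((Equiv.Perm.sign π : ℤ) : R) * ((Equiv.Perm.sign π : ℤ) : R) = 1 := by
    rcases Int.units_eq_one_or (Equiv.Perm.sign π) with h | h <;> simp [h]
  push_cast
  rw [Fin.val_zero, zero_add]
  linear_combination (-(-1 : R) ^ (m : ℕ) * Λ (u i ∘ T.vert i a ∘ m.succAbove)) * h5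

/-- Let `Λ` be an alternating function of the vertices of a facet. If the surfaces are weighted by
`χ ∈ W^h` (a constant on each surface), then the oriented sum of `Λ` over the facets of all
simplices vanishes, provided that the walls do not contribute: inside a surface the facets cancel
in pairs, and at the triple junctions the three sides cancel. -/
theorem sum_facets_eq_zero (χ : Fin T.numSurf → R)
    (hχ : ∀ k, (T.tjFacets k 0).Nonempty →
      ∑ j, ((T.orient k j : ℤ) : R) * χ (T.tjSurf k j) = 0)
    (hu : ∀ k l j j', u (T.tjSurf k j) (T.rho k j l) = u (T.tjSurf k j') (T.rho k j' l))
    (hΛ : ∀ f (π : Equiv.Perm (Fin n)), Λ (f ∘ π) = ((Equiv.Perm.sign π : ℤ) : R) * Λ f)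
    (hwall : ∀ k, ∀ F ∈ T.blFacets k, ∀ f : Fin n → Fin (T.numVtx (T.blSurf k)),
      (∀ c, f c ∈ F) → χ (T.blSurf k) * Λ (u (T.blSurf k) ∘ f) = 0) :
    ∑ i, χ i * ∑ a, ∑ m : Fin (n + 1),
      (-1) ^ (m : ℕ) * Λ (u i ∘ T.vert i a ∘ m.succAbove) = 0 := by
  classical
  have hsurf : ∀ i, χ i * ∑ a, ∑ m : Fin (n + 1),
      (-1) ^ (m : ℕ) * Λ (u i ∘ T.vert i a ∘ m.succAbove) =
      ∑ p, χ i * ∑ F ∈ T.bdry i p, facetSum u Λ i F := by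
    intro i
    rw [← sum_facetSum, ← Finset.mul_sum, ← Finset.sum_biUnion
      (fun p _ p' _ h => T.bdry_disjoint i p p' h)]
    congr 1
    refine (Finset.sum_subset (Finset.subset_univ _) fun F _ hF => facetSum_eq_zero hΛ fun p hp =>
      hF ?_).symm
    exact Finset.mem_biUnion.2 ⟨p, Finset.mem_univ p, hp⟩
  have henum : ∀ {m : ℕ} (F : Finset (Fin m)), F.card = n →
      ∃ f : Fin n → Fin m, Finset.univ.image f = F := by
    intro m F hF
    refine ⟨F.orderEmbOfFin hF, ?_⟩
    rw [← Finset.coe_inj, Finset.coe_image, Finset.coe_univ, Set.image_univ,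
      Finset.range_orderEmbOfFin]
  rw [Finset.sum_congr rfl fun i _ => hsurf i]
  rw [← Fintype.sum_sigma' (f := fun i p => χ i * ∑ F ∈ T.bdry i p, facetSum u Λ i F)]
  rw [← T.slot.sum_comp, Fintype.sum_sum_type, Fintype.sum_prod_type]
  have hB : ∑ k, χ (T.slot (Sum.inr k)).1 * ∑ F ∈ T.bdry (T.slot (Sum.inr k)).1
      (T.slot (Sum.inr k)).2, facetSum u Λ (T.slot (Sum.inr k)).1 F = 0 := by
    refine Finset.sum_eq_zero fun k _ => ?_
    rw [Finset.mul_sum]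
    refine Finset.sum_eq_zero fun F hF => ?_
    obtain ⟨f, rfl⟩ := henum F ((T.mem_bdry_iff _ F).1 ⟨_, hF⟩).1
    obtain ⟨a, v, σ, -, h⟩ := exists_facetSum_eq (u := u) hΛ hF
    rw [h, mul_left_comm, hwall k _ hF f fun c => Finset.mem_image_of_mem _ (Finset.mem_univ c),
      mul_zero]
  rw [hB, add_zero]
  refine Finset.sum_eq_zero fun k _ => ?_
  -- the facets of the three sides, as sets of vertices of the junction line
  set S : Finset (Finset (Fin (T.tjSize k))) := Finset.univ.filter fun F =>
    F.image (T.rho k 0) ∈ T.tjFacets k 0 with hS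
  have hSj : ∀ F j, F ∈ S ↔ F.image (T.rho k j) ∈ T.tjFacets k j := by
    intro F j
    rw [hS, Finset.mem_filter]
    exact ⟨fun h => T.rho_facet k 0 j F h.2, fun h => ⟨Finset.mem_univ _, T.rho_facet k j 0 F h⟩⟩
  have hside : ∀ j, ∑ F ∈ T.bdry (T.slot (Sum.inl (k, j))).1 (T.slot (Sum.inl (k, j))).2,
      facetSum u Λ (T.slot (Sum.inl (k, j))).1 F =
      ∑ F ∈ S, facetSum u Λ (T.tjSurf k j) (F.image (T.rho k j)) := by
    intro j
    have himg : T.bdry (T.slot (Sum.inl (k, j))).1 (T.slot (Sum.inl (k, j))).2 =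
        S.image fun F => F.image (T.rho k j) := by
      ext F
      rw [Finset.mem_image]
      constructor
      · intro hF
        have hsub : ∀ v ∈ F, v ∈ Set.range (T.rho k j) := fun v hv => by
          rw [T.rho_range]; exact ⟨F, hF, hv⟩
        have heq : (Finset.univ.filter fun l => T.rho k j l ∈ F).image (T.rho k j) = F := by
          ext v
          simp only [Finset.mem_image, Finset.mem_filter, Finset.mem_univ, true_and]
          constructor
          · rintro ⟨l, hl, rfl⟩; exact hl
          · intro hv
            obtain ⟨l, rfl⟩ := hsub v hv
            exact ⟨l, hv, rfl⟩
        exact ⟨_, (hSj _ j).2 (by rw [heq]; exact hF), heq⟩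
      · rintro ⟨F', hF', rfl⟩
        exact (hSj F' j).1 hF'
    rw [himg, Finset.sum_image]
    intro F _ F' _ h
    exact Finset.image_injective (T.rho_injective k j) h
  simp only [hside, Finset.mul_sum]
  rw [Finset.sum_comm]
  refine Finset.sum_eq_zero fun F hF => ?_
  have hF0 := (hSj F 0).1 hF
  have hFcard : F.card = n := by
    have := ((T.mem_bdry_iff _ _).1 ⟨_, hF0⟩).1
    rwa [Finset.card_image_of_injective _ (T.rho_injective k 0)] at this
  obtain ⟨f, rfl⟩ := henum F hFcard
  have hmem : ∀ j, Finset.univ.image (fun c => T.rho k j (f c)) ∈ T.tjFacets k j := by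
    intro j
    have := (hSj _ j).1 hF
    rwa [Finset.image_image] at this
  choose a v σ hσ hval using fun j => exists_facetSum_eq (u := u) hΛ (hmem j)
  have hΛj : ∀ j, Λ (u (T.tjSurf k j) ∘ fun c => T.rho k j (f c)) =
      Λ (u (T.tjSurf k 0) ∘ fun c => T.rho k 0 (f c)) := by
    intro j
    congr 1
    funext c
    exact hu k (f c) j 0
  have hsign : ∀ j, ((Equiv.Perm.sign (σ j) : ℤ) : R) = ((T.orient k j : ℤ) : R) *
      (((T.orient k 0 : ℤ) : R) * ((Equiv.Perm.sign (σ 0) : ℤ) : R)) := by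
    intro j
    have h1 := T.orient_compat k f j 0 (a j) (a 0) (v j) (v 0) (σ j) (σ 0) (hmem j) (hσ j) (hσ 0)
    have h2 : Equiv.Perm.sign (σ j) = T.orient k j * (T.orient k 0 * Equiv.Perm.sign (σ 0)) := by
      rw [← h1, ← mul_assoc, Int.units_mul_self, one_mul]
    rw [h2]; push_cast; rfl
  have hterm : ∀ j, χ (T.tjSurf k j) *
      facetSum u Λ (T.tjSurf k j) ((Finset.univ.image f).image (T.rho k j)) =
      ((T.orient k j : ℤ) : R) * χ (T.tjSurf k j) * (((T.orient k 0 : ℤ) : R) *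
        ((Equiv.Perm.sign (σ 0) : ℤ) : R) * Λ (u (T.tjSurf k 0) ∘ fun c => T.rho k 0 (f c))) := by
    intro j
    rw [Finset.image_image]
    have h3 := hval j
    rw [hΛj, hsign] at h3
    have h4 : facetSum u Λ (T.tjSurf k j) (Finset.univ.image (T.rho k j ∘ f)) = _ := h3
    rw [h4]
    ring
  rw [Finset.sum_congr rfl fun j _ => hterm j, ← Finset.sum_mul, hχ k ⟨_, hmem 0⟩, zero_mul]

end cancellation

end ClusterMesh

end SurfaceCluster

namespace SurfaceCluster

namespace ClusterMesh

variable {n : ℕ} {T : ClusterMesh n}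

/-! ### Embedded clusters -/

section pushWeight

variable {ι κ : Type*} [Fintype ι] [DecidableEq κ]

/-- The image of a weight under a map of index sets. -/
def pushWeight (f : ι → κ) (w : ι → ℝ) (v : κ) : ℝ := ∑ l, if f l = v then w l else 0

theorem pushWeight_apply {f : ι → κ} (hf : Function.Injective f) (w : ι → ℝ) (l : ι) :
    pushWeight f w (f l) = w l := by
  rw [pushWeight, Finset.sum_eq_single l]
  · simp
  · intro b _ hb
    exact if_neg fun h => hb (hf h)
  · simp

theorem sum_pushWeight [Fintype κ] (f : ι → κ) (w : ι → ℝ) : ∑ v, pushWeight f w v = ∑ l, w l := by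
  simp only [pushWeight]
  rw [Finset.sum_comm]
  simp

theorem sum_pushWeight_smul [Fintype κ] {V : Type*} [AddCommGroup V] [Module ℝ V] (f : ι → κ) (w : ι → ℝ)
    (X : κ → V) : ∑ v, pushWeight f w v • X v = ∑ l, w l • X (f l) := by
  simp only [pushWeight, Finset.sum_smul, ite_smul, zero_smul]
  rw [Finset.sum_comm]
  simp

theorem pushWeight_nonneg (f : ι → κ) {w : ι → ℝ} (hw : ∀ l, 0 ≤ w l) (v : κ) :
    0 ≤ pushWeight f w v :=
  Finset.sum_nonneg fun l _ => by split_ifs; exacts [hw l, le_rfl]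

theorem exists_of_pushWeight_ne_zero {f : ι → κ} {w : ι → ℝ} {v : κ} (h : pushWeight f w v ≠ 0) :
    ∃ l, f l = v ∧ w l ≠ 0 := by
  obtain ⟨l, -, hl⟩ := Finset.exists_ne_zero_of_sum_ne_zero h
  by_cases hv : f l = v
  · exact ⟨l, hv, by simpa [hv] using hl⟩
  · simp [hv] at hl

end pushWeight

theorem isPoint_pushWeight (i : Fin T.numSurf) (a : Fin (T.numSimp i)) {w : Fin (n + 1) → ℝ}
    (hw : ∀ k, 0 ≤ w k) (hw1 : ∑ k, w k = 1) : T.IsPoint ⟨i, pushWeight (T.vert i a) w⟩ := by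
  refine ⟨pushWeight_nonneg _ hw, ?_, a, fun v hv => ?_⟩
  · exact (sum_pushWeight _ _).trans hw1
  · obtain ⟨l, hl, -⟩ := exists_of_pushWeight_ne_zero (show pushWeight (T.vert i a) w v ≠ 0 from hv)
    exact ⟨l, hl⟩

theorem eqvGen_mem_iff {α : Type*} {r : α → α → Prop} {S : Set α}
    (hS : ∀ a b, r a b → (a ∈ S ↔ b ∈ S)) {a b : α} (h : Relation.EqvGen r a b) :
    a ∈ S ↔ b ∈ S := by
  induction h with
  | rel _ _ h => exact hS _ _ h
  | refl _ => rfl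
  | symm _ _ _ ih => exact ih.symm
  | trans _ _ _ _ _ ih1 ih2 => exact ih1.trans ih2

theorem Glue.symm {p q : Σ i, Fin (T.numVtx i) → ℝ} (h : T.Glue p q) : T.Glue q p := by
  obtain ⟨k, j, j', w, F, hF, hw, hw1, hwF, hp, hq⟩ := h
  exact ⟨k, j', j, w, F, T.rho_facet k j j' F hF, hw, hw1, hwF, hq, hp⟩

/-- The support of `p` is contained in a facet of the boundary piece `π`. -/
def OnPiece (p : Σ i, Fin (T.numVtx i) → ℝ) (π : Σ i, Fin (T.numPart i)) : Prop :=
  ∃ (i : Fin T.numSurf) (u : Fin (T.numVtx i) → ℝ) (c : Fin (T.numPart i))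
    (F : Finset (Fin (T.numVtx i))), p = ⟨i, u⟩ ∧ π = ⟨i, c⟩ ∧ F ∈ T.bdry i c ∧
      ∀ v, u v ≠ 0 → v ∈ F

theorem Glue.exists_eq {p q : Σ i, Fin (T.numVtx i) → ℝ} (h : T.Glue p q) :
    ∃ (k : Fin T.numTJ) (j j' : Fin 3) (w : Fin (T.tjSize k) → ℝ),
      p = ⟨T.tjSurf k j, pushWeight (T.rho k j) w⟩ ∧
      q = ⟨T.tjSurf k j', pushWeight (T.rho k j') w⟩ ∧ OnPiece p (T.slot (Sum.inl (k, j))) := by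
  obtain ⟨k, j, j', w, F, hF, hw, hw1, hwF, hp, hq⟩ := h
  refine ⟨k, j, j', w, hp, hq, _, _, _, _, hp, rfl, hF, fun v hv => ?_⟩
  obtain ⟨l, rfl, hl⟩ := exists_of_pushWeight_ne_zero hv
  exact Finset.mem_image_of_mem _ (hwF l hl)

theorem OnPiece.piece_eq {i : Fin T.numSurf} {u : Fin (T.numVtx i) → ℝ} {c : Fin (T.numPart i)}
    {F : Finset (Fin (T.numVtx i))} (hF : F ∈ T.bdry i c) (hu : ∀ v ∈ F, u v ≠ 0)
    {π : Σ i, Fin (T.numPart i)} (h : OnPiece ⟨i, u⟩ π) : π = ⟨i, c⟩ := by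
  obtain ⟨i', u', c', F', hp, rfl, hF', hu'⟩ := h
  obtain ⟨rfl, h2⟩ := Sigma.mk.inj_iff.1 hp
  obtain rfl := eq_of_heq h2
  have hsub : F ⊆ F' := fun v hv => hu' v (hu v hv)
  have hcard : F'.card ≤ F.card := by
    rw [((T.mem_bdry_iff i F).1 ⟨c, hF⟩).1, ((T.mem_bdry_iff i F').1 ⟨c', hF'⟩).1]
  have hFF := Finset.eq_of_subset_of_card_le hsub hcard
  subst hFF
  by_contra hne
  have hcc : c' ≠ c := fun h => hne (by rw [h])
  exact (Finset.disjoint_left.1 (T.bdry_disjoint i c' c hcc)) hF' hF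

theorem OnPiece.exists_notMem {i : Fin T.numSurf} {u : Fin (T.numVtx i) → ℝ}
    {a : Fin (T.numSimp i)} {π : Σ i, Fin (T.numPart i)} (h : OnPiece ⟨i, u⟩ π) :
    ∃ k, u (T.vert i a k) = 0 := by
  obtain ⟨i', u', c', F', hp, rfl, hF', hu'⟩ := h
  obtain ⟨rfl, h2⟩ := Sigma.mk.inj_iff.1 hp
  obtain rfl := eq_of_heq h2
  by_contra hall
  push Not at hall
  have hle : (Finset.univ.image (T.vert i a)).card ≤ F'.card := Finset.card_le_card fun v hv => by
    obtain ⟨k, -, rfl⟩ := Finset.mem_image.1 hv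
    exact hu' _ (hall k)
  rw [Finset.card_image_of_injective _ (T.vert_injective i a), Finset.card_univ, Fintype.card_fin,
    ((T.mem_bdry_iff i F').1 ⟨c', hF'⟩).1] at hle
  omega

/-- In an embedded cluster, a point of an open simplex lies on no other simplex. -/
theorem IsEmbedded.simplex_eq {X : T.VectorField} (hX : IsEmbedded X) {i i' : Fin T.numSurf}
    {a : Fin (T.numSimp i)} {a' : Fin (T.numSimp i')} {z : E n}
    (hz : z ∈ openSimplex (onSimplex X i a))
    (hz' : z ∈ convexHull ℝ (Set.range (onSimplex X i' a'))) :
    (⟨i, a⟩ : Σ i, Fin (T.numSimp i)) = ⟨i', a'⟩ := by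
  obtain ⟨w, hw, hw1, rfl⟩ := hz
  obtain ⟨w', hw', hw1', heq⟩ := (mem_convexHull_range_iff _ _).1 hz'
  have hE := hX _ _ (isPoint_pushWeight i a (fun k => (hw k).le) hw1)
    (isPoint_pushWeight i' a' hw' hw1') (by
      rw [sum_pushWeight_smul, sum_pushWeight_smul]; exact heq)
  have hiso : ∀ q, ¬ T.Glue ⟨i, pushWeight (T.vert i a) w⟩ q := by
    intro q hq
    obtain ⟨k, j, j', v, -, -, hon⟩ := hq.exists_eq
    obtain ⟨c, hc⟩ := hon.exists_notMem (a := a)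
    rw [pushWeight_apply (T.vert_injective i a)] at hc
    exact (hw c).ne' hc
  have h2 := (eqvGen_mem_iff (S := {(⟨i, pushWeight (T.vert i a) w⟩ : Σ i, Fin (T.numVtx i) → ℝ)})
    (fun p q hpq => by
      constructor
      · rintro rfl; exact absurd hpq (hiso q)
      · rintro rfl; exact absurd hpq.symm (hiso p)) hE).1 rfl
  obtain ⟨rfl, h3⟩ := Sigma.mk.inj_iff.1 (Set.mem_singleton_iff.1 h2)
  have h4 := eq_of_heq h3
  have hsub : Set.range (T.vert i' a) ⊆ Set.range (T.vert i' a') := by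
    rintro _ ⟨k, rfl⟩
    have h5 := congrFun h4 (T.vert i' a k)
    rw [pushWeight_apply (T.vert_injective i' a)] at h5
    obtain ⟨l, hl, -⟩ := exists_of_pushWeight_ne_zero (h5.trans_ne (hw k).ne')
    exact ⟨l, hl⟩
  have hrange := Set.eq_of_subset_of_ncard_le hsub (by
    rw [Set.ncard_range_of_injective (T.vert_injective i' a),
      Set.ncard_range_of_injective (T.vert_injective i' a')]) (Set.toFinite _)
  rw [T.simp_injective i' hrange]

/-- In an embedded cluster, an inner point of a facet of a triple junction line lies only on
simplices of the three sides that contain this facet. -/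
theorem IsEmbedded.exists_side {X : T.VectorField} (hX : IsEmbedded X) {k : Fin T.numTJ}
    {F : Finset (Fin (T.tjSize k))} (hF : ∀ j, F.image (T.rho k j) ∈ T.tjFacets k j)
    {w : Fin (T.tjSize k) → ℝ} (hw : ∀ l, 0 ≤ w l) (hwF : ∀ l, w l ≠ 0 ↔ l ∈ F)
    (hw1 : ∑ l, w l = 1) {i : Fin T.numSurf} {a : Fin (T.numSimp i)}
    (h : ∑ l, w l • X (T.tjSurf k 0) (T.rho k 0 l) ∈
      convexHull ℝ (Set.range (onSimplex X i a))) :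
    ∃ (j : Fin 3) (b : Fin (T.numSimp (T.tjSurf k j))),
      (⟨i, a⟩ : Σ i, Fin (T.numSimp i)) = ⟨T.tjSurf k j, b⟩ ∧
      ((F.image (T.rho k j) : Finset _) : Set (Fin (T.numVtx (T.tjSurf k j)))) ⊆
        Set.range (T.vert (T.tjSurf k j) b) := by
  obtain ⟨w', hw', hw1', heq⟩ := (mem_convexHull_range_iff _ _).1 h
  set P : Fin 3 → Σ i, Fin (T.numVtx i) → ℝ := fun j => ⟨T.tjSurf k j, pushWeight (T.rho k j) w⟩
    with hP
  have hPt : T.IsPoint (P 0) := by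
    refine ⟨pushWeight_nonneg _ hw, (sum_pushWeight _ _).trans hw1, ?_⟩
    obtain ⟨-, b, hb, -⟩ := (T.mem_bdry_iff _ _).1 ⟨_, hF 0⟩
    refine ⟨b, fun v hv => hb ?_⟩
    obtain ⟨l, rfl, hl⟩ :=
      exists_of_pushWeight_ne_zero (show pushWeight (T.rho k 0) w v ≠ 0 from hv)
    exact Finset.mem_coe.2 (Finset.mem_image_of_mem _ ((hwF l).1 hl))
  have hE := hX (P 0) _ hPt (isPoint_pushWeight i a hw' hw1') (by
    change ∑ v, pushWeight _ w v • _ = ∑ v, pushWeight _ w' v • _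
    rw [sum_pushWeight_smul, sum_pushWeight_smul]; exact heq)
  have hclosed : ∀ p q, T.Glue p q → p ∈ Set.range P → q ∈ Set.range P := by
    rintro p q hpq ⟨j, rfl⟩
    obtain ⟨k', j1, j2, v, hp, hq, hon⟩ := hpq.exists_eq
    have hpiece := OnPiece.piece_eq (hF j) (u := pushWeight (T.rho k j) w) (by
      intro x hx
      obtain ⟨l, hl, rfl⟩ := Finset.mem_image.1 hx
      rw [pushWeight_apply (T.rho_injective k j)]
      exact (hwF l).2 hl) hon
    have hslot := T.slot.injective (hpiece.trans (Sigma.eta _))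
    obtain ⟨rfl, rfl⟩ := Prod.mk.inj (Sum.inl.inj hslot)
    have h1 := eq_of_heq (Sigma.mk.inj_iff.1 hp).2
    have hvw : v = w := by
      funext l
      have := congrFun h1 (T.rho k' j1 l)
      rw [pushWeight_apply (T.rho_injective k' j1), pushWeight_apply (T.rho_injective k' j1)] at this
      exact this.symm
    rw [hvw] at hq
    exact ⟨j2, hq.symm⟩
  obtain ⟨j, hj⟩ := (eqvGen_mem_iff (S := Set.range P)
    (fun p q hpq => ⟨hclosed p q hpq, hclosed q p hpq.symm⟩) hE).1 ⟨0, rfl⟩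
  obtain ⟨rfl, h3⟩ := Sigma.mk.inj_iff.1 hj
  have h4 := eq_of_heq h3
  refine ⟨j, a, rfl, fun v hv => ?_⟩
  obtain ⟨l, hl, rfl⟩ := Finset.mem_image.1 (Finset.mem_coe.1 hv)
  have h5 := congrFun h4 (T.rho k j l)
  rw [pushWeight_apply (T.rho_injective k j)] at h5
  obtain ⟨c, hc, -⟩ := exists_of_pushWeight_ne_zero (h5.symm.trans_ne ((hwF l).2 hl))
  exact ⟨c, hc⟩

/-! ### The jump of the indicator function of an enclosed region -/

section region

variable {D : T.Walls} {ρ : T.RegionData} {X : T.VectorField} {R : Set (E n)}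

theorem RegionData.isOpen_container (ρ : T.RegionData) : IsOpen (ρ.container D) := by
  refine ρ.isOpen_trunc.inter ?_
  have : {x : E n | ∀ k ∈ ρ.planes, D.offset k < inner ℝ (D.normal k) x} =
      ⋂ k ∈ ρ.planes, {x | D.offset k < inner ℝ (D.normal k) x} := by
    ext x; simp
  rw [this]
  exact isOpen_biInter_finset fun k _ => isOpen_lt continuous_const (by fun_prop)

theorem RegionData.convex_container (ρ : T.RegionData) : Convex ℝ (ρ.container D) := by
  refine ρ.convex_trunc.inter fun x hx y hy a b ha hb hab k hk => ?_
  have h1 : D.offset k < inner ℝ (D.normal k) x := hx k hk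
  have h2 : D.offset k < inner ℝ (D.normal k) y := hy k hk
  rw [inner_add_right, inner_smul_right, inner_smul_right]
  rcases ha.eq_or_lt with rfl | ha
  · have : b = 1 := by linarith
    subst this; linarith
  · have h3 := mul_lt_mul_of_pos_left h1 ha
    have h4 := mul_le_mul_of_nonneg_left h2.le hb
    have : D.offset k = a * D.offset k + b * D.offset k := by rw [← add_mul, hab, one_mul]
    linarith

/-- Near a point of an open bounding simplex, the region lies on the inner side of the simplex. -/
theorem IsEnclosedRegion.eventually_side (hR : IsEnclosedRegion D ρ X R) {i : Fin T.numSurf}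
    (hi : i ∈ ρ.surfaces) {a : Fin (T.numSimp i)} {z : E n}
    (hz : z ∈ openSimplex (onSimplex X i a)) (hzK : z ∈ ρ.container D)
    (hA : orientVec (onSimplex X i a) ≠ 0) : ∀ᶠ w in 𝓝 z,
      ((((ρ.sign i : ℤˣ) : ℤ) : ℝ) * inner ℝ (orientVec (onSimplex X i a)) (w - z) < 0 → w ∈ R) ∧
      (0 < (((ρ.sign i : ℤˣ) : ℤ) : ℝ) * inner ℝ (orientVec (onSimplex X i a)) (w - z) →
        w ∉ R) := by
  classical
  set q := onSimplex X i a with hq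
  set σ : ℝ := (((ρ.sign i : ℤˣ) : ℤ) : ℝ) with hσ
  have hσ2 : σ * σ = 1 := by
    rcases Int.units_eq_one_or (ρ.sign i) with h | h <;> simp [hσ, h]
  -- a ball in the container that meets no other simplex
  have hother : ∀ᶠ w in 𝓝 z, ∀ p : Σ i, Fin (T.numSimp i), p ≠ ⟨i, a⟩ →
      w ∉ convexHull ℝ (Set.range (onSimplex X p.1 p.2)) := by
    rw [Filter.eventually_all]
    intro p
    by_cases hp : p = ⟨i, a⟩
    · exact Filter.Eventually.of_forall fun w h => absurd hp h
    · have hcl : IsClosed (convexHull ℝ (Set.range (onSimplex X p.1 p.2))) :=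
        (Set.finite_range _).isClosed_convexHull ℝ
      have hzn : z ∉ convexHull ℝ (Set.range (onSimplex X p.1 p.2)) := fun h =>
        hp (hR.embedded.simplex_eq hz h).symm
      filter_upwards [hcl.isOpen_compl.mem_nhds hzn] with w hw _ using hw
  obtain ⟨r, hr, hball⟩ := Metric.eventually_nhds_iff_ball.1
    (hother.and (ρ.isOpen_container.mem_nhds hzK))
  have hzq : z ∈ convexHull ℝ (Set.range q) := openSimplex_subset_convexHull q hz
  -- the two half balls do not meet the boundary of the region
  have hhalf : ∀ c : ℝ, c ≠ 0 → ∀ w ∈ Metric.ball z r, 0 < c * inner ℝ (orientVec q) (w - z) →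
      ∀ w' ∈ Metric.ball z r, 0 < c * inner ℝ (orientVec q) (w' - z) → w ∈ R → w' ∈ R := by
    intro c hc w hw hw0 w' hw' hw0' hwR
    by_contra hwR'
    set H : Set (E n) := Metric.ball z r ∩ {w | 0 < c * inner ℝ (orientVec q) (w - z)} with hH
    have hconv : Convex ℝ H := by
      refine (convex_ball z r).inter fun x hx y hy s t hs ht hst => ?_
      simp only [Set.mem_ofPred_eq] at hx hy ⊢
      have : s • x + t • y - z = s • (x - z) + t • (y - z) := by
        have : z = (s + t) • z := by rw [hst, one_smul]
        nth_rewrite 1 [this]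
        module
      rw [this, inner_add_right, inner_smul_right, inner_smul_right]
      rcases hs.eq_or_lt with rfl | hs
      · have : t = 1 := by linarith
        subst this; linarith
      · have h1 := mul_pos hs hx
        have h2 := mul_nonneg ht hy.le
        linarith
    obtain ⟨p, hpH, hpf⟩ : (H ∩ frontier R).Nonempty := by
      by_contra hempty
      have hfr : ∀ p ∈ H, p ∉ frontier R := fun p hp hpf => hempty ⟨p, hp, hpf⟩
      have hcl : ∀ p ∈ H, p ∉ R → p ∈ (closure R)ᶜ := fun p hp hpR hpc =>
        hfr p hp ⟨hpc, fun h => hpR (interior_subset h)⟩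
      obtain ⟨p, -, hp1, hp2⟩ := hconv.isPreconnected R (closure R)ᶜ hR.isOpen
        isClosed_closure.isOpen_compl
        (fun p hp => (em (p ∈ R)).imp_right fun h => hcl p hp h)
        ⟨w, ⟨hw, hw0⟩, hwR⟩ ⟨w', ⟨hw', hw0'⟩, hcl w' ⟨hw', hw0'⟩ hwR'⟩
      exact hp2 (subset_closure hp1)
    have hpK := (hball p hpH.1).2
    have hps : p ∈ (⋃ i ∈ ρ.surfaces, surf X i) ∩ ρ.container D := by
      rw [← hR.frontier_eq]; exact ⟨hpf, hpK⟩
    obtain ⟨i', hi'⟩ := Set.mem_iUnion.1 hps.1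
    obtain ⟨-, hi''⟩ := Set.mem_iUnion.1 hi'
    obtain ⟨a', ha'⟩ := Set.mem_iUnion.1 hi''
    by_cases heq : (⟨i', a'⟩ : Σ i, Fin (T.numSimp i)) = ⟨i, a⟩
    · obtain ⟨rfl, h2⟩ := Sigma.mk.inj_iff.1 heq
      obtain rfl := eq_of_heq h2
      have h0 := inner_orientVec_eq_zero_of_mem hzq ha'
      have := hpH.2
      simp only [Set.mem_ofPred_eq] at this
      rw [h0, mul_zero] at this
      exact lt_irrefl _ this
    · exact (hball p hpH.1).1 ⟨i', a'⟩ heq ha'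
  -- the outer normal identifies the sides
  have hν : inner ℝ (orientVec q) (unitNormal q) = ‖orientVec q‖ := by
    rw [unitNormal, inner_smul_right, real_inner_self_eq_norm_sq]
    have := norm_ne_zero_iff.2 hA
    field_simp
  have hnorm : 0 < ‖orientVec q‖ := norm_pos_iff.2 hA
  have hsmall : ∀ c : ℝ, ∀ᶠ s : ℝ in 𝓝[>] 0, z + (s * c) • unitNormal q ∈ Metric.ball z r := by
    intro c
    have hc : Continuous fun s : ℝ => z + (s * c) • unitNormal q := by fun_prop
    have := hc.tendsto 0
    simp only [zero_mul, zero_smul, add_zero] at this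
    exact nhdsWithin_le_nhds (this.eventually (Metric.ball_mem_nhds z hr))
  obtain ⟨s, ⟨⟨⟨hin, hout⟩, hb1⟩, hb2⟩, hs⟩ := (((((hR.outer_normal i hi a z hz).and
    (hsmall σ)).and (hsmall (-σ))).and self_mem_nhdsWithin)).exists
  have hs0 : 0 < s := hs
  have hval : ∀ c : ℝ, inner ℝ (orientVec q) (z + c • unitNormal q - z) = c * ‖orientVec q‖ := by
    intro c
    rw [add_sub_cancel_left, inner_smul_right, hν]
  have hin' : z + (s * -σ) • unitNormal q ∈ R := by
    have : z + (s * -σ) • unitNormal q = z - (s * σ) • unitNormal q := by module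
    rw [this]; exact hin
  have hσ0 : σ ≠ 0 := fun h => by rw [h] at hσ2; norm_num at hσ2
  filter_upwards [Metric.ball_mem_nhds z hr] with w hw
  constructor
  · intro hneg
    refine hhalf (-σ) (neg_ne_zero.2 hσ0) _ hb2 ?_ w hw (by linarith) hin'
    rw [hval]
    have : -σ * (s * -σ * ‖orientVec q‖) = (σ * σ) * (s * ‖orientVec q‖) := by ring
    rw [this, hσ2, one_mul]
    exact mul_pos hs0 hnorm
  · intro hpos hwR
    refine hout (hhalf σ hσ0 w hw hpos _ hb1 ?_ hwR)
    rw [hval]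
    have : σ * (s * σ * ‖orientVec q‖) = (σ * σ) * (s * ‖orientVec q‖) := by ring
    rw [this, hσ2, one_mul]
    exact mul_pos hs0 hnorm

open Classical in
/-- The integer-valued indicator function of a set. -/
noncomputable def indic (R : Set (E n)) (x : E n) : ℤ := if x ∈ R then 1 else 0

open Classical in
/-- The weights of the surfaces of a cluster that single out a region: the signs of the bounding
surfaces, and `0` for all others. -/
noncomputable def RegionData.weight (ρ : T.RegionData) (i : Fin T.numSurf) : ℤ :=
  if i ∈ ρ.surfaces then ((ρ.sign i : ℤˣ) : ℤ) else 0

/-- Along a segment in general position, the indicator function of an enclosed region changes by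
the crossing numbers with the bounding surfaces. -/
theorem IsEnclosedRegion.indic_sub (hR : IsEnclosedRegion D ρ X R) {x y : E n}
    (hx : x ∈ ρ.container D) (hy : y ∈ ρ.container D)
    (hgen : ∀ i ∈ ρ.surfaces, ∀ a, InGenPos x y (onSimplex X i a)) :
    indic R x - indic R y = ∑ i, ρ.weight i * ∑ a, crossing x y (onSimplex X i a) := by
  classical
  set z : ℝ → E n := fun s => AffineMap.lineMap x y s with hz
  have hzc : Continuous z := AffineMap.lineMap_continuous
  have hzK : ∀ s ∈ Set.Icc (0 : ℝ) 1, z s ∈ ρ.container D := by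
    intro s hs
    exact ρ.convex_container.segment_subset hx hy (segment_eq_image_lineMap ℝ x y ▸ ⟨s, hs, rfl⟩)
  set P : (Σ i, Fin (T.numSimp i)) → Prop := fun p =>
    ∃ s ∈ Set.Ioo (0 : ℝ) 1, z s ∈ openSimplex (onSimplex X p.1 p.2) with hP
  set τ : (Σ i, Fin (T.numSimp i)) → ℝ := fun p => if h : P p then h.choose else 1 / 2 with hτ
  set ε : (Σ i, Fin (T.numSimp i)) → ℤ := fun p =>
    -(ρ.weight p.1 * crossing x y (onSimplex X p.1 p.2)) with hε
  set g : ℝ → ℤ := fun s => indic R (z s) with hg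
  have hτspec : ∀ p, P p → τ p ∈ Set.Ioo (0 : ℝ) 1 ∧
      z (τ p) ∈ openSimplex (onSimplex X p.1 p.2) := by
    intro m hm
    simp only [hτ, dif_pos hm]
    exact hm.choose_spec
  have hτI : ∀ m, τ m ∈ Set.Ioo (0 : ℝ) 1 := by
    intro m
    by_cases hm : P m
    · exact (hτspec m hm).1
    · simp only [hτ, dif_neg hm]; norm_num
  have hεP : ∀ p, ε p ≠ 0 → p.1 ∈ ρ.surfaces ∧ P p := by
    intro p hp
    simp only [hε, neg_ne_zero] at hp
    refine ⟨?_, (crossing_ne_zero_iff.1 (right_ne_zero_of_mul hp)).1⟩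
    by_contra h
    exact left_ne_zero_of_mul hp (if_neg h)
  have hconst : ∀ s ∈ Set.Icc (0 : ℝ) 1, z s ∉ (⋃ i ∈ ρ.surfaces, surf X i) →
      ∀ᶠ u in 𝓝 s, g u = g s := by
    intro s hs hns
    have hfr : z s ∉ frontier R := fun h => by
      have : z s ∈ (⋃ i ∈ ρ.surfaces, surf X i) ∩ ρ.container D := by
        rw [← hR.frontier_eq]; exact ⟨h, hzK s hs⟩
      exact hns this.1
    by_cases hsR : z s ∈ R
    · filter_upwards [hzc.continuousAt.eventually (hR.isOpen.mem_nhds hsR)] with u hu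
      have hu' : z u ∈ R := hu
      simp only [hg, indic, if_pos hu', if_pos hsR]
    · have hcl : z s ∈ (closure R)ᶜ := fun h => hfr ⟨h, fun h' => hsR (interior_subset h')⟩
      filter_upwards [hzc.continuousAt.eventually (isClosed_closure.isOpen_compl.mem_nhds hcl)]
        with u hu
      have : z u ∉ R := fun h => hu (subset_closure h)
      simp only [hg, indic, if_neg this, if_neg hsR]
  have hcross : ∀ s ∈ Set.Icc (0 : ℝ) 1, ∀ p : Σ i, Fin (T.numSimp i), p.1 ∈ ρ.surfaces →
      z s ∈ convexHull ℝ (Set.range (onSimplex X p.1 p.2)) →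
      s ∈ Set.Ioo (0 : ℝ) 1 ∧ z s ∈ openSimplex (onSimplex X p.1 p.2) ∧
        inner ℝ (orientVec (onSimplex X p.1 p.2)) (y - x) ≠ 0 := by
    intro s hs p hp hmem
    have hne := (hgen p.1 hp p.2).resolve_right fun h => h s hs hmem
    obtain ⟨⟨s', hs', ho⟩, hA⟩ := crossing_ne_zero_iff.1 hne
    have hss : s' = s := eq_of_lineMap_mem hA hmem (openSimplex_subset_convexHull _ ho)
    subst hss
    exact ⟨hs', ho, hA⟩
  have hdich : ∀ s, z s ∉ (⋃ i ∈ ρ.surfaces, surf X i) ∨ ∃ p : Σ i, Fin (T.numSimp i),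
      p.1 ∈ ρ.surfaces ∧ z s ∈ convexHull ℝ (Set.range (onSimplex X p.1 p.2)) := by
    intro s
    by_cases h : z s ∈ (⋃ i ∈ ρ.surfaces, surf X i)
    · obtain ⟨i', hi'⟩ := Set.mem_iUnion.1 h
      obtain ⟨hi, hi''⟩ := Set.mem_iUnion.1 hi'
      obtain ⟨a', ha'⟩ := Set.mem_iUnion.1 hi''
      exact Or.inr ⟨⟨i', a'⟩, hi, ha'⟩
    · exact Or.inl h
  have hend : ∀ s ∈ Set.Icc (0 : ℝ) 1, s ∉ Set.Ioo (0 : ℝ) 1 → ∀ᶠ u in 𝓝 s, g u = g s := by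
    intro s hs hs'
    rcases hdich s with h | ⟨p, hp, hmem⟩
    · exact hconst s hs h
    · exact absurd (hcross s hs p hp hmem).1 hs'
  have hsum := sub_eq_sum_jumps g τ ε hτI
    (nhdsWithin_le_nhds (hend 0 (by simp) (by simp)))
    (nhdsWithin_le_nhds (hend 1 (by simp) (by simp))) (by
      intro s hs
      rcases hdich s with hno | ⟨p, hp, hmem⟩
      · refine ⟨g s, g s, nhdsWithin_le_nhds (hconst s hs hno),
          nhdsWithin_le_nhds (hconst s hs hno), ?_⟩
        rw [sub_self]
        refine (Finset.sum_eq_zero fun p _ => ?_).symm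
        split_ifs with hps
        · by_contra hne
          obtain ⟨hpi, hPp⟩ := hεP p hne
          refine hno (Set.mem_iUnion₂.2 ⟨p.1, hpi, Set.mem_iUnion.2 ⟨p.2, ?_⟩⟩)
          have := (hτspec p hPp).2
          rw [hps] at this
          exact openSimplex_subset_convexHull _ this
        · rfl
      · obtain ⟨hs', ho, hA⟩ := hcross s hs p hp hmem
        have hPp : P p := ⟨s, hs', ho⟩
        have hτp : τ p = s := eq_of_lineMap_mem hA hmem
          (openSimplex_subset_convexHull _ (hτspec p hPp).2)
        have hjump : (∑ p, if τ p = s then ε p else 0) = ε p := by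
          rw [Finset.sum_eq_single p]
          · rw [if_pos hτp]
          · intro p' _ hp'
            split_ifs with h1
            · by_contra hne
              obtain ⟨-, hPp'⟩ := hεP p' hne
              have h2 := (hτspec p' hPp').2
              rw [h1] at h2
              exact hp' (hR.embedded.simplex_eq ho (openSimplex_subset_convexHull _ h2)).symm
            · rfl
          · simp
        rw [hjump]
        have hA0 : orientVec (onSimplex X p.1 p.2) ≠ 0 := fun h => hA (by rw [h, inner_zero_left])
        have hside := hzc.continuousAt.eventually
          (hR.eventually_side hp ho (hzK s hs) hA0)
        have hzu : ∀ u, z u - z s = (u - s) • (y - x) := by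
          intro u
          simp only [hz, AffineMap.lineMap_apply_module']
          module
        simp only [hzu, inner_smul_right] at hside
        have hε' : ε p = -((((ρ.sign p.1 : ℤˣ) : ℤ)) *
            ((SignType.sign (inner ℝ (orientVec (onSimplex X p.1 p.2)) (y - x)) : SignType) : ℤ)) := by
          simp only [hε, RegionData.weight, if_pos hp]
          rw [crossing_of_mem hs' ho]
        have key : ∀ c : ℝ, (c < 0 → ∀ᶠ u in 𝓝[<] s, (u - s) * c > 0) ∧
            (0 < c → ∀ᶠ u in 𝓝[<] s, (u - s) * c < 0) ∧
            (c < 0 → ∀ᶠ u in 𝓝[>] s, (u - s) * c < 0) ∧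
            (0 < c → ∀ᶠ u in 𝓝[>] s, (u - s) * c > 0) := by
          intro c
          refine ⟨fun hc => ?_, fun hc => ?_, fun hc => ?_, fun hc => ?_⟩ <;>
            filter_upwards [self_mem_nhdsWithin] with u hu
          · exact mul_pos_of_neg_of_neg (sub_neg.2 hu) hc
          · exact mul_neg_of_neg_of_pos (sub_neg.2 hu) hc
          · exact mul_neg_of_pos_of_neg (sub_pos.2 hu) hc
          · exact mul_pos (sub_pos.2 hu) hc
        set d := inner ℝ (orientVec (onSimplex X p.1 p.2)) (y - x) with hd
        set σ : ℝ := (((ρ.sign p.1 : ℤˣ) : ℤ) : ℝ) with hσ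
        have hσd : σ * d ≠ 0 := by
          refine mul_ne_zero ?_ hA
          rcases Int.units_eq_one_or (ρ.sign p.1) with h | h <;> simp [hσ, h]
        have hεs : ε p = -((SignType.sign (σ * d) : SignType) : ℤ) := by
          rw [hε', int_sign_mul]
          congr 2
          rcases Int.units_eq_one_or (ρ.sign p.1) with h | h <;> simp [hσ, h]
        have hass : ∀ u : ℝ, σ * ((u - s) * d) = (u - s) * (σ * d) := fun u => by ring
        simp only [hass] at hside
        obtain ⟨k1, k2, k3, k4⟩ := key (σ * d)
        rcases lt_or_gt_of_ne hσd with hneg | hpos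
        · refine ⟨0, 1, ?_, ?_, by rw [hεs, sign_neg hneg]; rfl⟩
          · filter_upwards [nhdsWithin_le_nhds hside, k1 hneg] with u hu hu'
            exact if_neg (hu.2 hu')
          · filter_upwards [nhdsWithin_le_nhds hside, k3 hneg] with u hu hu'
            exact if_pos (hu.1 hu')
        · refine ⟨1, 0, ?_, ?_, by rw [hεs, sign_pos hpos]; rfl⟩
          · filter_upwards [nhdsWithin_le_nhds hside, k2 hpos] with u hu hu'
            exact if_pos (hu.1 hu')
          · filter_upwards [nhdsWithin_le_nhds hside, k4 hpos] with u hu hu'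
            exact if_neg (hu.2 hu'))
  have hz0 : z 0 = x := AffineMap.lineMap_apply_zero _ _
  have hz1 : z 1 = y := AffineMap.lineMap_apply_one _ _
  simp only [hg, hz0, hz1, hε, Finset.sum_neg_distrib] at hsum
  rw [Fintype.sum_sigma] at hsum
  simp only [Finset.mul_sum]
  linarith

end region

end ClusterMesh

end SurfaceCluster

namespace SurfaceCluster

/-! ### Crossing numbers near a facet -/

section junctionForm

variable {n : ℕ}

/-- The oriented volume spanned by two points or vectors and a facet `G`, in homogeneous
coordinates. It induces an area form on the plane of the directions transversal to `G`. -/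
noncomputable def junctionForm (G : Fin n → E n) : (ℝ × E n) →ₗ[ℝ] (ℝ × E n) →ₗ[ℝ] ℝ :=
  LinearMap.mk₂ ℝ (fun p r => (((hvol n).curryLeft p).curryLeft r) (hom G))
    (by intros; simp) (by intros; simp) (by intros; simp) (by intros; simp)

theorem junctionForm_apply (G : Fin n → E n) (p r : ℝ × E n) :
    junctionForm G p r = hvol n (Fin.cons p (Fin.cons r (hom G))) := rfl

theorem junctionForm_self (G : Fin n → E n) (p : ℝ × E n) : junctionForm G p p = 0 := by
  rw [junctionForm_apply]
  refine (hvol n).map_eq_zero_of_eq _ (i := 0) (j := 1) rfl (by simp)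

theorem junctionForm_swap (G : Fin n → E n) (p r : ℝ × E n) :
    junctionForm G p r = -junctionForm G r p := by
  have h := junctionForm_self G (p + r)
  simp only [map_add, LinearMap.add_apply, junctionForm_self] at h
  linarith

theorem junctionForm_hom (G : Fin n → E n) (p : ℝ × E n) (c : Fin n) :
    junctionForm G p (1, G c) = 0 := by
  rw [junctionForm_apply]
  refine (hvol n).map_eq_zero_of_eq _ (i := 1) (j := c.succ.succ) rfl ?_
  exact fun h => Fin.succ_ne_zero _ (Fin.succ_injective _ (h.symm.trans Fin.succ_zero_eq_one.symm))

theorem junctionForm_apex (G : Fin n → E n) (V z : E n) :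
    junctionForm G (0, z) (1, V) =
      -inner ℝ (orientVec (Fin.cons V G : Fin (n + 1) → E n)) z := by
  rw [inner_orientVec, neg_neg, junctionForm_apply]
  congr 2
  funext i
  refine Fin.cases rfl (fun k => rfl) i

theorem junctionForm_smul_right (G : Fin n → E n) (a b : E n) (t : ℝ) :
    junctionForm G (0, a) (0, t • b) = t * junctionForm G (0, a) (0, b) := by
  have : ((0, t • b) : ℝ × E n) = t • (0, b) := by ext1 <;> simp
  rw [this, map_smul, smul_eq_mul]

theorem junctionForm_add_right (G : Fin n → E n) (a b b' : E n) :
    junctionForm G (0, a) (0, b + b') =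
      junctionForm G (0, a) (0, b) + junctionForm G (0, a) (0, b') := by
  have : ((0, b + b') : ℝ × E n) = (0, b) + (0, b') := by ext1 <;> simp
  rw [this, map_add]

/-- The centroid of a facet. -/
noncomputable def centroid (G : Fin n → E n) : E n := ∑ c, (n : ℝ)⁻¹ • G c

theorem junctionForm_centroid (hn : n ≠ 0) (G : Fin n → E n) (p : ℝ × E n) :
    junctionForm G p (1, centroid G) = 0 := by
  have h : ((1, centroid G) : ℝ × E n) = ∑ c, (n : ℝ)⁻¹ • (1, G c) := by
    have := sum_smul_hom G (fun _ => (n : ℝ)⁻¹)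
    rw [centroid, show (∑ c, (n : ℝ)⁻¹ • ((1, G c) : ℝ × E n)) = ∑ c, (n : ℝ)⁻¹ • hom G c from rfl,
      this]
    simp [hn]
  rw [h, map_sum]
  refine Finset.sum_eq_zero fun c _ => ?_
  rw [map_smul, junctionForm_hom, smul_zero]

/-- If a point `centroid G + v` is a combination of `V` and the vertices of `G` then the weight of
`V` determines the component of `v` transversal to `G`. -/
theorem junctionForm_combination (hn : n ≠ 0) (G : Fin n → E n) (V a v : E n)
    (w : Fin (n + 1) → ℝ) (hw1 : ∑ k, w k = 1)
    (hv : centroid G + v = ∑ k, w k • (Fin.cons V G : Fin (n + 1) → E n) k) :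
    junctionForm G (0, a) (0, v) =
      -(w 0 * inner ℝ (orientVec (Fin.cons V G : Fin (n + 1) → E n)) a) := by
  have h : ((0, v) : ℝ × E n) =
      w 0 • (1, V) + ∑ c : Fin n, w c.succ • ((1, G c) : ℝ × E n) - (1, centroid G) := by
    rw [eq_sub_iff_add_eq]
    rw [Fin.sum_univ_succ] at hw1 hv
    ext1
    · simp [Prod.fst_sum, hw1]
    · simp only [Prod.snd_add, Prod.smul_snd, Prod.snd_sum]
      simp only [Fin.cons_zero, Fin.cons_succ] at hv
      rw [← hv, add_comm]
  rw [h, map_sub, map_add, map_sum, map_smul, junctionForm_centroid hn, junctionForm_apex]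
  rw [Finset.sum_eq_zero fun c _ => by rw [map_smul, junctionForm_hom, smul_zero]]
  simp

open Classical in
/-- A small segment that turns around a facet `G` in the positive sense crosses the simplex with
apex `V` over `G` if and only if it passes from its negative to its positive side. -/
theorem eventually_crossing_apex (hn : n ≠ 0) (G : Fin n → E n) (V a b : E n)
    (hab : 0 < junctionForm G (0, a) (0, b))
    (ha : inner ℝ (orientVec (Fin.cons V G : Fin (n + 1) → E n)) a ≠ 0)
    (hb : inner ℝ (orientVec (Fin.cons V G : Fin (n + 1) → E n)) b ≠ 0) :
    ∀ᶠ ε : ℝ in 𝓝[>] 0,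
      InGenPos (centroid G + ε • a) (centroid G + ε • b) (Fin.cons V G : Fin (n + 1) → E n) ∧
      crossing (centroid G + ε • a) (centroid G + ε • b) (Fin.cons V G : Fin (n + 1) → E n) =
        if inner ℝ (orientVec (Fin.cons V G : Fin (n + 1) → E n)) a < 0 ∧
          0 < inner ℝ (orientVec (Fin.cons V G : Fin (n + 1) → E n)) b then 1 else 0 := by
  set q : Fin (n + 1) → E n := Fin.cons V G with hq
  set α := inner ℝ (orientVec q) a with hα
  set β := inner ℝ (orientVec q) b with hβ
  have hline : ∀ ε s : ℝ, AffineMap.lineMap (centroid G + ε • a) (centroid G + ε • b) s =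
      centroid G + ε • ((1 - s) • a + s • b) := by
    intro ε s
    rw [AffineMap.lineMap_apply_module]
    module
  have hDa : ∀ s : ℝ, junctionForm G (0, a) (0, (1 - s) • a + s • b) =
      s * junctionForm G (0, a) (0, b) := by
    intro s
    rw [junctionForm_add_right, junctionForm_smul_right, junctionForm_smul_right,
      junctionForm_self, mul_zero, zero_add]
  have hDb : ∀ s : ℝ, junctionForm G (0, b) (0, (1 - s) • a + s • b) =
      -((1 - s) * junctionForm G (0, a) (0, b)) := by
    intro s
    rw [junctionForm_add_right, junctionForm_smul_right, junctionForm_smul_right,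
      junctionForm_self, mul_zero, add_zero, junctionForm_swap, mul_neg]
  by_cases hcase : α < 0 ∧ 0 < β
  · rw [if_pos hcase]
    obtain ⟨hα0, hβ0⟩ := hcase
    set s : ℝ := -α / (β - α) with hs
    have hden : 0 < β - α := by linarith
    have hs0 : 0 < s := div_pos (by linarith) hden
    have hs1 : s < 1 := (div_lt_one hden).2 (by linarith)
    set m : E n := (1 - s) • a + s • b with hm
    have hAm : inner ℝ (orientVec q) m = 0 := by
      rw [hm, inner_add_right, inner_smul_right, inner_smul_right, ← hα, ← hβ, hs]
      field_simp
      ring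
    have hA : orientVec q ≠ 0 := fun h => ha (by rw [hα, h, inner_zero_left])
    have hvol0 : hvol n (Fin.cons (0, orientVec q) (hom q)) ≠ 0 := by
      have h1 := inner_orientVec q (orientVec q)
      rw [real_inner_self_eq_norm_sq] at h1
      have h2 : ‖orientVec q‖ ^ 2 ≠ 0 := pow_ne_zero 2 (norm_ne_zero_iff.2 hA)
      intro h
      rw [h, neg_zero] at h1
      exact h2 h1
    obtain ⟨c, hc⟩ := exists_eq_sum_of_hvol_ne_zero hvol0 (0, m)
    have hc0 : c 0 = 0 := by
      have h1 := hvol_update_sum (Fin.cons (0, orientVec q) (hom q)) c 0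
      rw [hc, Fin.update_cons_zero] at h1
      have h2 := inner_orientVec q m
      rw [hAm, h1] at h2
      have : c 0 * hvol n (Fin.cons (0, orientVec q) (hom q)) = 0 := by linarith
      exact (mul_eq_zero.1 this).resolve_right hvol0
    rw [Fin.sum_univ_succ, hc0, zero_smul, zero_add] at hc
    simp only [Fin.cons_succ] at hc
    rw [sum_smul_hom] at hc
    obtain ⟨hcs, hcm⟩ := Prod.mk.inj hc
    -- the weights of the crossing point
    set w : ℝ → Fin (n + 1) → ℝ := fun ε k =>
      ε * c k.succ + (Fin.cons 0 (fun _ => (n : ℝ)⁻¹) : Fin (n + 1) → ℝ) k with hw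
    have hw1 : ∀ ε, ∑ k, w ε k = 1 := by
      intro ε
      simp only [hw, Finset.sum_add_distrib, ← Finset.mul_sum, hcs]
      rw [Fin.sum_univ_succ]
      simp [hn]
    have hwp : ∀ ε : ℝ, centroid G + ε • m = ∑ k, w ε k • q k := by
      intro ε
      simp only [hw, add_smul, Finset.sum_add_distrib, mul_smul, ← Finset.smul_sum, hcm]
      rw [add_comm]
      congr 1
      rw [Fin.sum_univ_succ]
      simp [centroid, hq]
    have ht : 0 < c (Fin.succ 0) := by
      have h1 := junctionForm_combination hn G V a ((1 : ℝ) • m) (w 1) (hw1 1) (hwp 1)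
      rw [one_smul, hm, hDa] at h1
      have h2 : w 1 0 = c (Fin.succ 0) := by simp [hw]
      rw [h2] at h1
      have h3 := mul_pos hs0 hab
      by_contra hneg
      have h4 := mul_nonneg_of_nonpos_of_nonpos (not_lt.1 hneg) hα0.le
      rw [← hq] at h1
      linarith
    have hpos : ∀ᶠ ε : ℝ in 𝓝[>] 0, ∀ k, 0 < w ε k := by
      rw [Filter.eventually_all]
      intro k
      refine Fin.cases ?_ (fun k => ?_) k
      · filter_upwards [self_mem_nhdsWithin] with ε hε
        simp only [hw, Fin.cons_zero, add_zero]
        exact mul_pos hε ht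
      · have hcont : Continuous fun ε => w ε k.succ := by simp only [hw]; fun_prop
        have h0 : 0 < w 0 k.succ := by
          simp only [hw, Fin.cons_succ, zero_mul, zero_add]
          exact inv_pos.2 (Nat.cast_pos.2 (Nat.pos_of_ne_zero hn))
        exact nhdsWithin_le_nhds (hcont.continuousAt.eventually (lt_mem_nhds h0))
    filter_upwards [hpos, self_mem_nhdsWithin] with ε hε hε0
    have hcr : crossing (centroid G + ε • a) (centroid G + ε • b) q = 1 := by
      rw [crossing_of_mem (s := s) ⟨hs0, hs1⟩ ⟨w ε, hε, hw1 ε, by rw [hline]; exact hwp ε⟩]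
      have : 0 < inner ℝ (orientVec q) (centroid G + ε • b - (centroid G + ε • a)) := by
        rw [add_sub_add_left_eq_sub, ← smul_sub, inner_smul_right, inner_sub_right]
        exact mul_pos hε0 (by linarith)
      rw [sign_pos this]; rfl
    exact ⟨Or.inl (by rw [hcr]; exact one_ne_zero), hcr⟩
  · rw [if_neg hcase]
    filter_upwards [self_mem_nhdsWithin] with ε hε
    have hε0 : 0 < ε := hε
    have hno : ∀ s ∈ Set.Icc (0 : ℝ) 1, AffineMap.lineMap (centroid G + ε • a)
        (centroid G + ε • b) s ∉ convexHull ℝ (Set.range q) := by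
      intro s hs hmem
      obtain ⟨w, hw, hw1, heq⟩ := (mem_convexHull_range_iff _ _).1 hmem
      rw [hline] at heq
      have h1 := junctionForm_combination hn G V a _ w hw1 heq
      have h2 := junctionForm_combination hn G V b _ w hw1 heq
      rw [junctionForm_smul_right, hDa, ← hq, ← hα] at h1
      rw [junctionForm_smul_right, hDb, ← hq, ← hβ] at h2
      have h3 : 0 ≤ ε * (s * junctionForm G (0, a) (0, b)) :=
        mul_nonneg hε0.le (mul_nonneg hs.1 hab.le)
      have h4 : 0 ≤ ε * ((1 - s) * junctionForm G (0, a) (0, b)) :=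
        mul_nonneg hε0.le (mul_nonneg (by linarith [hs.2]) hab.le)
      have h5 : 0 < ε * (s * junctionForm G (0, a) (0, b)) +
          ε * ((1 - s) * junctionForm G (0, a) (0, b)) := by
        have : ε * (s * junctionForm G (0, a) (0, b)) +
          ε * ((1 - s) * junctionForm G (0, a) (0, b)) = ε * junctionForm G (0, a) (0, b) := by ring
        rw [this]; exact mul_pos hε0 hab
      rcases (hw 0).eq_or_lt with h0 | h0
      · rw [← h0] at h1 h2
        linarith
      · refine hcase ⟨lt_of_le_of_ne ?_ ha, lt_of_le_of_ne ?_ hb.symm⟩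
        · by_contra hpos
          have := mul_pos h0 (not_le.1 hpos)
          linarith
        · by_contra hneg
          have := mul_neg_of_pos_of_neg h0 (not_le.1 hneg)
          linarith
    exact ⟨Or.inr hno, crossing_eq_zero_of_forall hno⟩

/-- Around a closed cyclic sequence of three directions there is exactly one change from negative
to positive values of a linear function. -/
theorem sum_cyclic_changes {α β γ : ℝ} (hα : α ≠ 0) (hβ : β ≠ 0) (hγ : γ ≠ 0)
    (h : α + β + γ = 0) :
    (if α < 0 ∧ 0 < β then (1 : ℤ) else 0) + (if β < 0 ∧ 0 < γ then 1 else 0) +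
      (if γ < 0 ∧ 0 < α then 1 else 0) = 1 := by
  rcases lt_or_gt_of_ne hα with h1 | h1 <;> rcases lt_or_gt_of_ne hβ with h2 | h2 <;>
    rcases lt_or_gt_of_ne hγ with h3 | h3 <;>
    first
    | (exfalso; linarith)
    | simp [h1, h2, h3, h1.not_gt, h2.not_gt, h3.not_gt]

/-- Two directions in general position with respect to finitely many hyperplanes, in the positive
sense around `G`. -/
theorem exists_generic_directions (hn : n ≠ 0) (G : Fin n → E n) {ι : Type*} [Finite ι] [Nonempty ι]
    (A : ι → E n)
    (V : ι → E n) (hAV : ∀ j, A j = orientVec (Fin.cons (V j) G : Fin (n + 1) → E n))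
    (hA : ∀ j, A j ≠ 0) :
    ∃ a b : E n, 0 < junctionForm G (0, a) (0, b) ∧ ∀ j, inner ℝ (A j) a ≠ 0 ∧
      inner ℝ (A j) b ≠ 0 ∧ inner ℝ (A j) (a + b) ≠ 0 := by
  have hf : ∀ j, ∃ x, (innerₛₗ ℝ (A j)) x ≠ 0 := fun j => ⟨A j, by
    rw [innerₛₗ_apply_apply, real_inner_self_eq_norm_sq]
    exact pow_ne_zero 2 (norm_ne_zero_iff.2 (hA j))⟩
  obtain ⟨a, ha⟩ := Module.Dual.exists_forall_ne_zero_of_forall_exists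
    (fun j => innerₛₗ ℝ (A j)) hf
  obtain ⟨j₀⟩ := ‹Nonempty ι›
  set L : Module.Dual ℝ (E n) := (junctionForm G (0, a)).comp (LinearMap.inr ℝ ℝ (E n)) with hL
  have hLx : ∃ x, L x ≠ 0 := by
    refine ⟨V j₀ - centroid G, ?_⟩
    have h1 : ((0, V j₀ - centroid G) : ℝ × E n) = (1, V j₀) - (1, centroid G) := by ext1 <;> simp
    have h2 : L (V j₀ - centroid G) = junctionForm G (0, a) (0, V j₀ - centroid G) := rfl
    rw [h2, h1, map_sub, junctionForm_centroid hn, junctionForm_apex, ← hAV, sub_zero, neg_ne_zero]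
    exact ha j₀
  obtain ⟨b, hb⟩ := Module.Dual.exists_forall_ne_zero_of_forall_exists
    (fun j : Option ι => j.elim L fun j => innerₛₗ ℝ (A j))
    (fun j => by cases j with | none => exact hLx | some j => exact hf j)
  have hb0 : junctionForm G (0, a) (0, b) ≠ 0 := hb none
  have hev : ∀ᶠ t : ℝ in 𝓝[>] 0, ∀ j, inner ℝ (A j) (a + t • b) ≠ 0 := by
    rw [Filter.eventually_all]
    intro j
    have hc : Continuous fun t : ℝ => inner ℝ (A j) (a + t • b) := by fun_prop
    refine nhdsWithin_le_nhds (hc.continuousAt.eventually_ne ?_)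
    rw [zero_smul, add_zero]
    exact ha j
  obtain ⟨t, ht, ht0⟩ := (hev.and self_mem_nhdsWithin).exists
  have ht0' : (0 : ℝ) < t := ht0
  have htb : ∀ j, inner ℝ (A j) (t • b) ≠ 0 := fun j => by
    rw [inner_smul_right]
    exact mul_ne_zero ht0'.ne' (hb (some j))
  rcases lt_or_gt_of_ne hb0 with hneg | hpos
  · refine ⟨t • b, a, ?_, fun j => ⟨htb j, ha j, by rw [add_comm (t • b) a]; exact ht j⟩⟩
    rw [junctionForm_swap, junctionForm_smul_right, neg_pos]
    exact mul_neg_of_pos_of_neg ht0' hneg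
  · refine ⟨a, t • b, ?_, fun j => ⟨ha j, htb j, ht j⟩⟩
    rw [junctionForm_smul_right]
    exact mul_pos ht0' hpos

end junctionForm

/-! ### The junction condition for the weights of a region -/

namespace ClusterMesh

variable {n : ℕ} {T : ClusterMesh n}

/-- The vertices of some facet of a triple junction line. -/
theorem exists_junction_facet {k : Fin T.numTJ} (hk : (T.tjFacets k 0).Nonempty) :
    ∃ f : Fin n → Fin (T.tjSize k), ∀ j,
      Finset.univ.image (fun c => T.rho k j (f c)) ∈ T.tjFacets k j := by
  obtain ⟨F, hF⟩ := hk
  have heq : (Finset.univ.filter fun l => T.rho k 0 l ∈ F).image (T.rho k 0) = F := by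
    ext v
    simp only [Finset.mem_image, Finset.mem_filter, Finset.mem_univ, true_and]
    constructor
    · rintro ⟨l, hl, rfl⟩; exact hl
    · intro hv
      have : v ∈ Set.range (T.rho k 0) := by rw [T.rho_range]; exact ⟨F, hF, hv⟩
      obtain ⟨l, rfl⟩ := this
      exact ⟨l, hv, rfl⟩
  set F₀ := Finset.univ.filter fun l => T.rho k 0 l ∈ F with hF₀
  have hcard : F₀.card = n := by
    have := ((T.mem_bdry_iff _ _).1 ⟨_, hF⟩).1
    rwa [← heq, Finset.card_image_of_injective _ (T.rho_injective k 0)] at this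
  refine ⟨F₀.orderEmbOfFin hcard, fun j => ?_⟩
  have himg : Finset.univ.image (F₀.orderEmbOfFin hcard) = F₀ := by
    rw [← Finset.coe_inj, Finset.coe_image, Finset.coe_univ, Set.image_univ,
      Finset.range_orderEmbOfFin]
  have := T.rho_facet k 0 j F₀ (by rw [heq]; exact hF)
  rwa [← himg, Finset.image_image] at this

theorem inGenPos_perm {x y : E n} {q : Fin (n + 1) → E n} (p : Equiv.Perm (Fin (n + 1))) :
    InGenPos x y (q ∘ p) ↔ InGenPos x y q := by
  unfold InGenPos
  rw [crossing_perm, EquivLike.range_comp]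
  rcases Int.units_eq_one_or (Equiv.Perm.sign p) with h | h <;> simp [h]

/-- The centroid of a facet at which the region could have a corner lies in the container. -/
theorem IsEnclosedRegion.centroid_mem {D : T.Walls} {ρ : T.RegionData} {X : T.VectorField}
    {R : Set (E n)} (hn : n ≠ 0) (hR : IsEnclosedRegion D ρ X R) {k : Fin T.numTJ} {j : Fin 3}
    (hj : T.tjSurf k j ∈ ρ.surfaces) {f : Fin n → Fin (T.tjSize k)}
    (hf : Finset.univ.image (fun c => T.rho k j (f c)) ∈ T.tjFacets k j) :
    centroid (fun c => X (T.tjSurf k j) (T.rho k j (f c))) ∈ ρ.container D := by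
  have hmem : ∀ c, X (T.tjSurf k j) (T.rho k j (f c)) ∈
      ρ.trunc ∩ {x | ∀ k ∈ ρ.planes, D.offset k ≤ inner ℝ (D.normal k) x} := by
    intro c
    obtain ⟨a, b, hab⟩ := T.vert_cover _ (T.rho k j (f c))
    refine hR.surf_subset _ hj (Set.mem_iUnion.2 ⟨a, subset_convexHull ℝ _ ⟨b, ?_⟩⟩)
    rw [onSimplex, hab]
  have hn0 : (0 : ℝ) < (n : ℝ)⁻¹ := inv_pos.2 (Nat.cast_pos.2 (Nat.pos_of_ne_zero hn))
  have hsum : ∑ _c : Fin n, (n : ℝ)⁻¹ = 1 := by simp [hn]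
  refine ⟨ρ.convex_trunc.sum_mem (fun c _ => hn0.le) hsum fun c _ => (hmem c).1,
    fun k' hk' => ?_⟩
  obtain ⟨v, hv, hlt⟩ := hR.junction_off k j hj _ hf k' hk'
  obtain ⟨c, -, rfl⟩ := Finset.mem_image.1 hv
  have h1 : D.offset k' = ∑ _c : Fin n, (n : ℝ)⁻¹ * D.offset k' := by
    rw [← Finset.sum_mul, hsum, one_mul]
  rw [centroid, inner_sum, h1]
  simp only [inner_smul_right]
  exact Finset.sum_lt_sum (fun c _ => mul_le_mul_of_nonneg_left ((hmem c).2 k' hk') hn0.le)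
    ⟨c, Finset.mem_univ c, mul_lt_mul_of_pos_left hlt hn0⟩

/-- The indicator function of the region returns to its value after a turn around a triple junction
line. Hence the weights of the bounding surfaces satisfy the junction condition of `W^h`. -/
theorem IsEnclosedRegion.sum_orient_weight {D : T.Walls} {ρ : T.RegionData} {X : T.VectorField}
    {R : Set (E n)} (hn : n ≠ 0) (hX : IsCluster D X) (hR : IsEnclosedRegion D ρ X R)
    {k : Fin T.numTJ} (hk : (T.tjFacets k 0).Nonempty) :
    ∑ j, ((T.orient k j : ℤˣ) : ℤ) * ρ.weight (T.tjSurf k j) = 0 := by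
  classical
  by_cases hnone : ∀ j, T.tjSurf k j ∉ ρ.surfaces
  · refine Finset.sum_eq_zero fun j _ => ?_
    rw [RegionData.weight, if_neg (hnone j), mul_zero]
  push Not at hnone
  obtain ⟨j₁, hj₁⟩ := hnone
  obtain ⟨f, hf⟩ := exists_junction_facet hk
  set G : Fin n → E n := fun c => X (T.tjSurf k 0) (T.rho k 0 (f c)) with hG
  have hGj : ∀ j, (fun c => X (T.tjSurf k j) (T.rho k j (f c))) = G := fun j => by
    funext c; exact hX.junction k (f c) j 0
  have hx₀ : centroid G ∈ ρ.container D := by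
    rw [← hGj j₁]; exact hR.centroid_mem hn hj₁ (hf j₁)
  choose a m σ hσ hσ0 hfac huniq using fun j => exists_simplex_of_mem_bdry (hf j)
  set V : Fin 3 → E n := fun j => onSimplex X (T.tjSurf k j) (a j) (m j) with hV
  have hq : ∀ j, onSimplex X (T.tjSurf k j) (a j) ∘ σ j = Fin.cons (V j) G := by
    intro j
    have h1 : onSimplex X (T.tjSurf k j) (a j) ∘ σ j =
        X (T.tjSurf k j) ∘ (T.vert (T.tjSurf k j) (a j) ∘ σ j) := rfl
    rw [h1, hσ, ← hGj j]
    funext c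
    refine Fin.cases rfl (fun c => rfl) c
  have hA : ∀ j, orientVec (Fin.cons (V j) G : Fin (n + 1) → E n) ≠ 0 := fun j => by
    refine orientVec_ne_zero ?_
    rw [← hq]
    exact (hX.nondegenerate _ (a j)).comp_embedding (σ j).toEmbedding
  obtain ⟨u, v, huv, hgen⟩ := exists_generic_directions hn G _ V (fun j => rfl) hA
  -- the third direction
  set w : E n := -(u + v) with hw
  have hvw : 0 < junctionForm G (0, v) (0, w) := by
    have : w = (-1 : ℝ) • u + (-1 : ℝ) • v := by rw [hw]; module
    rw [this, junctionForm_add_right, junctionForm_smul_right, junctionForm_smul_right,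
      junctionForm_self, junctionForm_swap]
    linarith
  have hwu : 0 < junctionForm G (0, w) (0, u) := by
    have : w = (-1 : ℝ) • u + (-1 : ℝ) • v := by rw [hw]; module
    rw [junctionForm_swap, this, junctionForm_add_right, junctionForm_smul_right,
      junctionForm_smul_right, junctionForm_self]
    linarith
  have hgw : ∀ j, inner ℝ (orientVec (Fin.cons (V j) G : Fin (n + 1) → E n)) w ≠ 0 := fun j => by
    rw [hw, inner_neg_right, neg_ne_zero]; exact (hgen j).2.2
  -- near the centroid there are only the three simplices adjacent to the facet
  have hnear : ∀ᶠ y in 𝓝 (centroid G), y ∈ ρ.container D ∧ ∀ p : Σ i, Fin (T.numSimp i),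
      (∀ j, (⟨T.tjSurf k j, a j⟩ : Σ i, Fin (T.numSimp i)) ≠ p) →
      y ∉ convexHull ℝ (Set.range (onSimplex X p.1 p.2)) := by
    refine Filter.Eventually.and (ρ.isOpen_container.mem_nhds hx₀) ?_
    rw [Filter.eventually_all]
    intro p
    by_cases hp : ∀ j, (⟨T.tjSurf k j, a j⟩ : Σ i, Fin (T.numSimp i)) ≠ p
    · have hcl : IsClosed (convexHull ℝ (Set.range (onSimplex X p.1 p.2))) :=
        (Set.finite_range _).isClosed_convexHull ℝ
      have hxn : centroid G ∉ convexHull ℝ (Set.range (onSimplex X p.1 p.2)) := by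
        intro hmem
        set F : Finset (Fin (T.tjSize k)) := Finset.univ.image f with hF
        have hFj : ∀ j, F.image (T.rho k j) = Finset.univ.image (fun c => T.rho k j (f c)) :=
          fun j => Finset.image_image
        have hfinj : Function.Injective f := fun c c' h =>
          injective_of_image_mem_bdry (hf 0) (congrArg (T.rho k 0) h)
        have hn0 : (n : ℝ)⁻¹ ≠ 0 := by simp [hn]
        set ω : Fin (T.tjSize k) → ℝ := pushWeight f fun _ => (n : ℝ)⁻¹ with hω
        obtain ⟨j, b, hpb, hsub⟩ := hR.embedded.exists_side (k := k) (F := F) (w := ω)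
          (fun j => by rw [hFj]; exact hf j)
          (pushWeight_nonneg _ fun _ => by positivity)
          (fun l => by
            constructor
            · intro hl
              obtain ⟨c, rfl, -⟩ := exists_of_pushWeight_ne_zero hl
              exact Finset.mem_image_of_mem _ (Finset.mem_univ c)
            · intro hl
              obtain ⟨c, -, rfl⟩ := Finset.mem_image.1 hl
              rw [hω, pushWeight_apply hfinj]
              exact hn0)
          (by rw [hω, sum_pushWeight]; simp [hn]) (i := p.1) (a := p.2)
          (by rw [hω, sum_pushWeight_smul]; exact hmem)
        have hb : b = a j := huniq j b (by rw [← hFj]; exact hsub)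
        exact hp j (by rw [← hb]; exact hpb.symm)
      filter_upwards [hcl.isOpen_compl.mem_nhds hxn] with y hy _ using hy
    · exact Filter.Eventually.of_forall fun y h => absurd h hp
  obtain ⟨r, hr, hball⟩ := Metric.eventually_nhds_iff_ball.1 hnear
  have hsmall : ∀ d : E n, ∀ᶠ ε : ℝ in 𝓝[>] 0, centroid G + ε • d ∈ Metric.ball (centroid G) r := by
    intro d
    have hc : Continuous fun ε : ℝ => centroid G + ε • d := by fun_prop
    have := hc.tendsto 0
    simp only [zero_smul, add_zero] at this
    exact nhdsWithin_le_nhds (this.eventually (Metric.ball_mem_nhds _ hr))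
  -- the crossings of one edge of the small triangle
  have hedge : ∀ d e : E n, 0 < junctionForm G (0, d) (0, e) →
      (∀ j, inner ℝ (orientVec (Fin.cons (V j) G : Fin (n + 1) → E n)) d ≠ 0) →
      (∀ j, inner ℝ (orientVec (Fin.cons (V j) G : Fin (n + 1) → E n)) e ≠ 0) →
      ∀ᶠ ε : ℝ in 𝓝[>] 0, indic R (centroid G + ε • d) - indic R (centroid G + ε • e) =
        ∑ j, ρ.weight (T.tjSurf k j) * (((Equiv.Perm.sign (σ j) : ℤˣ) : ℤ) *
          if inner ℝ (orientVec (Fin.cons (V j) G : Fin (n + 1) → E n)) d < 0 ∧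
            0 < inner ℝ (orientVec (Fin.cons (V j) G : Fin (n + 1) → E n)) e then 1 else 0) := by
    intro d e hde hd he
    have hall : ∀ᶠ ε : ℝ in 𝓝[>] 0, ∀ j, _ := Filter.eventually_all.2 fun j =>
      eventually_crossing_apex hn G (V j) d e hde (hd j) (he j)
    filter_upwards [hall, hsmall d, hsmall e] with ε hε hbd hbe
    have hside : ∀ j, crossing (centroid G + ε • d) (centroid G + ε • e)
        (onSimplex X (T.tjSurf k j) (a j)) = ((Equiv.Perm.sign (σ j) : ℤˣ) : ℤ) *
          if inner ℝ (orientVec (Fin.cons (V j) G : Fin (n + 1) → E n)) d < 0 ∧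
            0 < inner ℝ (orientVec (Fin.cons (V j) G : Fin (n + 1) → E n)) e then 1 else 0 := by
      intro j
      have h1 := (hε j).2
      rw [← hq, crossing_perm] at h1
      rw [← hq, ← h1, ← mul_assoc, ← Units.val_mul, Int.units_mul_self, Units.val_one, one_mul]
    have hother : ∀ p : Σ i, Fin (T.numSimp i),
        (∀ j, (⟨T.tjSurf k j, a j⟩ : Σ i, Fin (T.numSimp i)) ≠ p) → ∀ s ∈ Set.Icc (0 : ℝ) 1,
        AffineMap.lineMap (centroid G + ε • d) (centroid G + ε • e) s ∉
          convexHull ℝ (Set.range (onSimplex X p.1 p.2)) := fun p hp s hs =>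
      (hball _ ((convex_ball _ _).segment_subset hbd hbe
        (segment_eq_image_lineMap ℝ _ (centroid G + ε • e) ▸ ⟨s, hs, rfl⟩))).2 p hp
    rw [hR.indic_sub (hball _ hbd).1 (hball _ hbe).1]
    · simp only [Finset.mul_sum]
      rw [← Fintype.sum_sigma' (f := fun i b => ρ.weight i *
        crossing (centroid G + ε • d) (centroid G + ε • e) (onSimplex X i b))]
      symm
      refine Fintype.sum_of_injective
        (fun j => (⟨T.tjSurf k j, a j⟩ : Σ i, Fin (T.numSimp i))) ?_ _ _ ?_ ?_
      · intro j j' h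
        have h1 : T.tjSurf k j = T.tjSurf k j' := (Sigma.mk.inj_iff.1 h).1
        obtain ⟨h2, h3⟩ := T.slot_lt k
        have h4 := h2.trans h3
        fin_cases j <;> fin_cases j' <;>
          first
          | rfl
          | exact absurd h1 h2.ne
          | exact absurd h1 h3.ne
          | exact absurd h1 h4.ne
          | exact absurd h1 h2.ne'
          | exact absurd h1 h3.ne'
          | exact absurd h1 h4.ne'
      · intro p hp
        have hp' : ∀ j, (⟨T.tjSurf k j, a j⟩ : Σ i, Fin (T.numSimp i)) ≠ p := fun j h => hp ⟨j, h⟩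
        rw [crossing_eq_zero_of_forall (hother p hp'), mul_zero]
      · intro j
        rw [hside]
    · intro i _ b
      by_cases hp : ∃ j, (⟨T.tjSurf k j, a j⟩ : Σ i, Fin (T.numSimp i)) = ⟨i, b⟩
      · obtain ⟨j, hj⟩ := hp
        obtain ⟨rfl, h2⟩ := Sigma.mk.inj_iff.1 hj
        obtain rfl := eq_of_heq h2
        rw [← inGenPos_perm (σ j), hq]
        exact (hε j).1
      · push Not at hp
        exact Or.inr (hother ⟨i, b⟩ hp)
  obtain ⟨ε, ⟨h1, h2⟩, h3⟩ := (((hedge u v huv (fun j => (hgen j).1) fun j => (hgen j).2.1).and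
    (hedge v w hvw (fun j => (hgen j).2.1) hgw)).and
    (hedge w u hwu hgw fun j => (hgen j).1)).exists
  have hsum : ∑ j, ρ.weight (T.tjSurf k j) * ((Equiv.Perm.sign (σ j) : ℤˣ) : ℤ) = 0 := by
    have h4 : ∀ j, ρ.weight (T.tjSurf k j) * ((Equiv.Perm.sign (σ j) : ℤˣ) : ℤ) = _ := fun j => by
      rw [← mul_one (ρ.weight (T.tjSurf k j) * _), ← sum_cyclic_changes (hgen j).1 (hgen j).2.1
        (hgw j) (by rw [← inner_add_right, ← inner_add_right, hw, add_neg_cancel, inner_zero_right]),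
        mul_add, mul_add]
    rw [Finset.sum_congr rfl fun j _ => h4 j, Finset.sum_add_distrib, Finset.sum_add_distrib]
    simp only [← mul_assoc] at h1 h2 h3
    rw [← h1, ← h2, ← h3]
    ring
  -- the signs of the permutations are the signs of the junction up to a common factor
  have horient : ∀ j, ((T.orient k j : ℤˣ) : ℤ) = (((T.orient k 0 : ℤˣ) : ℤ) *
      ((Equiv.Perm.sign (σ 0) : ℤˣ) : ℤ)) * ((Equiv.Perm.sign (σ j) : ℤˣ) : ℤ) := by
    intro j
    have h1 := T.orient_compat k f j 0 (a j) (a 0) _ _ (σ j) (σ 0) (hf j) (hσ j) (hσ 0)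
    rw [← Units.val_mul, ← h1, ← Units.val_mul, mul_assoc, Int.units_mul_self, mul_one]
  rw [Finset.sum_congr rfl fun j _ => by rw [horient j, mul_assoc, mul_comm _ (ρ.weight _)],
    ← Finset.mul_sum, hsum, mul_zero]

end ClusterMesh

end SurfaceCluster

namespace SurfaceCluster

/-! ### Sweeping a simplex from its old to its new position, one vertex after the other -/

section sweep

variable {n : ℕ} {ι : Type*}

/-- Vertex data `(rank, old position, new position)`: at stage `j` of the sweep the vertices of rank
less than `j` are in their new positions. -/
def stage (j : ℕ) (U : ι → ℕ × E n × E n) (k : ι) : E n :=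
  if (U k).1 < j then (U k).2.2 else (U k).2.1

/-- The simplex that is swept when the vertex `k` moves to its new position. -/
def sweepTuple {m : ℕ} (U : Fin m → ℕ × E n × E n) (k : Fin m) : Fin (m + 1) → E n :=
  Fin.cons (U k).2.2 (stage (U k).1 U)

theorem sweepTuple_mem {m : ℕ} {U : Fin m → ℕ × E n × E n} {S : Set (E n)}
    (h : ∀ k, (U k).2.1 ∈ S) (h' : ∀ k, (U k).2.2 ∈ S) (k : Fin m) (l : Fin (m + 1)) :
    sweepTuple U k l ∈ S := by
  refine Fin.cases ?_ (fun l => ?_) l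
  · exact h' k
  · rw [sweepTuple, Fin.cons_succ, stage]
    split_ifs
    · exact h' l
    · exact h l

theorem sweepTuple_perm {m : ℕ} (U : Fin m → ℕ × E n × E n) (π : Equiv.Perm (Fin m)) (k : Fin m) :
    sweepTuple (U ∘ π) k =
      sweepTuple U (π k) ∘ Equiv.Perm.decomposeFin.symm (0, π) := by
  rw [sweepTuple, sweepTuple, cons_comp_decomposeFin]
  rfl

variable {A : Type*} [CommRing A]

theorem sum_sweepTuple_perm (Ψ : (Fin (n + 1) → E n) → A)
    (hΨ : ∀ q (p : Equiv.Perm (Fin (n + 1))), Ψ (q ∘ p) = ((Equiv.Perm.sign p : ℤ) : A) * Ψ q)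
    (U : Fin n → ℕ × E n × E n) (π : Equiv.Perm (Fin n)) :
    ∑ c, Ψ (sweepTuple (U ∘ π) c) =
      ((Equiv.Perm.sign π : ℤ) : A) * ∑ c, Ψ (sweepTuple U c) := by
  rw [← Equiv.sum_comp π fun c => Ψ (sweepTuple U c), Finset.mul_sum]
  refine Finset.sum_congr rfl fun c _ => ?_
  rw [sweepTuple_perm, hΨ, Equiv.Perm.decomposeFin.symm_sign]
  simp

/-- The boundary of the prism swept by a simplex consists of the old simplex, the new simplex, and
the lateral faces swept by the facets. -/
theorem sum_faces_sweepTuple (Ψ : (Fin (n + 1) → E n) → A)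
    (hΨ : ∀ q (p : Equiv.Perm (Fin (n + 1))), Ψ (q ∘ p) = ((Equiv.Perm.sign p : ℤ) : A) * Ψ q)
    (U : Fin (n + 1) → ℕ × E n × E n) (hU : Function.Injective fun k => (U k).1) :
    ∑ k, ∑ m : Fin (n + 2), (-1) ^ (m : ℕ) * Ψ (sweepTuple U k ∘ m.succAbove) =
      Ψ (fun k => (U k).2.1) - Ψ (fun k => (U k).2.2) -
        ∑ m : Fin (n + 1), (-1) ^ (m : ℕ) * ∑ c, Ψ (sweepTuple (U ∘ m.succAbove) c) := by
  set B : Fin (n + 1) → Fin (n + 1) → A := fun m k =>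
    (-1) ^ (m : ℕ) * Ψ (Fin.cons (U k).2.2 (stage (U k).1 U ∘ m.succAbove)) with hB
  have hk : ∀ k, ∑ m : Fin (n + 2), (-1) ^ (m : ℕ) * Ψ (sweepTuple U k ∘ m.succAbove) =
      Ψ (stage (U k).1 U) - ∑ m, B m k := by
    intro k
    rw [Fin.sum_univ_succ, sub_eq_add_neg, ← Finset.sum_neg_distrib]
    congr 1
    · have : sweepTuple U k ∘ Fin.succAbove 0 = stage (U k).1 U := by
        funext c; simp [sweepTuple]
      rw [this]; simp
    · refine Finset.sum_congr rfl fun m _ => ?_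
      have : sweepTuple U k ∘ m.succ.succAbove =
          Fin.cons (U k).2.2 (stage (U k).1 U ∘ m.succAbove) := by
        funext c
        refine Fin.cases ?_ (fun c => ?_) c
        · simp [sweepTuple]
        · simp [sweepTuple]
      rw [this, hB, Fin.val_succ, pow_succ]
      ring
  have hdiag : ∀ k, B k k = Ψ (stage ((U k).1 + 1) U) := by
    intro k
    have h1 : (Fin.cons (U k).2.2 (stage (U k).1 U ∘ k.succAbove) : Fin (n + 1) → E n) =
        stage ((U k).1 + 1) U ∘ (Fin.cycleRange k).symm := by
      rw [comp_cycleRange_symm]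
      congr 1
      · simp [stage]
      · funext c
        have hne : (U (k.succAbove c)).1 ≠ (U k).1 := fun h => Fin.succAbove_ne k c (hU h)
        have : (U (k.succAbove c)).1 < (U k).1 ↔ (U (k.succAbove c)).1 < (U k).1 + 1 := by omega
        simp only [Function.comp_apply, stage, this]
    rw [hB]
    simp only
    rw [h1, hΨ, Equiv.Perm.sign_symm, Fin.sign_cycleRange]
    push_cast
    rw [← mul_assoc, ← mul_pow]
    simp
  have htel : ∑ k, (Ψ (stage (U k).1 U) - Ψ (stage ((U k).1 + 1) U)) =
      Ψ (fun k => (U k).2.1) - Ψ (fun k => (U k).2.2) := by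
    obtain ⟨N, hN⟩ : ∃ N, ∀ k, (U k).1 < N :=
      ⟨(Finset.univ.sup fun k => (U k).1) + 1, fun k =>
        Nat.lt_succ_of_le (Finset.le_sup (f := fun k => (U k).1) (Finset.mem_univ k))⟩
    have h0 : stage 0 U = fun k => (U k).2.1 := by funext k; simp [stage]
    have h1 : stage N U = fun k => (U k).2.2 := by funext k; simp [stage, hN k]
    rw [← h0, ← h1, ← Finset.sum_range_sub' (fun j => Ψ (stage j U)) N,
      ← Finset.sum_image (s := Finset.univ) (g := fun k => (U k).1)
        (f := fun j => Ψ (stage j U) - Ψ (stage (j + 1) U)) (fun a _ b _ h => hU h)]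
    refine Finset.sum_subset (fun j hj => ?_) fun j _ hj => ?_
    · obtain ⟨k, -, rfl⟩ := Finset.mem_image.1 hj
      exact Finset.mem_range.2 (hN k)
    · have : stage (j + 1) U = stage j U := by
        funext k
        have hne : (U k).1 ≠ j := fun h => hj (h ▸ Finset.mem_image_of_mem _ (Finset.mem_univ k))
        have : (U k).1 < j + 1 ↔ (U k).1 < j := by omega
        simp only [stage, this]
      rw [this, sub_self]
  rw [Finset.sum_congr rfl fun k _ => hk k, Finset.sum_sub_distrib, Finset.sum_comm,
    ← htel, Finset.sum_sub_distrib, sub_sub, ← Finset.sum_add_distrib]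
  congr 1
  refine Finset.sum_congr rfl fun m _ => ?_
  rw [Fin.sum_univ_succAbove _ m, hdiag, Finset.mul_sum]
  rfl

end sweep

/-! ### General position of almost all segments -/

section generic

variable {n : ℕ}

open MeasureTheory

theorem volume_affineSpan_eq_zero {ι : Type*} [Fintype ι] (q : ι → E n)
    (h : Fintype.card ι = n + 1) : volume (affineSpan ℝ (Set.range q) : Set (E n)) = 0 := by
  refine Measure.addHaar_affineSubspace _ _ fun htop => ?_
  have h1 := finrank_vectorSpan_range_le ℝ q h
  rw [← direction_affineSpan, htop, AffineSubspace.direction_top, finrank_top,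
    finrank_euclideanSpace_fin] at h1
  omega

theorem ae_inGenPos {ι : Type*} [Finite ι] (Q : ι → Fin (n + 1) → E n) :
    ∀ᵐ x : E n, ∀ᵐ y : E n, ∀ i, InGenPos x y (Q i) := by
  have hx : ∀ᵐ x : E n, ∀ i, x ∉ (affineSpan ℝ (Set.range (Q i)) : Set (E n)) := by
    rw [ae_all_iff]
    intro i
    exact measure_eq_zero_iff_ae_notMem.1 (volume_affineSpan_eq_zero _ (by simp))
  filter_upwards [hx] with x hx
  rw [ae_all_iff]
  intro i
  have h1 : ∀ᵐ y : E n, y ∉ (affineSpan ℝ (Set.range (Q i)) : Set (E n)) :=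
    measure_eq_zero_iff_ae_notMem.1 (volume_affineSpan_eq_zero _ (by simp))
  have h2 : ∀ᵐ y : E n, ∀ k : Fin (n + 1), y ∉
      (affineSpan ℝ (insert x (Set.range fun j : {j // j ≠ k} => Q i j)) : Set (E n)) := by
    rw [ae_all_iff]
    intro k
    have h3 : insert x (Set.range fun j : {j // j ≠ k} => Q i j) =
        Set.range (fun o : Option {j // j ≠ k} => o.elim x fun j => Q i j) := by
      ext z
      simp only [Set.mem_insert_iff, Set.mem_range, Option.exists, Option.elim_none,
        Option.elim_some, eq_comm]
    rw [h3]
    refine measure_eq_zero_iff_ae_notMem.1 (volume_affineSpan_eq_zero _ ?_)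
    rw [Fintype.card_option, Fintype.card_subtype_compl]
    simp
  filter_upwards [h1, h2] with y hy hxy
  exact inGenPos_of_notMem (hx i) hy hxy

end generic

/-! ### The signed indicator function of the swept volume -/

namespace ClusterMesh

open MeasureTheory

variable {n : ℕ} {T : ClusterMesh n}

/-- A numbering of finitely many points. It depends on the points only, so that it is compatible
with the identifications at the triple junction lines. -/
theorem exists_rank (X : T.VectorField) :
    ∃ r : E n → ℕ, Set.InjOn r (⋃ i, Set.range (X i)) :=
  Set.countable_iff_exists_injOn.1 (Set.finite_iUnion fun i => Set.finite_range (X i)).countable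

/-- The ranks and the old and new positions of the vertices of a cluster. -/
def motion (r : E n → ℕ) (X X' : T.VectorField) (i : Fin T.numSurf) (v : Fin (T.numVtx i)) :
    ℕ × E n × E n := (r (X i v), X i v, X' i v)

theorem injective_rank_motion {D : T.Walls} {X : T.VectorField} (hX : IsCluster D X)
    {r : E n → ℕ} (hr : Set.InjOn r (⋃ i, Set.range (X i))) (X' : T.VectorField)
    (i : Fin T.numSurf) (a : Fin (T.numSimp i)) :
    Function.Injective fun k => ((motion r X X' i ∘ T.vert i a) k).1 := by
  intro k k' h
  exact (hX.nondegenerate i a).injective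
    (hr (Set.mem_iUnion.2 ⟨i, Set.mem_range_self _⟩) (Set.mem_iUnion.2 ⟨i, Set.mem_range_self _⟩) h)

/-- The algebraic number of times that a point is swept by the bounding surfaces of a region. -/
noncomputable def RegionData.sweep (ρ : T.RegionData) (r : E n → ℕ) (X X' : T.VectorField)
    (x : E n) : ℤ :=
  ∑ i, ρ.weight i * ∑ a, ∑ k, signedIndicator (sweepTuple (motion r X X' i ∘ T.vert i a) k) x

variable {D : T.Walls} {ρ : T.RegionData} {X X' : T.VectorField}

/-- The boundary lines remain in the external planes. -/
theorem IsCluster.inner_motion (hX : IsCluster D X) (hd : InVBdry D (X' - X)) {k : Fin T.numBL}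
    {F : Finset (Fin (T.numVtx (T.blSurf k)))} (hF : F ∈ T.blFacets k)
    {v : Fin (T.numVtx (T.blSurf k))} (hv : v ∈ F) :
    inner ℝ (D.normal k) (X' (T.blSurf k) v) = D.offset k := by
  have h1 := hd.2 k F hF v hv
  rw [Pi.sub_apply, Pi.sub_apply, inner_sub_right, sub_eq_zero] at h1
  rw [h1]; exact hX.attached k F hF v hv

/-- The lateral faces of the swept volume do not contribute to crossing numbers inside the
container: those over inner facets and triple junctions cancel, and those over boundary lines lie
in the external planes. -/
theorem sum_lateral_crossing (hX : IsCluster D X) (hV : InV X') (hd : InVBdry D (X' - X))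
    (hρ : ∀ k, (T.tjFacets k 0).Nonempty →
      ∑ j, ((T.orient k j : ℤˣ) : ℤ) * ρ.weight (T.tjSurf k j) = 0)
    (r : E n → ℕ) {x y : E n} (hx : x ∈ ρ.container D) (hy : y ∈ ρ.container D) :
    ∑ i, ρ.weight i * ∑ a, ∑ m : Fin (n + 1), (-1) ^ (m : ℕ) *
      ∑ c, crossing x y (sweepTuple (motion r X X' i ∘ T.vert i a ∘ m.succAbove) c) = 0 := by
  refine sum_facets_eq_zero (u := motion r X X')
    (Λ := fun U => ∑ c, crossing x y (sweepTuple U c)) ρ.weight hρ ?_ ?_ ?_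
  · intro k l j j'
    simp only [motion, hX.junction k l j j', hV k l j j']
  · intro f π
    exact sum_sweepTuple_perm _ (fun q p => crossing_perm x y q p) f π
  · intro k F hF f hf
    by_cases hk : T.blSurf k ∈ ρ.surfaces
    swap
    · rw [RegionData.weight, if_neg hk, zero_mul]
    refine mul_eq_zero_of_right _ (Finset.sum_eq_zero fun c _ => ?_)
    refine crossing_eq_zero_of_forall fun s hs hmem => ?_
    have h1 : D.offset k < inner ℝ (D.normal k) (AffineMap.lineMap x y s) :=
      (ρ.convex_container.segment_subset hx hy
        (segment_eq_image_lineMap ℝ x y ▸ ⟨s, hs, rfl⟩)).2 k (ρ.plane_of_surface k hk)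
    have hplane : Convex ℝ {z : E n | inner ℝ (D.normal k) z = D.offset k} :=
      convex_hyperplane (innerₛₗ ℝ (D.normal k)).isLinear _
    have h2 : AffineMap.lineMap x y s ∈ {z : E n | inner ℝ (D.normal k) z = D.offset k} := by
      refine convexHull_min ?_ hplane hmem
      rintro _ ⟨l, rfl⟩
      exact sweepTuple_mem (fun c => hX.attached k F hF _ (hf c))
        (fun c => hX.inner_motion hd hF (hf c)) c l
    exact h1.ne' h2

/-- The change of the region is described by the sweep, up to a constant. -/
theorem exists_ae_indic_sub_indic (hn : n ≠ 0) (hX : IsCluster D X) (hV : InV X')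
    (hd : InVBdry D (X' - X))
    {R R' : Set (E n)} (hR : IsEnclosedRegion D ρ X R) (hR' : IsEnclosedRegion D ρ X' R')
    {r : E n → ℕ} (hr : Set.InjOn r (⋃ i, Set.range (X i))) :
    ∃ c : ℤ, ∀ᵐ x : E n, x ∈ ρ.container D →
      indic R x - indic R' x = ρ.sweep r X X' x + c := by
  have hg₁ := ae_inGenPos fun p : Σ i, Fin (T.numSimp i) => onSimplex X p.1 p.2
  have hg₂ := ae_inGenPos fun p : Σ i, Fin (T.numSimp i) => onSimplex X' p.1 p.2
  have hg₃ := ae_inGenPos fun p : (Σ i, Fin (T.numSimp i)) × Fin (n + 1) × Fin (n + 2) =>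
    sweepTuple (motion r X X' p.1.1 ∘ T.vert p.1.1 p.1.2) p.2.1 ∘ p.2.2.succAbove
  have hK : ∃ᵐ x : E n, x ∈ ρ.container D := by
    rw [frequently_ae_iff]
    exact (ρ.isOpen_container.measure_pos volume (hR.nonempty.mono hR.subset)).ne'
  obtain ⟨x, hx, hx₁, hx₂, hx₃⟩ := (hK.and_eventually (hg₁.and (hg₂.and hg₃))).exists
  refine ⟨indic R x - indic R' x - ρ.sweep r X X' x, ?_⟩
  filter_upwards [hx₁, hx₂, hx₃] with y hy₁ hy₂ hy₃ hy
  have h1 := hR.indic_sub hx hy fun i _ a => hy₁ ⟨i, a⟩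
  have h2 := hR'.indic_sub hx hy fun i _ a => hy₂ ⟨i, a⟩
  have h3 : ρ.sweep r X X' x - ρ.sweep r X X' y =
      ∑ i, ρ.weight i * ∑ a, crossing x y (onSimplex X i a) -
      ∑ i, ρ.weight i * ∑ a, crossing x y (onSimplex X' i a) -
      ∑ i, ρ.weight i * ∑ a, ∑ m : Fin (n + 1), (-1) ^ (m : ℕ) *
        ∑ c, crossing x y (sweepTuple (motion r X X' i ∘ T.vert i a ∘ m.succAbove) c) := by
    simp only [RegionData.sweep, ← Finset.sum_sub_distrib, ← mul_sub]
    refine Finset.sum_congr rfl fun i _ => ?_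
    congr 1
    refine Finset.sum_congr rfl fun a _ => ?_
    have hg : ∀ k (m : Fin (n + 2)),
        InGenPos x y (sweepTuple (motion r X X' i ∘ T.vert i a) k ∘ m.succAbove) :=
      fun k m => hy₃ ⟨⟨i, a⟩, k, m⟩
    have h4 : ∀ k, signedIndicator (sweepTuple (motion r X X' i ∘ T.vert i a) k) x -
        signedIndicator (sweepTuple (motion r X X' i ∘ T.vert i a) k) y = _ :=
      fun k => (sum_crossing_faces (hg k)).symm
    simp only [h4]
    have h5 := sum_faces_sweepTuple (crossing x y)
      (fun q p => by rw [crossing_perm, Int.cast_id])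
      (motion r X X' i ∘ T.vert i a) (injective_rank_motion hX hr X' i a)
    exact h5
  rw [sum_lateral_crossing hX hV hd (fun k hk => hR.sum_orient_weight hn hX hk) r hx hy,
    ← h1, ← h2] at h3
  linarith

end ClusterMesh

end SurfaceCluster

namespace SurfaceCluster

/-! ### The swept volume and the time-averaged normals -/

section sweptVolume

open MeasureTheory

theorem inner_orientVec_one (q : Fin 2 → E 1) (z : E 1) :
    inner ℝ (orientVec q) z = z 0 * (q 1 1 - q 0 1) - z 1 * (q 1 0 - q 0 0) := by
  rw [orientVec, inner_wedge, Matrix.det_fin_two]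
  simp [edge]

theorem inner_orientVec_two (q : Fin 3 → E 2) (z : E 2) :
    inner ℝ (orientVec q) z =
      z 0 * ((q 1 1 - q 0 1) * (q 2 2 - q 0 2) - (q 1 2 - q 0 2) * (q 2 1 - q 0 1)) -
      z 1 * ((q 1 0 - q 0 0) * (q 2 2 - q 0 2) - (q 1 2 - q 0 2) * (q 2 0 - q 0 0)) +
      z 2 * ((q 1 0 - q 0 0) * (q 2 1 - q 0 1) - (q 1 1 - q 0 1) * (q 2 0 - q 0 0)) := by
  have h : ∀ (a : Fin 3 → ℝ) (f : Fin 2 → Fin 3 → ℝ),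
      (Fin.cons a f : Fin 3 → Fin 3 → ℝ) 2 = f 1 := fun _ _ => rfl
  rw [orientVec, inner_wedge, Matrix.det_fin_three]
  simp [edge, h]
  ring

theorem integral_quadratic {t₀ t₁ : ℝ} (ht : t₀ < t₁) (a b c : ℝ) :
    ∫ t in t₀..t₁, (a + b * ((t - t₀) / (t₁ - t₀)) + c * ((t - t₀) / (t₁ - t₀)) ^ 2) =
      (t₁ - t₀) * (a + b / 2 + c / 3) := by
  have h : t₁ - t₀ ≠ 0 := (sub_pos.2 ht).ne'
  simp only [sub_div]
  rw [intervalIntegral.integral_comp_div_sub (fun s => a + b * s + c * s ^ 2) h, sub_self,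
    ← sub_div, div_self h, smul_eq_mul, intervalIntegral.integral_add,
    intervalIntegral.integral_add, intervalIntegral.integral_const_mul,
    intervalIntegral.integral_const_mul, integral_pow, integral_id]
  · norm_num
    left
    ring
  all_goals exact Continuous.intervalIntegrable (by fun_prop) _ _

theorem inner_integral_orientVec {n : ℕ} (t₀ t₁ : ℝ) (q q' : Fin (n + 1) → E n) (z : E n) :
    inner ℝ z (∫ t in t₀..t₁, orientVec fun k =>
      ((t₁ - t) / (t₁ - t₀)) • q k + ((t - t₀) / (t₁ - t₀)) • q' k) =
    ∫ t in t₀..t₁, inner ℝ (orientVec fun k =>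
      ((t₁ - t) / (t₁ - t₀)) • q k + ((t - t₀) / (t₁ - t₀)) • q' k) z := by
  have hc : Continuous fun t : ℝ => orientVec fun k =>
      ((t₁ - t) / (t₁ - t₀)) • q k + ((t - t₀) / (t₁ - t₀)) • q' k := by
    refine continuous_orientVec.comp (continuous_pi fun k => ?_)
    fun_prop
  have := (innerSL ℝ z).intervalIntegral_comp_comm (hc.intervalIntegrable (μ := volume) t₀ t₁)
  simp only [innerSL_apply_apply] at this
  rw [← this]
  simp only [real_inner_comm]

/-- A plane polygon that changes its vertices one after the other sweeps the same area as the
polygon that moves linearly. -/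
theorem sum_hdet_sweepTuple_one {t₀ t₁ : ℝ} (ht : t₀ < t₁) (U : Fin 2 → ℕ × E 1 × E 1)
    (hU : Function.Injective fun k => (U k).1) :
    (t₁ - t₀) * ∑ k : Fin 2, hdet (sweepTuple U k) = -∑ k : Fin 2, inner ℝ ((U k).2.2 - (U k).2.1)
      (∫ t in t₀..t₁, orientVec fun k =>
        ((t₁ - t) / (t₁ - t₀)) • (U k).2.1 + ((t - t₀) / (t₁ - t₀)) • (U k).2.2) := by
  have h : t₁ - t₀ ≠ 0 := (sub_pos.2 ht).ne'
  have hp : ∀ z : E 1, inner ℝ z (∫ t in t₀..t₁, orientVec fun k =>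
        ((t₁ - t) / (t₁ - t₀)) • (U k).2.1 + ((t - t₀) / (t₁ - t₀)) • (U k).2.2) =
      (t₁ - t₀) * ((inner ℝ (orientVec fun k => (U k).2.1) z +
        inner ℝ (orientVec fun k => (U k).2.2) z) / 2) := by
    intro z
    rw [inner_integral_orientVec]
    have h1 := integral_quadratic ht (inner ℝ (orientVec fun k => (U k).2.1) z)
      (inner ℝ (orientVec fun k => (U k).2.2) z - inner ℝ (orientVec fun k => (U k).2.1) z) 0
    rw [show (t₁ - t₀) * ((inner ℝ (orientVec fun k => (U k).2.1) z +
        inner ℝ (orientVec fun k => (U k).2.2) z) / 2) = (t₁ - t₀) *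
        (inner ℝ (orientVec fun k => (U k).2.1) z + (inner ℝ (orientVec fun k => (U k).2.2) z -
          inner ℝ (orientVec fun k => (U k).2.1) z) / 2 + 0 / 3) by ring, ← h1]
    congr 1
    funext t
    have h2 : (t₁ - t) / (t₁ - t₀) = 1 - (t - t₀) / (t₁ - t₀) := by field_simp; ring
    rw [h2]
    simp only [inner_orientVec_one, PiLp.add_apply, PiLp.smul_apply, smul_eq_mul]
    ring
  simp only [hp]
  have h01 : (U 0).1 ≠ (U 1).1 := fun h => absurd (hU h) (by simp)
  simp only [Fin.sum_univ_two, sweepTuple, hdet_cons, inner_orientVec_one, stage]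
  rcases lt_or_gt_of_ne h01 with h1 | h1 <;>
    simp only [h1, h1.not_gt, lt_irrefl, if_true, if_false, PiLp.sub_apply] <;> ring

/-- The difference between the volumes swept by an edge in two ways: with its end points moving one
after the other, and with both moving linearly. It is half of the tetrahedron spanned by the four
positions, with a sign that depends on the order. -/
noncomputable def lateralDefect (U : Fin 2 → ℕ × E 2 × E 2) : ℝ :=
  ((SignType.sign (((U 1).1 : ℤ) - (U 0).1) : SignType) : ℝ) / 2 *
    hdet ![(U 0).2.1, (U 1).2.1, (U 0).2.2, (U 1).2.2]

theorem hdet_vecCons (a b c d : E 2) :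
    hdet ![a, b, c, d] = inner ℝ (orientVec ![b, c, d]) (b - a) :=
  hdet_cons a ![b, c, d]

/-- A triangle that changes its vertices one after the other sweeps the same volume as the triangle
that moves linearly, up to the defects at its edges. -/
theorem sum_hdet_sweepTuple_two {t₀ t₁ : ℝ} (ht : t₀ < t₁) (U : Fin 3 → ℕ × E 2 × E 2)
    (hU : Function.Injective fun k => (U k).1) :
    (t₁ - t₀) * ∑ k : Fin 3, hdet (sweepTuple U k) = -∑ k : Fin 3, inner ℝ ((U k).2.2 - (U k).2.1)
      (∫ t in t₀..t₁, orientVec fun k =>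
        ((t₁ - t) / (t₁ - t₀)) • (U k).2.1 + ((t - t₀) / (t₁ - t₀)) • (U k).2.2) +
      (t₁ - t₀) * ∑ m : Fin 3, (-1) ^ (m : ℕ) * lateralDefect (U ∘ m.succAbove) := by
  have h : t₁ - t₀ ≠ 0 := (sub_pos.2 ht).ne'
  have hp : ∀ z : E 2, inner ℝ z (∫ t in t₀..t₁, orientVec fun k =>
        ((t₁ - t) / (t₁ - t₀)) • (U k).2.1 + ((t - t₀) / (t₁ - t₀)) • (U k).2.2) =
      (t₁ - t₀) * ((inner ℝ (orientVec fun k => (U k).2.1) z +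
        inner ℝ (orientVec fun k => (U k).2.2) z) / 2 -
        inner ℝ (orientVec fun k => (U k).2.2 - (U k).2.1) z / 6) := by
    intro z
    rw [inner_integral_orientVec]
    set a := inner ℝ (orientVec fun k => (U k).2.1) z with ha
    set b := inner ℝ (orientVec fun k => (U k).2.2) z with hb
    set c := inner ℝ (orientVec fun k => (U k).2.2 - (U k).2.1) z with hc
    have h1 := integral_quadratic ht a (b - a - c) c
    rw [show (t₁ - t₀) * ((a + b) / 2 - c / 6) = (t₁ - t₀) * (a + (b - a - c) / 2 + c / 3) by ring,
      ← h1]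
    congr 1
    funext t
    have h2 : (t₁ - t) / (t₁ - t₀) = 1 - (t - t₀) / (t₁ - t₀) := by field_simp; ring
    rw [h2, ha, hb, hc]
    generalize (t - t₀) / (t₁ - t₀) = τ
    simp only [inner_orientVec_two, PiLp.add_apply, PiLp.sub_apply, PiLp.smul_apply, smul_eq_mul]
    ring
  simp only [hp, ← mul_add, ← Finset.mul_sum, ← mul_neg]
  congr 1
  have h01 : (U 0).1 ≠ (U 1).1 := fun h => absurd (hU h) (by simp)
  have h02 : (U 0).1 ≠ (U 2).1 := fun h => absurd (hU h) (by simp)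
  have h12 : (U 1).1 ≠ (U 2).1 := fun h => absurd (hU h) (by simp)
  have s0 : ∀ a b : ℕ, a < b → SignType.sign ((b : ℤ) - a) = 1 := fun a b h =>
    sign_pos (by omega)
  have s1 : ∀ a b : ℕ, b < a → SignType.sign ((b : ℤ) - a) = -1 := fun a b h =>
    sign_neg (by omega)
  have a1 : Fin.succAbove (0 : Fin 3) (0 : Fin 2) = 1 := rfl
  have a2 : Fin.succAbove (0 : Fin 3) (1 : Fin 2) = 2 := rfl
  have a3 : Fin.succAbove (1 : Fin 3) (0 : Fin 2) = 0 := rfl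
  have a4 : Fin.succAbove (1 : Fin 3) (1 : Fin 2) = 2 := rfl
  have a5 : Fin.succAbove (2 : Fin 3) (0 : Fin 2) = 0 := rfl
  have a6 : Fin.succAbove (2 : Fin 3) (1 : Fin 2) = 1 := rfl
  have v0 : ((0 : Fin 3) : ℕ) = 0 := rfl
  have v1 : ((1 : Fin 3) : ℕ) = 1 := rfl
  have v2 : ((2 : Fin 3) : ℕ) = 2 := rfl
  simp only [Fin.sum_univ_three, sweepTuple, hdet_cons, lateralDefect, hdet_vecCons,
    Function.comp_apply, inner_orientVec_two, stage, a1, a2, a3, a4, a5, a6, v0, v1, v2,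
    Matrix.cons_val_zero, Matrix.cons_val_one, Matrix.cons_val, PiLp.sub_apply]
  rcases lt_or_gt_of_ne h01 with h1 | h1 <;> rcases lt_or_gt_of_ne h02 with h2 | h2 <;>
    rcases lt_or_gt_of_ne h12 with h3 | h3 <;>
    first
    | omega
    | (simp only [h1, h2, h3, h1.not_gt, h2.not_gt, h3.not_gt, lt_irrefl, if_true, if_false,
        s0, s1, SignType.coe_one, SignType.coe_neg_one]
       ring)

end sweptVolume

end SurfaceCluster

namespace SurfaceCluster

open MeasureTheory

/-! ### The integral of the signed indicator function of a simplex -/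

section volume

variable {n : ℕ}

theorem hdet_eq_det (w : Fin (n + 2) → E n) :
    hdet w = Matrix.det (Matrix.of fun k : Fin (n + 1) => (w k.succ - w 0).ofLp) := by
  have hw : (Fin.cons (w 0) (fun k => w k.succ) : Fin (n + 2) → E n) = w := by
    funext k; exact Fin.cases rfl (fun k => rfl) k
  rw [← hw, hdet_cons, orientVec, inner_wedge]
  refine (Matrix.det_eq_of_forall_row_eq_smul_add_const
    (Fin.cons 0 (fun _ => 1) : Fin (n + 1) → ℝ) 0 rfl fun i j => ?_).symm
  refine Fin.cases ?_ (fun i => ?_) i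
  · simp
  · simp [edge]

/-- The standard simplex with vertices `0, e_1, …, e_d`. -/
noncomputable def stdVertex : Fin (n + 2) → E n :=
  Fin.cons 0 fun k => EuclideanSpace.single k 1

open scoped Pointwise in
theorem volume_convexHull (w : Fin (n + 2) → E n) :
    volume (convexHull ℝ (Set.range w)) =
      ENNReal.ofReal |hdet w| * volume (convexHull ℝ (Set.range (stdVertex (n := n)))) := by
  set b := (EuclideanSpace.basisFun (Fin (n + 1)) ℝ).toBasis with hb
  set L : E n →ₗ[ℝ] E n := b.constr ℝ fun k => w k.succ - w 0 with hL
  have hLk : ∀ k, L (EuclideanSpace.single k 1) = w k.succ - w 0 := fun k => by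
    have h1 : b k = EuclideanSpace.single k 1 := by simp [hb]
    rw [← h1, hL]
    exact b.constr_basis ℝ _ k
  have hdet' : LinearMap.det L = hdet w := by
    rw [hdet_eq_det, ← LinearMap.det_toMatrix b, ← Matrix.det_transpose]
    congr 1
    ext i j
    simp [LinearMap.toMatrix_apply, hb, hLk]
  have himg : Set.range w = w 0 +ᵥ L '' Set.range (stdVertex (n := n)) := by
    rw [← Set.range_comp, ← Set.image_vadd, ← Set.range_comp]
    congr 1
    funext k
    refine Fin.cases ?_ (fun k => ?_) k
    · simp [stdVertex]
    · simp [stdVertex, hLk]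
  rw [himg, convexHull_vadd, measure_vadd, ← LinearMap.image_convexHull,
    Measure.addHaar_image_linearMap, hdet']

theorem signedIndicator_eq_indicator (w : Fin (n + 2) → E n) :
    (fun x => (signedIndicator w x : ℝ)) = (convexHull ℝ (Set.range w)).indicator
      fun _ => ((SignType.sign (hdet w) : SignType) : ℝ) := by
  classical
  funext x
  rw [signedIndicator, Set.indicator_apply]
  split_ifs
  · generalize SignType.sign (hdet w) = s
    revert s; intro s; cases s <;> simp
  · simp

theorem measurableSet_convexHull_range {ι : Type*} [Finite ι] (w : ι → E n) :
    MeasurableSet (convexHull ℝ (Set.range w)) :=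
  ((Set.finite_range w).isClosed_convexHull ℝ).measurableSet

theorem integrable_signedIndicator (w : Fin (n + 2) → E n) :
    Integrable fun x => (signedIndicator w x : ℝ) := by
  rw [signedIndicator_eq_indicator, integrable_indicator_iff (measurableSet_convexHull_range w)]
  exact integrableOn_const ((Set.finite_range w).isCompact_convexHull ℝ).measure_lt_top.ne

theorem integral_signedIndicator (w : Fin (n + 2) → E n) :
    ∫ x, (signedIndicator w x : ℝ) =
      hdet w * volume.real (convexHull ℝ (Set.range (stdVertex (n := n)))) := by
  rw [signedIndicator_eq_indicator, integral_indicator_const _ (measurableSet_convexHull_range w),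
    Measure.real, volume_convexHull, ENNReal.toReal_mul, ENNReal.toReal_ofReal (abs_nonneg _),
    smul_eq_mul, mul_right_comm, abs_mul_sign, Measure.real]

end volume

/-! ### Conservation of the volume -/

namespace ClusterMesh

variable {n : ℕ} {T : ClusterMesh n} {D : T.Walls} {ρ : T.RegionData} {X X' : T.VectorField}

/-- The first equation of the scheme, tested with weights that are constant on each surface. -/
theorem IsSolution.sum_weight_inner {g : Anisotropy n} {t₀ t₁ : ℝ} (ht : t₀ < t₁)
    {t : Fin g.L → ∀ i, Fin (T.numSimp i) → Fin n → E n} {κ : T.ScalarField}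
    (hX : IsCluster D X) (hsol : IsSolution g D t₀ t₁ X t X' κ) (χ : Fin T.numSurf → ℤ)
    (hχ : ∀ k, (T.tjFacets k 0).Nonempty →
      ∑ j, ((T.orient k j : ℤˣ) : ℤ) * χ (T.tjSurf k j) = 0) :
    ∑ i, (χ i : ℝ) * ∑ a, ∑ k, inner ℝ (onSimplex X' i a k - onSimplex X i a k)
      (∫ t in t₀..t₁, orientVec fun k => ((t₁ - t) / (t₁ - t₀)) • onSimplex X i a k +
        ((t - t₀) / (t₁ - t₀)) • onSimplex X' i a k) = 0 := by
  have hW : InW (fun i (_ : Fin (T.numVtx i)) => (χ i : ℝ)) := by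
    intro k l
    have hl : T.rho k 0 l ∈ Set.range (T.rho k 0) := ⟨l, rfl⟩
    rw [T.rho_range] at hl
    obtain ⟨F, hF, -⟩ := hl
    change ∑ j, _ * (χ (T.tjSurf k j) : ℝ) = 0
    exact_mod_cast hχ k ⟨F, hF⟩
  have h1 := hsol.eq_one _ hW
  have h2 : gradInner X κ (fun i (_ : Fin (T.numVtx i)) => (χ i : ℝ)) = 0 := by
    refine Finset.sum_eq_zero fun i _ => Finset.sum_eq_zero fun a _ => ?_
    have : onSimplex (fun i (_ : Fin (T.numVtx i)) => (χ i : ℝ)) i a = fun _ => (χ i : ℝ) := rfl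
    rw [this, surfGrad_const, inner_zero_right, mul_zero]
  have hdt : t₁ - t₀ ≠ 0 := (sub_pos.2 ht).ne'
  rw [h2, sub_zero, mul_eq_zero] at h1
  have h3 := h1.resolve_left (one_div_ne_zero hdt)
  have hterm : ∀ i a k, area (onSimplex X i a) * inner ℝ (onSimplex (X' - X) i a k)
      ((χ i : ℝ) • weightedNormal t₀ t₁ (onSimplex X i a) (onSimplex X' i a)) =
      ((n ! : ℝ)⁻¹ * (t₁ - t₀)⁻¹) * ((χ i : ℝ) *
        inner ℝ (onSimplex X' i a k - onSimplex X i a k)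
          (∫ t in t₀..t₁, orientVec fun k => ((t₁ - t) / (t₁ - t₀)) • onSimplex X i a k +
            ((t - t₀) / (t₁ - t₀)) • onSimplex X' i a k)) := by
    intro i a k
    have hA : ‖orientVec (onSimplex X i a)‖ ≠ 0 :=
      norm_ne_zero_iff.2 (orientVec_ne_zero (hX.nondegenerate i a))
    rw [inner_smul_right, weightedNormal, inner_smul_right, area]
    have : onSimplex (X' - X) i a k = onSimplex X' i a k - onSimplex X i a k := rfl
    rw [this]
    field_simp
  have hfac : ((n + 1 : ℕ) : ℝ)⁻¹ * ((n ! : ℝ)⁻¹ * (t₁ - t₀)⁻¹) ≠ 0 := by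
    have h5 : ((n + 1 : ℕ) : ℝ) ≠ 0 := by positivity
    have h6 : (n ! : ℝ) ≠ 0 := by positivity
    exact mul_ne_zero (inv_ne_zero h5) (mul_ne_zero (inv_ne_zero h6) (inv_ne_zero hdt))
  refine (mul_eq_zero.1 ?_).resolve_left hfac
  rw [← h3, lumped, Finset.mul_sum]
  refine Finset.sum_congr rfl fun i _ => ?_
  rw [one_div, mul_assoc]
  congr 1
  simp only [Finset.mul_sum]
  refine Finset.sum_congr rfl fun a _ => Finset.sum_congr rfl fun k _ => ?_
  exact (hterm i a k).symm

theorem lateralDefect_perm (U : Fin 2 → ℕ × E 2 × E 2) (π : Equiv.Perm (Fin 2)) :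
    lateralDefect (U ∘ π) = ((Equiv.Perm.sign π : ℤ) : ℝ) * lateralDefect U := by
  have h : ∀ π : Equiv.Perm (Fin 2), π = 1 ∨ π = Equiv.swap 0 1 := by decide
  rcases h π with rfl | rfl
  · simp
  · have h1 : ((U 0).1 : ℤ) - (U 1).1 = -(((U 1).1 : ℤ) - (U 0).1) := by ring
    rw [Equiv.Perm.sign_swap (by simp)]
    simp only [lateralDefect, Function.comp_apply, Equiv.swap_apply_left, Equiv.swap_apply_right,
      h1, Left.sign_neg, SignType.coe_neg, hdet_vecCons, inner_orientVec_two,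
      Matrix.cons_val_zero, Matrix.cons_val_one, Matrix.cons_val, PiLp.sub_apply]
    push_cast
    ring

theorem hdet_eq_zero_of_plane {w : Fin (n + 2) → E n} {ν : E n} (hν : ν ≠ 0) {c : ℝ}
    (h : ∀ k, inner ℝ ν (w k) = c) : hdet w = 0 := by
  by_contra hw
  obtain ⟨a, ha⟩ := exists_eq_sum_of_hvol_ne_zero hw (0, ν)
  rw [sum_smul_hom] at ha
  obtain ⟨ha0, ha1⟩ := Prod.mk.inj ha
  have h1 : inner ℝ ν ν = (0 : ℝ) := by
    nth_rewrite 2 [← ha1]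
    simp only [inner_sum, inner_smul_right, h, ← Finset.sum_mul, ha0, zero_mul]
  exact hν (inner_self_eq_zero.1 h1)

/-- The volume swept by the bounding surfaces of a region in a time step vanishes. -/
theorem sum_weight_hdet_eq_zero (hn : n = 1 ∨ n = 2) {g : Anisotropy n} {t₀ t₁ : ℝ} (ht : t₀ < t₁)
    {t : Fin g.L → ∀ i, Fin (T.numSimp i) → Fin n → E n} {κ : T.ScalarField}
    (hX : IsCluster D X) (hsol : IsSolution g D t₀ t₁ X t X' κ)
    (hρ : ∀ k, (T.tjFacets k 0).Nonempty →
      ∑ j, ((T.orient k j : ℤˣ) : ℤ) * ρ.weight (T.tjSurf k j) = 0)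
    {r : E n → ℕ} (hr : Set.InjOn r (⋃ i, Set.range (X i))) :
    ∑ i, (ρ.weight i : ℝ) * ∑ a, ∑ k,
      hdet (sweepTuple (motion r X X' i ∘ T.vert i a) k) = 0 := by
  have h0 := hsol.sum_weight_inner ht hX ρ.weight hρ
  have hdt : t₁ - t₀ ≠ 0 := (sub_pos.2 ht).ne'
  refine (mul_eq_zero.1 ?_).resolve_left hdt
  have hcomb : ∀ H S Λ : ∀ i, Fin (T.numSimp i) → ℝ,
      (∀ i a, (t₁ - t₀) * H i a = -S i a + (t₁ - t₀) * Λ i a) →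
      ∑ i, (ρ.weight i : ℝ) * ∑ a, S i a = 0 → ∑ i, (ρ.weight i : ℝ) * ∑ a, Λ i a = 0 →
      (t₁ - t₀) * ∑ i, (ρ.weight i : ℝ) * ∑ a, H i a = 0 := by
    intro H S Λ h hS hΛ
    have : (t₁ - t₀) * ∑ i, (ρ.weight i : ℝ) * ∑ a, H i a =
        -∑ i, (ρ.weight i : ℝ) * ∑ a, S i a +
          (t₁ - t₀) * ∑ i, (ρ.weight i : ℝ) * ∑ a, Λ i a := by
      simp only [Finset.mul_sum, ← Finset.sum_neg_distrib, ← Finset.sum_add_distrib]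
      refine Finset.sum_congr rfl fun i _ => Finset.sum_congr rfl fun a _ => ?_
      linear_combination (ρ.weight i : ℝ) * h i a
    rw [this, hS, hΛ, neg_zero, mul_zero, add_zero]
  rcases hn with rfl | rfl
  · refine hcomb _ _ (fun _ _ => 0) (fun i a => ?_) h0 (by simp)
    rw [mul_zero, add_zero]
    exact sum_hdet_sweepTuple_one ht (motion r X X' i ∘ T.vert i a)
      (injective_rank_motion hX hr X' i a)
  · refine hcomb _ _ (fun i a => ∑ m : Fin 3,
        (-1) ^ (m : ℕ) * lateralDefect (motion r X X' i ∘ T.vert i a ∘ m.succAbove))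
      (fun i a => sum_hdet_sweepTuple_two ht (motion r X X' i ∘ T.vert i a)
        (injective_rank_motion hX hr X' i a)) h0 ?_
    refine sum_facets_eq_zero (u := motion r X X') (Λ := lateralDefect)
      (fun i => (ρ.weight i : ℝ)) (fun k hk => by exact_mod_cast hρ k hk) ?_ lateralDefect_perm ?_
    · intro k l j j'
      simp only [motion, hX.junction k l j j', hsol.mem_V k l j j']
    · intro k F hF f hf
      have hν : D.normal k ≠ 0 := fun h => by simpa [h] using D.norm_normal k
      have hplane : hdet ![X (T.blSurf k) (f 0), X (T.blSurf k) (f 1), X' (T.blSurf k) (f 0),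
          X' (T.blSurf k) (f 1)] = 0 := by
        refine hdet_eq_zero_of_plane hν (c := D.offset k) fun l => ?_
        fin_cases l
        · exact hX.attached k F hF _ (hf 0)
        · exact hX.attached k F hF _ (hf 1)
        · exact hX.inner_motion hsol.displacement hF (hf 0)
        · exact hX.inner_motion hsol.displacement hF (hf 1)
      refine mul_eq_zero_of_right _ (mul_eq_zero_of_right _ ?_)
      exact hplane

theorem RegionData.integrable_sweep (ρ : T.RegionData) (r : E n → ℕ) (X X' : T.VectorField) :
    Integrable fun x => (ρ.sweep r X X' x : ℝ) := by
  simp only [RegionData.sweep]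
  push_cast
  refine integrable_finsetSum _ fun i _ => Integrable.const_mul ?_ _
  exact integrable_finsetSum _ fun a _ => integrable_finsetSum _ fun k _ =>
    integrable_signedIndicator _

theorem RegionData.integral_sweep (ρ : T.RegionData) (r : E n → ℕ) (X X' : T.VectorField) :
    ∫ x, (ρ.sweep r X X' x : ℝ) = (∑ i, (ρ.weight i : ℝ) * ∑ a, ∑ k,
      hdet (sweepTuple (motion r X X' i ∘ T.vert i a) k)) *
        volume.real (convexHull ℝ (Set.range (stdVertex (n := n)))) := by
  simp only [RegionData.sweep]
  push_cast
  rw [integral_finsetSum _ fun i _ => (integrable_finsetSum _ fun a _ => integrable_finsetSum _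
    fun k _ => integrable_signedIndicator _).const_mul _, Finset.sum_mul]
  refine Finset.sum_congr rfl fun i _ => ?_
  rw [integral_const_mul, mul_assoc, integral_finsetSum _ fun a _ => integrable_finsetSum _
    fun k _ => integrable_signedIndicator _, Finset.sum_mul]
  congr 1
  refine Finset.sum_congr rfl fun a _ => ?_
  rw [integral_finsetSum _ fun k _ => integrable_signedIndicator _, Finset.sum_mul]
  exact Finset.sum_congr rfl fun k _ => integral_signedIndicator _

theorem Walls.ae_notMem (D : T.Walls) :
    ∀ᵐ x : E n, ∀ k, inner ℝ (D.normal k) x ≠ D.offset k := by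
  rw [ae_all_iff]
  intro k
  set S : AffineSubspace ℝ (E n) := AffineSubspace.mk' (D.offset k • D.normal k)
    (LinearMap.ker (innerₛₗ ℝ (D.normal k))) with hS
  have hν : inner ℝ (D.normal k) (D.normal k) = (1 : ℝ) := by
    rw [real_inner_self_eq_norm_sq, D.norm_normal, one_pow]
  have hmem : ∀ x, x ∈ S ↔ inner ℝ (D.normal k) x = D.offset k := by
    intro x
    rw [hS, AffineSubspace.mem_mk', vsub_eq_sub, LinearMap.mem_ker, innerₛₗ_apply_apply,
      inner_sub_right, inner_smul_right, hν, mul_one, sub_eq_zero]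
  have htop : S ≠ ⊤ := by
    intro h
    have h1 := (hmem ((D.offset k + 1) • D.normal k)).1 (h ▸ AffineSubspace.mem_top ℝ _ _)
    rw [inner_smul_right, hν] at h1
    linarith
  filter_upwards [measure_eq_zero_iff_ae_notMem.1 (Measure.addHaar_affineSubspace volume S htop)]
    with x hx h
  exact hx ((hmem x).2 h)

/-- The bounding surfaces sweep points of the container only, up to points of the external
planes. -/
theorem IsEnclosedRegion.sweep_eq_zero {R R' : Set (E n)} (hR : IsEnclosedRegion D ρ X R)
    (hR' : IsEnclosedRegion D ρ X' R') (r : E n → ℕ) :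
    ∀ᵐ x : E n, x ∉ ρ.container D → ρ.sweep r X X' x = 0 := by
  filter_upwards [D.ae_notMem] with x hne hxK
  refine Finset.sum_eq_zero fun i _ => ?_
  by_cases hi : i ∈ ρ.surfaces
  swap
  · rw [RegionData.weight, if_neg hi, zero_mul]
  refine mul_eq_zero_of_right _ (Finset.sum_eq_zero fun a _ => Finset.sum_eq_zero fun k _ => ?_)
  refine if_neg fun hmem => hxK ?_
  set S : Set (E n) := ρ.trunc ∩ {x | ∀ k ∈ ρ.planes, D.offset k ≤ inner ℝ (D.normal k) x} with hS
  have hconv : Convex ℝ S := by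
    refine ρ.convex_trunc.inter ?_
    have : {x : E n | ∀ k ∈ ρ.planes, D.offset k ≤ inner ℝ (D.normal k) x} =
        ⋂ k ∈ ρ.planes, {x | D.offset k ≤ inner ℝ (D.normal k) x} := by
      ext x; simp
    rw [this]
    exact convex_iInter₂ fun k _ => convex_halfSpace_ge (innerₛₗ ℝ (D.normal k)).isLinear _
  have hx : x ∈ S := by
    refine convexHull_min ?_ hconv hmem
    rintro _ ⟨l, rfl⟩
    exact sweepTuple_mem
      (fun c => hR.surf_subset i hi (Set.mem_iUnion.2 ⟨a, subset_convexHull ℝ _ ⟨c, rfl⟩⟩))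
      (fun c => hR'.surf_subset i hi (Set.mem_iUnion.2 ⟨a, subset_convexHull ℝ _ ⟨c, rfl⟩⟩)) k l
  exact ⟨hx.1, fun k hk => lt_of_le_of_ne (hx.2 k hk) (hne k).symm⟩

/-- A solution of the scheme conserves the volumes of the enclosed regions. -/
theorem IsSolution.volume_eq (hn : n = 1 ∨ n = 2) {g : Anisotropy n} {t₀ t₁ : ℝ} (ht : t₀ < t₁)
    {t : Fin g.L → ∀ i, Fin (T.numSimp i) → Fin n → E n} {κ : T.ScalarField}
    (hX : IsCluster D X) (hsol : IsSolution g D t₀ t₁ X t X' κ) {R R' : Set (E n)}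
    (hR : IsEnclosedRegion D ρ X R) (hR' : IsEnclosedRegion D ρ X' R') :
    volume R' = volume R := by
  have hn0 : n ≠ 0 := by omega
  obtain ⟨r, hr⟩ := exists_rank X
  obtain ⟨c, hc⟩ := exists_ae_indic_sub_indic hn0 hX hsol.mem_V hsol.displacement hR hR' hr
  have hint : ∫ x in ρ.container D, (ρ.sweep r X X' x : ℝ) = 0 := by
    rw [setIntegral_eq_integral_of_ae_compl_eq_zero, RegionData.integral_sweep,
      sum_weight_hdet_eq_zero hn ht hX hsol (fun k hk => hR.sum_orient_weight hn0 hX hk) hr,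
      zero_mul]
    filter_upwards [hR.sweep_eq_zero hR' r] with x hx hxK
    rw [hx hxK, Int.cast_zero]
  have hKm : MeasurableSet (ρ.container D) := ρ.isOpen_container.measurableSet
  -- the indicator functions are integrable
  have hind : ∀ {S : Set (E n)}, IsOpen S → Bornology.IsBounded S → S ⊆ ρ.container D →
      IntegrableOn (fun x => (indic S x : ℝ)) (ρ.container D) ∧
        ∫ x in ρ.container D, (indic S x : ℝ) = volume.real S := by
    classical
    intro S hS hSb hSK
    have h1 : (fun x => (indic S x : ℝ)) = S.indicator fun _ => 1 := by
      funext x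
      rw [indic, Set.indicator_apply]
      split_ifs <;> simp
    rw [h1]
    refine ⟨?_, ?_⟩
    · refine Integrable.integrableOn ?_
      rw [integrable_indicator_iff hS.measurableSet]
      exact integrableOn_const hSb.measure_lt_top.ne
    · rw [setIntegral_indicator hS.measurableSet, Set.inter_eq_self_of_subset_right hSK,
        setIntegral_const, smul_eq_mul, mul_one]
  obtain ⟨hi, hv⟩ := hind hR.isOpen hR.isBounded hR.subset
  obtain ⟨hi', hv'⟩ := hind hR'.isOpen hR'.isBounded hR'.subset
  have hae : (fun x => (indic R x : ℝ) - (indic R' x : ℝ) - (ρ.sweep r X X' x : ℝ))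
      =ᵐ[volume.restrict (ρ.container D)] fun _ => (c : ℝ) := by
    rw [Filter.EventuallyEq, ae_restrict_iff' hKm]
    filter_upwards [hc] with x hx hxK
    have : (indic R x : ℝ) - (indic R' x : ℝ) = (ρ.sweep r X X' x : ℝ) + c := by
      exact_mod_cast hx hxK
    linarith
  have hsi := (ρ.integrable_sweep r X X').integrableOn (s := ρ.container D)
  have hci : IntegrableOn (fun _ : E n => (c : ℝ)) (ρ.container D) :=
    ((hi.sub hi').sub hsi).congr hae
  have hdiff : volume.real R - volume.real R' = volume.real (ρ.container D) * c := by
    have h1 := integral_congr_ae hae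
    rw [integral_sub (f := fun x => (indic R x : ℝ) - (indic R' x : ℝ)) (hi.sub hi') hsi,
      integral_sub hi hi', hint, hv, hv', sub_zero,
      setIntegral_const, smul_eq_mul] at h1
    exact h1
  -- an integer multiple of the volume of the container that is smaller than this volume
  have hc0 : c = 0 := by
    by_contra hne
    have hfin : volume (ρ.container D) ≠ ⊤ := by
      rcases (integrableOn_const_iff).1 hci with h | h
      · exact absurd (by simpa using h) hne
      · exact h.ne
    have hpos : ∀ {S : Set (E n)}, IsOpen S → S.Nonempty → S ⊆ ρ.container D →
        0 < volume.real S ∧ volume.real S ≤ volume.real (ρ.container D) := by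
      intro S hS hSn hSK
      refine ⟨ENNReal.toReal_pos (hS.measure_pos volume hSn).ne' ?_, measureReal_mono hSK hfin⟩
      exact ne_top_of_le_ne_top hfin (measure_mono hSK)
    obtain ⟨h1, h2⟩ := hpos hR.isOpen hR.nonempty hR.subset
    obtain ⟨h3, h4⟩ := hpos hR'.isOpen hR'.nonempty hR'.subset
    rcases lt_or_gt_of_ne hne with hneg | hpos'
    · have h5 : (c : ℝ) ≤ -1 := by exact_mod_cast (by omega : c ≤ -1)
      nlinarith
    · have h5 : (1 : ℝ) ≤ c := by exact_mod_cast (by omega : 1 ≤ c)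
      nlinarith
  rw [hc0, Int.cast_zero, mul_zero, sub_eq_zero] at hdiff
  exact ((measureReal_eq_measureReal_iff hR.isBounded.measure_lt_top.ne
    hR'.isBounded.measure_lt_top.ne).1 hdiff).symm

end ClusterMesh

end SurfaceCluster

open SurfaceCluster SurfaceCluster.ClusterMesh MeasureTheory in
/-- Stability and volume conservation of the anisotropic scheme, in dimension `d = n + 1`. -/
theorem theorem4p1 (n : ℕ) (hn : n = 1 ∨ n = 2) (g : Anisotropy n) (T : ClusterMesh n)
    (D : T.Walls) (t₀ t₁ : ℝ) (ht : t₀ < t₁)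
    (X : T.VectorField) (hX : IsCluster D X)
    (t : Fin g.L → ∀ i, Fin (T.numSimp i) → Fin n → E n)
    (hframe : ∀ l i a, IsTangentFrame (g.Gtilde l) (onSimplex X i a) (t l i a))
    (X' : T.VectorField) (κ : T.ScalarField) (hsol : IsSolution g D t₀ t₁ X t X' κ) :
    energy g X' + (t₁ - t₀) * gradInner X κ κ ≤ energy g X ∧
    ∀ (ρ : T.RegionData) (R R' : Set (E n)),
      IsEnclosedRegion D ρ X R → IsEnclosedRegion D ρ X' R' →
        volume R' = volume R := by
  exact ⟨energy_add_le hn ht hX hframe hsol, fun ρ R R' hR hR' => hsol.volume_eq hn ht hX hR hR'⟩
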